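/- Let $K$ be a field of characteristic zero, $d\ge 0$ and $R=K[[x_1,\dots,x_d]]$. An \emph{$R$-variety} is an integral separated scheme of finite type over $\operatorname{Spec}R$. Let $X$ be a non-singular $R$-variety (all its local rings are regular), and let $\mathfrak a=\prod_j\mathfrak a_j^{r_j}$ be an $\mathbb R$-ideal on $X$, that is, a formal product of finitely many coherent ideal sheaves $\mathfrak a_j$ with exponents $r_j>0$ in $\mathbb R$. A \emph{divisor over $X$} is a prime divisor $E$ on a normal $R$-variety $Y$ with a birational morphism $f\colon Y\to X$ over $R$; its \emph{centre} on $X$ is $\overline{f(E)}$. Its log discrepancy is $$a_E(X,\mathfrak a)=1+\operatorname{ord}_EK_{Y/X}-\sum_j r_j\operatorname{ord}_E(\mathfrak a_j\mathcal O_Y)\in[-\infty,\infty),$$ where the relative canonical divisor $K_{Y/X}$ is, on the non-singular locus of $Y$, the effective divisor defined by the zeroth Fitting ideal of $\Omega_{Y/X}$, and the order of the zero ideal is $+\infty$. A \emph{non-klt centre} of $(X,\mathfrak a)$ is the centre on $X$ of a divisor $E$ over $X$ with $a_E(X,\mathfrak a)\le 0$. Let $S$ be the union of all non-klt centres of codimension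 $1$ of $(X,\mathfrak a)$, regarded as a reduced closed subscheme of $X$. (If all $\mathfrak a_j$ are non-zero, this union is finite, hence closed; in general $S$ denotes its closure.) Let $T$ be the set of points $x\in S$ such that $\mathcal O_{S,x}$ is not an integrally closed domain. Then every irreducible component of $T$ is a non-klt centre of $(X,\mathfrak a)$. -/

import Mathlib

open AlgebraicGeometry CategoryTheory TopologicalSpace
open scoped ENNReal

universe u

namespace RVar

noncomputable section

/-! ### Commutative algebra -/

/-- A local ring is normal if it is an integrally closed domain. -/
def IsNormalLocalRing (A : Type*) [CommRing A] : Prop :=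
  IsDomain A ∧ IsIntegrallyClosed A

/-- The order of an ideal `I` of a local ring `A`: the supremum (in `ℕ ∪ {∞}`) of the `n` such
that `I` is contained in the `n`-th power of the maximal ideal. -/
def idealOrder (A : Type*) [CommRing A] [IsLocalRing A] (I : Ideal A) : ℕ∞ :=
  ⨆ (n : ℕ) (_ : I ≤ IsLocalRing.maximalIdeal A ^ n), (n : ℕ∞)

/-- The zeroth Fitting ideal of a finitely generated module `M`: it is generated by the
determinants of the square matrices whose rows are relations among a finite family of generators
of `M` (the ideal obtained from one such family does not depend on the family). -/
def fittingIdealZero (A M : Type*) [CommRing A] [AddCommGroup M] [Module A M] : Ideal A :=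
  Ideal.span {δ : A | ∃ (n : ℕ) (m : Fin n → M) (a : Matrix (Fin n) (Fin n) A),
    Submodule.span A (Set.range m) = ⊤ ∧ (∀ i, ∑ j, a i j • m j = 0) ∧ a.det = δ}

/-! ### Varieties over a formal power series ring -/

/-- `Spec K⟦x₁, …, x_d⟧`. -/
abbrev baseScheme (K : Type u) [Field K] (d : ℕ) : Scheme.{u} :=
  Spec (CommRingCat.of (MvPowerSeries (Fin d) K))

/-- An `R`-variety, `R = K⟦x₁, …, x_d⟧`: an integral separated scheme of finite type over
`Spec R`. -/
structure IsRVariety {K : Type u} [Field K] {d : ℕ} {X : Scheme.{u}}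
    (s : X ⟶ baseScheme K d) : Prop where
  isIntegral : IsIntegral X
  isSeparated : IsSeparated s
  locallyOfFiniteType : LocallyOfFiniteType s
  quasiCompact : QuasiCompact s

/-- A scheme is non-singular if all its local rings are regular. -/
def IsNonsingular (X : Scheme.{u}) : Prop :=
  ∀ x : X, IsRegularLocalRing (X.presheaf.stalk x)

/-- A scheme is normal if all its local rings are integrally closed domains. -/
def IsNormalScheme (X : Scheme.{u}) : Prop :=
  ∀ x : X, IsNormalLocalRing (X.presheaf.stalk x)

/-- The non-normal locus of a scheme. -/
def nonNormalLocus (X : Scheme.{u}) : Set X :=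
  {x : X | ¬ IsNormalLocalRing (X.presheaf.stalk x)}

/-- A morphism is birational if it restricts to an isomorphism from a dense open subscheme of the
source onto a dense open subscheme of the target. -/
def IsBirational {Y X : Scheme.{u}} (f : Y ⟶ X) : Prop :=
  ∃ φ : Y.PartialIso X, φ.iso.hom ≫ φ.target.ι = φ.source.ι ≫ f

/-- The irreducible closed set `Z` has codimension one: its generic point has codimension one
(`Order.coheight` is taken in the specialization order of the points of `X`). -/
def IsCodimOne {X : Scheme.{u}} (Z : Set X) : Prop :=
  ∃ η : X, IsGenericPoint η Z ∧ Order.coheight η = 1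

/-! ### `ℝ`-ideals, divisors over `X`, log discrepancies -/

/-- An `ℝ`-ideal: a formal product of finitely many coherent ideal sheaves with positive real
exponents. -/
structure RIdeal (X : Scheme.{u}) where
  /-- The number of factors. -/
  n : ℕ
  /-- The ideal sheaves. -/
  ideal : Fin n → X.IdealSheafData
  /-- The exponents. -/
  exponent : Fin n → ℝ
  exponent_pos : ∀ j, 0 < exponent j

/-- The stalk at `x` of an ideal sheaf, as an ideal of the local ring at `x`. -/
def stalkIdeal {X : Scheme.{u}} (I : X.IdealSheafData) (x : X) : Ideal (X.presheaf.stalk x) :=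
  ⨆ (U : X.affineOpens) (hx : x ∈ U.1), (I.ideal U).map (X.presheaf.germ U.1 x hx).hom

/-- The stalk at `y` of the inverse image ideal sheaf `I 𝒪_Y` under `f : Y ⟶ X`. -/
def pullbackStalkIdeal {Y X : Scheme.{u}} (f : Y ⟶ X) (I : X.IdealSheafData) (y : Y) :
    Ideal (Y.presheaf.stalk y) :=
  (stalkIdeal I (f y)).map (f.stalkMap y).hom

/-- The stalk at `y` of the zeroth Fitting ideal of `Ω_{Y/X}`; this is the zeroth Fitting ideal of
the module of differentials of the local ring at `y` over the local ring at `f y`. -/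
def jacobianStalkIdeal {Y X : Scheme.{u}} (f : Y ⟶ X) (y : Y) : Ideal (Y.presheaf.stalk y) :=
  letI : Algebra (X.presheaf.stalk (f y)) (Y.presheaf.stalk y) := (f.stalkMap y).hom.toAlgebra
  fittingIdealZero (Y.presheaf.stalk y)
    (KaehlerDifferential (X.presheaf.stalk (f y)) (Y.presheaf.stalk y))

/-- A divisor over the `R`-variety `X`: a prime divisor on a normal `R`-variety `Y` with a
birational morphism to `X` over `R`. The prime divisor is given by its generic point, a point of
codimension one. -/
structure DivisorOver {K : Type u} [Field K] {d : ℕ} {X : Scheme.{u}}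
    (s : X ⟶ baseScheme K d) where
  /-- The model. -/
  Y : Scheme.{u}
  /-- The birational morphism. -/
  f : Y ⟶ X
  isRVariety : IsRVariety (f ≫ s)
  isNormal : IsNormalScheme Y
  isBirational : IsBirational f
  /-- The generic point of the prime divisor. -/
  point : Y
  coheight_point : Order.coheight point = 1

section

variable {K : Type u} [Field K] {d : ℕ} {X : Scheme.{u}} {s : X ⟶ baseScheme K d}

/-- The centre of `E` on `X`: the closure of the image of `E`. -/
def DivisorOver.centre (E : DivisorOver s) : Set X :=
  closure (E.f '' closure {E.point})

/-- The order along `E` of an `ℝ`-ideal on `X`, in `[0, ∞]`. -/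
def DivisorOver.ord (E : DivisorOver s) (𝔞 : RIdeal X) : ℝ≥0∞ :=
  ∑ j : Fin 𝔞.n, ENNReal.ofReal (𝔞.exponent j) *
    (idealOrder (E.Y.presheaf.stalk E.point) (pullbackStalkIdeal E.f (𝔞.ideal j) E.point) : ℝ≥0∞)

/-- The order along `E` of the relative canonical divisor `K_{Y/X}` (for non-singular `X`): away
from a closed subset of codimension two of `Y`, which does not contain the generic point of `E`,
`Y` is non-singular and `K_{Y/X}` is the effective divisor defined by the zeroth Fitting ideal of
`Ω_{Y/X}`. -/
def DivisorOver.ordCanonical (E : DivisorOver s) : ℕ∞ :=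
  idealOrder (E.Y.presheaf.stalk E.point) (jacobianStalkIdeal E.f E.point)

/-- The log discrepancy `a_E(X, 𝔞) = 1 + ord_E K_{Y/X} - ord_E 𝔞`; it is `-∞` if `𝔞` has a factor
with the zero ideal. -/
def DivisorOver.logDiscrepancy (E : DivisorOver s) (𝔞 : RIdeal X) : EReal :=
  1 + ((E.ordCanonical : ℝ≥0∞) : EReal) - (E.ord 𝔞 : EReal)

variable (s)

/-- `Z` is a non-klt centre of `(X, 𝔞)`: the centre of a divisor over `X` whose log discrepancy is
at most `0`. -/
def IsNonKltCentre (𝔞 : RIdeal X) (Z : Set X) : Prop :=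
  ∃ E : DivisorOver s, E.centre = Z ∧ E.logDiscrepancy 𝔞 ≤ 0

/-- The union of the non-klt centres of codimension one of `(X, 𝔞)`, as a closed subset of `X`.
If all the ideals are non-zero this is a finite union, and the closure changes nothing. -/
def codimOneLocus (𝔞 : RIdeal X) : Closeds X :=
  Closeds.closure (⋃₀ {Z : Set X | IsNonKltCentre s 𝔞 Z ∧ IsCodimOne Z})

/-- The ideal sheaf of `codimOneLocus`; the closed subscheme that it defines carries the reduced
structure. -/
def codimOneIdeal (𝔞 : RIdeal X) : X.IdealSheafData :=
  Scheme.IdealSheafData.vanishingIdeal (codimOneLocus s 𝔞)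

end

end

end RVar

/-! If `S` is all of `X`, then `T` is empty, since a regular scheme is normal. Otherwise the non-klt
centres of codimension one are finite in number and `S` is a union of prime divisors. Regular local
rings are factorial (`isPrincipal_of_height_eq_one`), so every component of `S` is locally given by
one equation.

A hypersurface in a regular scheme satisfies Serre's condition S₂. Its failure of normality is
therefore visible in codimension one on `S`: every point of `T` is a specialization of a point `x`
of `T` of codimension two in `X` (`exists_le_height_eq_two`). Locally there are only finitely many
such `x` (`finite_height_eq_two`), because finite-type algebras over power series rings have finite
normalization, at least generically; characteristic zero is needed only there. Hence each
irreducible component of `T` is the closure of one such `x`.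

It remains to produce a divisor with centre the closure of `x` and log discrepancy at most `0`. Near
the generic point of the centre, the exceptional divisor `E` of the blow-up at `x` works. The
relative canonical divisor has order at most one along `E`. For the order of `𝔞` there are two
cases. Either two components of `S` pass through `x`, each with an equation in the maximal ideal
`𝔪`; or there is only one, and its equation lies in `𝔪²`, since otherwise `S` would be regular at
`x`. In both cases `ord_E 𝔞 ≥ ord_{η₁} 𝔞 + ord_{η₂} 𝔞` for generic points `η₁`, `η₂` of components
of `S`, equal to each other in the second case (`exists_mul_mem_pow_of_not_isNormalQuotientAt`). A
divisor whose centre has codimension one has the same local ring as its centre, so `ord_{ηᵢ} 𝔞 ≥ 1`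
(`one_le_orderAt_of_isNonKltCentre`). Altogether `a_E ≤ 1 + 1 - 2 = 0`. -/

namespace RVar

open IsLocalRing

/-! ### Regular local rings: quotients by parameters, integrality -/

section RegularLocal

/-- Dividing by an element of `𝔪 \ 𝔪²` lowers the number of generators of the maximal ideal. -/
lemma spanFinrank_maximalIdeal_quotient_succ_le (A : Type*) [CommRing A] [IsLocalRing A]
    [IsNoetherianRing A] {x : A} (hx : x ∈ maximalIdeal A) (hx2 : x ∉ maximalIdeal A ^ 2)
    [IsLocalRing (A ⧸ Ideal.span {x})] :
    (maximalIdeal (A ⧸ Ideal.span {x})).spanFinrank + 1 ≤ (maximalIdeal A).spanFinrank := by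
  classical
  let v : CotangentSpace A := (maximalIdeal A).toCotangent ⟨x, hx⟩
  have hv : v ≠ 0 := by
    rw [Ne, Ideal.toCotangent_eq_zero]; exact hx2
  have hli : LinearIndepOn (ResidueField A) id ({v} : Set (CotangentSpace A)) :=
    LinearIndepOn.singleton (v := id) hv
  let b := Module.Basis.extend hli
  have hvb : v ∈ hli.extend (Set.subset_univ _) := Module.Basis.subset_extend hli (by simp)
  have hbt : Submodule.span (ResidueField A) (hli.extend (Set.subset_univ _)) = ⊤ := by
    have := b.span_eq
    rwa [Module.Basis.range_extend] at this
  have hfin : (hli.extend (Set.subset_univ _)).Finite := by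
    exact Module.Finite.finite_basis b
  have hcard : (hli.extend (Set.subset_univ _)).ncard = (maximalIdeal A).spanFinrank := by
    rw [spanFinrank_maximalIdeal_eq_finrank_cotangentSpace, Module.finrank_eq_nat_card_basis b,
      Nat.card_coe_set_eq]
  choose g hg using fun w : CotangentSpace A => (maximalIdeal A).toCotangent_surjective w
  -- The lift of `v` is chosen to be `x` itself, so that `x` belongs to a minimal system of
  -- generators and drops out modulo `x`.
  let g' : CotangentSpace A → maximalIdeal A := fun w => if w = v then ⟨x, hx⟩ else g w
  have hg' : ∀ w, (maximalIdeal A).toCotangent (g' w) = w := by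
    intro w; by_cases h : w = v
    · simp only [g', h, if_true]; rfl
    · simp only [g', h, if_false]; exact hg w
  have hspan : Submodule.span A (g' '' (hli.extend (Set.subset_univ _))) = ⊤ := by
    rw [← CotangentSpace.span_image_eq_top_iff, Set.image_image]
    simpa [hg'] using hbt
  have hspan2 : maximalIdeal A =
      Ideal.span ((fun w => (g' w : A)) '' (hli.extend (Set.subset_univ _))) := by
    have := congrArg (Submodule.map (maximalIdeal A).subtype) hspan
    rw [Submodule.map_span, Submodule.map_top, Submodule.range_subtype, Set.image_image] at this
    exact this.symm
  have hmap : maximalIdeal (A ⧸ Ideal.span {x}) =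
      Ideal.span ((fun w => Ideal.Quotient.mk (Ideal.span {x}) (g' w : A)) ''
        (hli.extend (Set.subset_univ _) \ {v})) := by
    have h1 : (maximalIdeal A).map (Ideal.Quotient.mk (Ideal.span {x})) =
        maximalIdeal (A ⧸ Ideal.span {x}) :=
      IsLocalRing.map_maximalIdeal_of_surjective _ Ideal.Quotient.mk_surjective
    rw [← h1]
    conv_lhs => rw [hspan2]
    rw [Ideal.map_span, Set.image_image]
    apply le_antisymm
    · rw [Ideal.span_le]
      rintro _ ⟨w, hw, rfl⟩
      by_cases h : w = v
      · have : Ideal.Quotient.mk (Ideal.span {x}) (g' w : A) = 0 := by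
          simp only [g', h, if_true]
          exact Ideal.Quotient.eq_zero_iff_mem.mpr (Ideal.mem_span_singleton_self x)
        simp only [this, SetLike.mem_coe, zero_mem]
      · exact Ideal.subset_span ⟨w, ⟨hw, h⟩, rfl⟩
    · exact Ideal.span_mono (Set.image_mono Set.sdiff_subset)
  rw [hmap, ← hcard]
  have h1 := Submodule.spanFinrank_span_le_ncard_of_finite (R := A ⧸ Ideal.span {x})
    ((hfin.subset (Set.sdiff_subset (t := {v}))).image
      (fun w => Ideal.Quotient.mk (Ideal.span {x}) (g' w : A)))
  have h2 := Set.ncard_image_le (f := fun w => Ideal.Quotient.mk (Ideal.span {x}) (g' w : A))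
    (hfin.subset (Set.sdiff_subset (t := {v})))
  have h3 := Set.ncard_sdiff_singleton_add_one hvb hfin
  have h4 := h1.trans h2
  exact (Nat.add_le_add_right h4 1).trans h3.le

lemma isLocalRing_quotient_span_singleton {A : Type*} [CommRing A] [IsLocalRing A] {x : A}
    (hx : x ∈ maximalIdeal A) : IsLocalRing (A ⧸ Ideal.span {x}) := by
  have : Nontrivial (A ⧸ Ideal.span {x}) := Ideal.Quotient.nontrivial_iff.mpr
    ((Ideal.span_singleton_le_iff_mem _).mpr hx |>.trans_lt
      (lt_top_iff_ne_top.mpr (maximalIdeal.isMaximal A).ne_top)).ne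
  exact .of_surjective' (Ideal.Quotient.mk (Ideal.span {x})) Ideal.Quotient.mk_surjective

/-- The quotient of a regular local ring by an element of `𝔪 \ 𝔪²` is regular, of dimension one
less. -/
lemma isRegularLocalRing_quotient (A : Type*) [CommRing A] [IsRegularLocalRing A] {x : A}
    (hx : x ∈ maximalIdeal A) (hx2 : x ∉ maximalIdeal A ^ 2) :
    IsRegularLocalRing (A ⧸ Ideal.span {x}) ∧
      ringKrullDim (A ⧸ Ideal.span {x}) + 1 = ringKrullDim A := by
  have hloc := isLocalRing_quotient_span_singleton hx
  -- With `e` the minimal number of generators of the maximal ideal, `e(A/x) + 1 ≤ e(A) = dim A ≤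
  -- dim (A/x) + 1 ≤ e(A/x) + 1` forces equality throughout.
  have h1 := spanFinrank_maximalIdeal_quotient_succ_le A hx hx2
  have h2 : ringKrullDim A ≤ ringKrullDim (A ⧸ Ideal.span {x}) + 1 := by
    have := ringKrullDim_le_ringKrullDim_quotient_add_encard (R := A) {x}
      (by simpa [IsLocalRing.ringJacobson_eq_maximalIdeal] using hx)
    simpa using this
  have h3 : ringKrullDim (A ⧸ Ideal.span {x}) ≤
      (maximalIdeal (A ⧸ Ideal.span {x})).spanFinrank := ringKrullDim_le_spanFinrank_maximalIdeal _
  rw [← IsRegularLocalRing.spanFinrank_maximalIdeal (R := A)] at h2 ⊢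
  obtain ⟨n, hn⟩ : ∃ n : ℕ, ringKrullDim (A ⧸ Ideal.span {x}) = n := by
    have : FiniteRingKrullDim (A ⧸ Ideal.span {x}) := inferInstance
    obtain ⟨hb, ht⟩ := finiteRingKrullDim_iff_ne_bot_and_top.mp this
    revert hb ht h3
    cases ringKrullDim (A ⧸ Ideal.span {x}) with
    | bot => simp
    | coe a => cases a with
      | top => intro _ _ h; exact absurd rfl h
      | coe n => intro _ _ _; exact ⟨n, rfl⟩
  rw [hn] at h2 h3 ⊢
  norm_cast at h2 h3 ⊢
  refine ⟨.of_spanFinrank_maximalIdeal_le _ ?_, by omega⟩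
  rw [hn]; norm_cast; omega

/-- Nakayama's lemma. This supplies the elements of `𝔪 \ 𝔪²` on which inductions on the dimension
rest. -/
lemma maximalIdeal_pow_two_lt {A : Type*} [CommRing A] [IsLocalRing A] [IsNoetherianRing A]
    (h : maximalIdeal A ≠ ⊥) : ¬ maximalIdeal A ≤ maximalIdeal A ^ 2 := by
  intro hle
  apply h
  refine Submodule.eq_bot_of_le_smul_of_le_jacobson_bot (maximalIdeal A) _
    (IsNoetherian.noetherian _) ?_ (maximalIdeal_le_jacobson _)
  rwa [smul_eq_mul, ← pow_two]

/-- A regular local ring is a domain. -/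
theorem isDomain_of_isRegularLocalRing (A : Type*) [CommRing A] [IsRegularLocalRing A] :
    IsDomain A := by
  obtain ⟨n, hn⟩ : ∃ n, (maximalIdeal A).spanFinrank = n := ⟨_, rfl⟩
  have hdim := IsRegularLocalRing.spanFinrank_maximalIdeal (R := A)
  rw [hn] at hdim
  clear hn
  induction n generalizing A with
  | zero =>
    have hm : maximalIdeal A = ⊥ := by
      have := IsRegularLocalRing.spanFinrank_maximalIdeal (R := A)
      rw [← hdim] at this
      norm_cast at this
      exact (Submodule.spanFinrank_eq_zero_iff_eq_bot (IsNoetherian.noetherian _)).mp this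
    exact (isField_iff_maximalIdeal_eq.mpr hm).isDomain
  | succ n ih =>
    have hm0 : ∀ p ∈ minimalPrimes A, ¬ maximalIdeal A ≤ p := by
      intro p hp hle
      have := hp.1.1
      have h0 : p.height = 0 := Ideal.height_eq_zero_iff.mpr hp
      have h1 : maximalIdeal A = p := le_antisymm hle (le_maximalIdeal this.ne_top)
      rw [← h1] at h0
      have h2 := maximalIdeal_height_eq_ringKrullDim (R := A)
      rw [h0, ← hdim] at h2
      norm_cast at h2
    have hmb : maximalIdeal A ≠ ⊥ := by
      intro h
      have : maximalIdeal A ∈ minimalPrimes A :=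
        ⟨⟨inferInstance, bot_le⟩, fun q _ _ => h ▸ bot_le⟩
      exact hm0 _ this le_rfl
    have hfin := minimalPrimes.finite_of_isNoetherianRing A
    obtain ⟨x, hx, hx2, hxp⟩ : ∃ x ∈ maximalIdeal A, x ∉ maximalIdeal A ^ 2 ∧
        ∀ p ∈ minimalPrimes A, x ∉ p := by
      by_contra! hcon
      -- Prime avoidance tolerates two ideals that are not prime; `𝔪²` fills both places.
      have := (Ideal.subset_union_prime' (s := hfin.toFinset) (f := id)
        (a := maximalIdeal A ^ 2) (b := maximalIdeal A ^ 2) (I := maximalIdeal A)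
        (fun i hi => ((hfin.mem_toFinset).mp hi).1.1)).mp (by
          intro y hy
          by_cases hy2 : y ∈ maximalIdeal A ^ 2
          · exact Or.inl (Or.inl hy2)
          · obtain ⟨p, hp, hyp⟩ := hcon y hy hy2
            exact Or.inr (Set.mem_biUnion (x := p) (by simpa using hp) hyp))
      rcases this with h | h | ⟨p, hp, h⟩
      · exact maximalIdeal_pow_two_lt hmb h
      · exact maximalIdeal_pow_two_lt hmb h
      · exact hm0 p (by simpa using hp) h
    obtain ⟨hreg, hd⟩ := isRegularLocalRing_quotient A hx hx2
    have hdom : IsDomain (A ⧸ Ideal.span {x}) := by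
      apply ih
      rw [← hdim] at hd
      have := IsRegularLocalRing.spanFinrank_maximalIdeal (R := A ⧸ Ideal.span {x})
      rw [← this] at hd ⊢
      norm_cast at hd ⊢
      omega
    have hxprime : (Ideal.span {x}).IsPrime := (Ideal.Quotient.isDomain_iff_prime _).mp hdom
    -- A minimal prime `p` inside the prime `(x)` does not contain `x`, so every `y = x z` in `p`
    -- has `z ∈ p`. Thus `p = 𝔪 p`, and `p = 0` by Nakayama.
    obtain ⟨p, hp, hpx⟩ := Ideal.exists_minimalPrimes_le (bot_le : ⊥ ≤ Ideal.span {x})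
    have hpp := hp.1.1
    have hpbot : p = ⊥ := by
      refine Submodule.eq_bot_of_le_smul_of_le_jacobson_bot (maximalIdeal A) _
        (IsNoetherian.noetherian _) ?_ (maximalIdeal_le_jacobson _)
      intro y hy
      obtain ⟨z, rfl⟩ := Ideal.mem_span_singleton.mp (hpx hy)
      have hz : z ∈ p := (hpp.mem_or_mem hy).resolve_left (hxp p hp)
      exact Submodule.smul_mem_smul hx hz
    rw [hpbot] at hpp
    exact IsDomain.of_bot_isPrime A

end RegularLocal

end RVar
namespace RVar

open IsLocalRing Pointwise

/-! ### Finite free resolutions over regular local rings -/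

section FreeResolutions

/-- `M` has a resolution of length `n` by finite free modules (at the last step, a free module). -/
def HasFreeResolution (R : Type u) [CommRing R] :
    ℕ → ∀ (M : Type u) [AddCommGroup M] [Module R M], Prop
  | 0, M, _, _ => Module.Free R M
  | n + 1, M, _, _ => ∃ (k : ℕ) (φ : (Fin k → R) →ₗ[R] M), Function.Surjective φ ∧
      HasFreeResolution R n (LinearMap.ker φ)

/-- Finite free resolutions lift from `M / x M` to `M` when `x` is regular. -/
lemma HasFreeResolution.of_quotient {R : Type u} [CommRing R] [IsLocalRing R] [IsNoetherianRing R]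
    {x : R} (hx : x ∈ maximalIdeal R) (hxR : IsSMulRegular R x) (n : ℕ)
    (M : Type u) [AddCommGroup M] [Module R M] [Module.Finite R M] (hxM : IsSMulRegular M x)
    (N : Type u) [AddCommGroup N] [Module R N] [Module (R ⧸ Ideal.span {x}) N]
    [IsScalarTower R (R ⧸ Ideal.span {x}) N] (f : M →ₗ[R] N) (hf : Function.Surjective f)
    (hker : ∀ m, f m = 0 → ∃ m', m = x • m') (h : HasFreeResolution (R ⧸ Ideal.span {x}) n N) :
    HasFreeResolution R n M := by
  have hxN : ∀ y : N, x • y = 0 := fun y => by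
    rw [← one_smul (R ⧸ Ideal.span {x}) y, ← smul_assoc]
    have : x • (1 : R ⧸ Ideal.span {x}) = 0 := by
      rw [Algebra.smul_def, mul_one]
      exact Ideal.Quotient.eq_zero_iff_mem.mpr (Ideal.mem_span_singleton_self x)
    rw [this, zero_smul]
  induction n generalizing M N with
  | zero =>
    have hfree : Module.Free (R ⧸ Ideal.span {x}) N := h
    have hk : LinearMap.ker f = x • (⊤ : Submodule R M) := by
      ext m
      rw [LinearMap.mem_ker, Submodule.mem_smul_pointwise_iff_exists]
      constructor
      · intro hm
        obtain ⟨m', hm'⟩ := hker m hm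
        exact ⟨m', trivial, hm'.symm⟩
      · rintro ⟨m', -, rfl⟩
        rw [map_smul, hxN]
    let e : QuotSMulTop x M ≃ₗ[R] N :=
      (Submodule.quotEquivOfEq _ _ hk.symm).trans (f.quotKerEquivOfSurjective hf)
    have : Module.Free (R ⧸ Ideal.span {x}) (QuotSMulTop x M) :=
      Module.Free.of_equiv (e.extendScalarsOfSurjective Ideal.Quotient.mk_surjective).symm
    have hfp := Module.finitePresentation_of_finite R M
    exact (Module.free_quotSMulTop_iff_free R M (maximalIdeal_le_jacobson _ hx) hxM).mp this
  | succ n ih =>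
    obtain ⟨k, ψ, hψ, hres⟩ := h
    choose g hg using fun i => hf (ψ (Pi.single i 1))
    let φ : (Fin k → R) →ₗ[R] M := Fintype.linearCombination R g
    let π : (Fin k → R) →ₗ[R] (Fin k → R ⧸ Ideal.span {x}) :=
      LinearMap.pi fun i => (Algebra.linearMap R (R ⧸ Ideal.span {x})).comp (LinearMap.proj i)
    have hπ : Function.Surjective π := by
      intro y
      choose z hz using fun i => Ideal.Quotient.mk_surjective (y i)
      exact ⟨z, funext hz⟩
    have hcomm : ∀ a, f (φ a) = ψ (π a) := by
      have : f ∘ₗ φ = (ψ.restrictScalars R) ∘ₗ π := by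
        ext i
        have : π (Pi.single i 1) = Pi.single i 1 := by
          funext j
          by_cases hij : j = i
          · subst hij; simp [π]
          · simp [π, hij]
        simp only [LinearMap.comp_apply, LinearMap.coe_single, LinearMap.restrictScalars_apply,
          this]
        simp [φ, Fintype.linearCombination_apply_single, hg]
      exact fun a => LinearMap.congr_fun this a
    have hφ : Function.Surjective φ := by
      rw [← LinearMap.range_eq_top, eq_top_iff]
      refine Submodule.le_of_le_smul_of_le_jacobson_bot (I := maximalIdeal R)
        (IsNoetherian.noetherian _) (maximalIdeal_le_jacobson _) ?_
      intro m _
      obtain ⟨b, hb⟩ := hψ (f m)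
      obtain ⟨a, rfl⟩ := hπ b
      obtain ⟨m', hm'⟩ := hker (m - φ a) (by rw [map_sub, hcomm, hb, sub_self])
      rw [← sub_add_cancel m (φ a), hm', add_comm]
      exact Submodule.add_mem_sup ⟨a, rfl⟩ (Submodule.smul_mem_smul hx trivial)
    have hπx : ∀ c, π (x • c) = 0 := by
      intro c
      funext i
      simp only [π, LinearMap.pi_apply, LinearMap.comp_apply, LinearMap.proj_apply, Pi.smul_apply,
        Algebra.linearMap_apply, Pi.zero_apply, smul_eq_mul]
      exact Ideal.Quotient.eq_zero_iff_mem.mpr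
        (Ideal.mul_mem_right _ _ (Ideal.mem_span_singleton_self x))
    have hxpi : IsSMulRegular (Fin k → R) x := IsSMulRegular.pi fun _ => hxR
    refine ⟨k, φ, hφ, ?_⟩
    -- Since `x` is regular on `M`, a multiple `x c` lies in `ker φ` only if `c` does. So `ker ψ` is
    -- the reduction of `ker φ` modulo `x`, and the induction hypothesis applies to the syzygies.
    let F : LinearMap.ker φ →ₗ[R] LinearMap.ker ψ :=
      { toFun := fun a => ⟨π a.1, by
          rw [LinearMap.mem_ker, ← hcomm, LinearMap.mem_ker.mp a.2, map_zero]⟩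
        map_add' := fun a b => by ext1; simp
        map_smul' := fun r a => by ext1; simp }
    refine ih (LinearMap.ker φ) (hxpi.submodule _ _) (LinearMap.ker ψ) F ?_ ?_ hres ?_
    · rintro ⟨b, hb⟩
      obtain ⟨a, rfl⟩ := hπ b
      obtain ⟨m', hm'⟩ := hker (φ a) (by rw [hcomm]; exact hb)
      obtain ⟨c, rfl⟩ := hφ m'
      refine ⟨⟨a - x • c, ?_⟩, ?_⟩
      · rw [LinearMap.mem_ker, map_sub, map_smul, hm', sub_self]
      · ext1
        change π (a - x • c) = π a
        rw [map_sub, hπx, sub_zero]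
    · rintro ⟨a, ha⟩ h0
      have h0' : π a = 0 := congrArg Subtype.val h0
      have : ∀ i, ∃ c, a i = x * c := fun i =>
        Ideal.mem_span_singleton.mp (Ideal.Quotient.eq_zero_iff_mem.mp (congrFun h0' i))
      choose c hc using this
      have hac : a = x • c := funext fun i => by simp [hc]
      refine ⟨⟨c, ?_⟩, ?_⟩
      · rw [LinearMap.mem_ker] at ha ⊢
        rw [hac, map_smul] at ha
        exact hxM (ha.trans (smul_zero x).symm)
      · ext1; exact hac
    · intro y
      ext1
      funext i
      have : x • (y.1 i) = 0 := by
        rw [Algebra.smul_def]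
        have : algebraMap R (R ⧸ Ideal.span {x}) x = 0 :=
          Ideal.Quotient.eq_zero_iff_mem.mpr (Ideal.mem_span_singleton_self x)
        rw [this, zero_mul]
      exact this

/-- Over a regular local ring of dimension `n`, finite modules have free resolutions of
length `n`. -/
theorem hasFreeResolution_of_isRegularLocalRing (n : ℕ) (A : Type u) [CommRing A]
    [IsRegularLocalRing A] (hn : ringKrullDim A = n) (M : Type u) [AddCommGroup M] [Module A M]
    [Module.Finite A M] : HasFreeResolution A n M := by
  induction n generalizing A M with
  | zero =>
    have hm : maximalIdeal A = ⊥ := by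
      have := IsRegularLocalRing.spanFinrank_maximalIdeal (R := A)
      rw [hn] at this
      norm_cast at this
      exact (Submodule.spanFinrank_eq_zero_iff_eq_bot (IsNoetherian.noetherian _)).mp this
    let _ : Field A := (isField_iff_maximalIdeal_eq.mpr hm).toField
    exact Module.Free.of_divisionRing A M
  | succ n ih =>
    have := isDomain_of_isRegularLocalRing A
    have hmb : maximalIdeal A ≠ ⊥ := by
      intro h
      have := ringKrullDim_eq_zero_of_isField (isField_iff_maximalIdeal_eq.mpr h)
      rw [hn] at this
      norm_cast at this
    obtain ⟨x, hx, hx2⟩ := Set.not_subset.mp (maximalIdeal_pow_two_lt hmb)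
    have hx0 : x ≠ 0 := fun h => hx2 (h ▸ zero_mem _)
    obtain ⟨hreg, hd⟩ := isRegularLocalRing_quotient A hx hx2
    have hd' : ringKrullDim (A ⧸ Ideal.span {x}) = n := by
      rw [hn, ← IsRegularLocalRing.spanFinrank_maximalIdeal (R := A ⧸ Ideal.span {x})] at hd
      rw [← IsRegularLocalRing.spanFinrank_maximalIdeal (R := A ⧸ Ideal.span {x})]
      norm_cast at hd ⊢
      omega
    have hxR : IsSMulRegular A x := fun a b h => mul_left_cancel₀ hx0 h
    obtain ⟨k, φ, hφ⟩ := Module.Finite.exists_fin' A M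
    refine ⟨k, φ, hφ, ?_⟩
    -- `M` may have `x`-torsion, but its syzygy module lies in a free module over a domain. Passing
    -- to it uses up the one extra step of the resolution.
    have hxK : IsSMulRegular (LinearMap.ker φ) x :=
      (IsSMulRegular.pi fun _ => hxR : IsSMulRegular (Fin k → A) x).submodule _ _
    refine HasFreeResolution.of_quotient hx hxR n _ hxK (QuotSMulTop x (LinearMap.ker φ))
      (Submodule.mkQ _) (Submodule.mkQ_surjective _) ?_ ?_
    · intro m hm
      rw [Submodule.mkQ_apply, Submodule.Quotient.mk_eq_zero,
        Submodule.mem_smul_pointwise_iff_exists] at hm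
      obtain ⟨m', -, h⟩ := hm
      exact ⟨m', h.symm⟩
    · have : Module.Finite (A ⧸ Ideal.span {x}) (QuotSMulTop x (LinearMap.ker φ)) :=
        Module.Finite.of_restrictScalars_finite A _ _
      exact ih _ hd' _

/-- If `M` has a finite free resolution over `A` and its localization is projective, the
localization is stably free. -/
theorem HasFreeResolution.isStablyFree_localizedModule {A : Type u} [CommRing A] [IsNoetherianRing A]
    (S : Submonoid A) (n : ℕ) (M : Type u) [AddCommGroup M] [Module A M] [Module.Finite A M]
    (h : HasFreeResolution A n M)
    (hP : Module.Projective (Localization S) (LocalizedModule S M)) :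
    Module.IsStablyFree (Localization S) (LocalizedModule S M) := by
  induction n generalizing M with
  | zero =>
    have : Module.Free A M := h
    have : Module.Free (Localization S) (LocalizedModule S M) :=
      Module.Free.of_equiv (LocalizedModule.equivTensorProduct S M).symm
    infer_instance
  | succ n ih =>
    obtain ⟨k, φ, hφ, hK⟩ := h
    let g := LocalizedModule.map S φ
    let i := LocalizedModule.map S (LinearMap.ker φ).subtype
    have hg : Function.Surjective g := LocalizedModule.map_surjective S φ hφ
    have hi : Function.Injective i :=
      LocalizedModule.map_injective S _ (LinearMap.ker φ).injective_subtype
    have hex : Function.Exact i g :=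
      LocalizedModule.map_exact S _ _ (LinearMap.exact_subtype_ker_map φ)
    -- Projectivity splits the localized sequence, so the kernel `K` is projective and stably free
    -- by induction. If `K × N` is free, then so is `M × (K × N)`, being the free middle term times
    -- `N`.
    obtain ⟨s, hs⟩ := Module.projective_lifting_property g LinearMap.id hg
    let e := Function.Exact.splitSurjectiveEquiv (R := Localization S)
      (M := LocalizedModule S (LinearMap.ker φ)) (N := LocalizedModule S (Fin k → A))
      (P := LocalizedModule S M) (f := i) (g := g) hex hi ⟨s, hs⟩
    have hfree : Module.Free (Localization S) (LocalizedModule S (Fin k → A)) :=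
      Module.Free.of_equiv (LocalizedModule.equivTensorProduct S (Fin k → A)).symm
    have hfin : Module.Finite (Localization S) (LocalizedModule S (Fin k → A)) := inferInstance
    have hfreeprod : Module.Free (Localization S)
        (LocalizedModule S (LinearMap.ker φ) × LocalizedModule S M) := Module.Free.of_equiv e.1
    have hKproj : Module.Projective (Localization S) (LocalizedModule S (LinearMap.ker φ)) :=
      Module.Projective.of_split
        (LinearMap.inl _ (LocalizedModule S (LinearMap.ker φ)) (LocalizedModule S M))
        (LinearMap.fst _ _ _) (LinearMap.ext fun _ => rfl)
    have hKs := ih _ hK hKproj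
    obtain ⟨N, _, _, _, _, hKN⟩ := Module.IsStablyFree.exist_free_prod (Localization S)
      (LocalizedModule S (LinearMap.ker φ))
    have e2 : ((LocalizedModule S (LinearMap.ker φ) × LocalizedModule S M) × N) ≃ₗ[Localization S]
        (LocalizedModule S M × (LocalizedModule S (LinearMap.ker φ) × N)) :=
      ((LinearEquiv.prodComm _ _ _).prodCongr (.refl _ N)).trans (LinearEquiv.prodAssoc _ _ _ _)
    have : Module.Free (Localization S)
        (LocalizedModule S M × (LocalizedModule S (LinearMap.ker φ) × N)) := Module.Free.of_equiv e2
    exact Module.IsStablyFree.of_free_prod _ _ (LocalizedModule S (LinearMap.ker φ) × N)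

end FreeResolutions

end RVar
namespace RVar

open IsLocalRing

/-! ### Factoriality of regular local rings -/

section AuslanderBuchsbaum

/-- Localizations of regular rings are regular. -/
lemma isRegularRing_of_isLocalization {R : Type*} [CommRing R] [IsRegularRing R] (M : Submonoid R)
    (S : Type*) [CommRing S] [Algebra R S] [IsLocalization M S] : IsRegularRing S := by
  have := IsLocalization.isNoetherianRing M S inferInstance
  refine isRegularRing_iff.mpr fun p hp => ?_
  have : IsLocalization.AtPrime (Localization.AtPrime p) (p.comap (algebraMap R S)) :=
    IsLocalization.isLocalization_isLocalization_atPrime_isLocalization M _ p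
  exact IsRegularLocalRing.of_ringEquiv (IsLocalization.algEquiv
    (p.comap (algebraMap R S)).primeCompl
    (Localization.AtPrime (p.comap (algebraMap R S))) (Localization.AtPrime p)).toRingEquiv

/-- A nonzero ideal of a domain that is locally principal is invertible. -/
lemma isUnit_coeIdeal_of_locally_principal {R F : Type*} [CommRing R] [IsDomain R] [Field F]
    [Algebra R F] [IsFractionRing R F] (J : Ideal R) (hJ : J ≠ ⊥)
    (h : ∀ q : Ideal R, q.IsMaximal → ∃ c ∈ J, ∃ s ∉ q, ∀ a ∈ J, ∃ b, s * a = c * b) :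
    IsUnit (J : FractionalIdeal (nonZeroDivisors R) F) := by
  have hJ0 : (J : FractionalIdeal (nonZeroDivisors R) F) ≠ 0 :=
    FractionalIdeal.coeIdeal_ne_zero.mpr hJ
  rw [← FractionalIdeal.mul_inv_cancel_iff_isUnit]
  apply le_antisymm
  · rw [FractionalIdeal.mul_le]
    intro i hi j hj
    rw [mul_comm]
    exact (FractionalIdeal.mem_inv_iff hJ0).mp hj i hi
  -- `L` is the ideal of ring elements lying in `J J⁻¹`. It escapes each maximal ideal `q`: with `c`
  -- a generator of `J` at `q` and `s` the denominator, `s = c (s / c)` and `s / c ∈ J⁻¹`.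
  · let L : Ideal R := Submodule.comap (Algebra.linearMap R F)
      ((J : FractionalIdeal (nonZeroDivisors R) F) * (J : FractionalIdeal _ F)⁻¹ :
        FractionalIdeal (nonZeroDivisors R) F).coeToSubmodule
    have hL : L = ⊤ := by
      by_contra hne
      obtain ⟨q, hq, hLq⟩ := Ideal.exists_le_maximal L hne
      obtain ⟨c, hc, s, hs, hcs⟩ := h q hq
      have hc0 : c ≠ 0 := by
        rintro rfl
        obtain ⟨a, ha, ha0⟩ := Submodule.exists_mem_ne_zero_of_ne_bot hJ
        obtain ⟨b, hb⟩ := hcs a ha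
        rw [zero_mul, mul_eq_zero] at hb
        rcases hb with rfl | hb
        · exact hs (zero_mem q)
        · exact ha0 hb
      have hcF : algebraMap R F c ≠ 0 :=
        (map_ne_zero_iff _ (IsFractionRing.injective R F)).mpr hc0
      apply hs
      apply hLq
      change algebraMap R F s ∈ ((J : FractionalIdeal (nonZeroDivisors R) F) *
        (J : FractionalIdeal _ F)⁻¹ : FractionalIdeal (nonZeroDivisors R) F)
      have : algebraMap R F s = algebraMap R F c * (algebraMap R F s / algebraMap R F c) := by
        field_simp
      rw [this]
      refine FractionalIdeal.mul_mem_mul (FractionalIdeal.mem_coeIdeal_of_mem _ hc) ?_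
      rw [FractionalIdeal.mem_inv_iff hJ0]
      intro y hy
      obtain ⟨a, ha, rfl⟩ := (FractionalIdeal.mem_coeIdeal _).mp hy
      obtain ⟨b, hb⟩ := hcs a ha
      rw [FractionalIdeal.mem_one_iff]
      refine ⟨b, ?_⟩
      rw [div_mul_eq_mul_div, ← map_mul, hb, map_mul]
      field_simp
    have h1 : (1 : R) ∈ L := hL ▸ trivial
    rw [FractionalIdeal.one_le]
    have h2 : algebraMap R F 1 ∈ ((J : FractionalIdeal (nonZeroDivisors R) F) *
        (J : FractionalIdeal _ F)⁻¹ : FractionalIdeal (nonZeroDivisors R) F) := h1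
    rwa [map_one] at h2

/-- A locally principal nonzero ideal of a domain is an invertible module. -/
lemma invertible_of_locally_principal {R : Type*} [CommRing R] [IsDomain R] (J : Ideal R)
    (hJ : J ≠ ⊥)
    (h : ∀ q : Ideal R, q.IsMaximal → ∃ c ∈ J, ∃ s ∉ q, ∀ a ∈ J, ∃ b, s * a = c * b) :
    Module.Invertible R J := by
  have hu := isUnit_coeIdeal_of_locally_principal (F := FractionRing R) J hJ h
  have hu' : IsUnit (IsLocalization.coeSubmodule (FractionRing R) J) :=
    hu.map (FractionalIdeal.coeSubmoduleHom (nonZeroDivisors R) (FractionRing R))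
  have : Module.Invertible R (IsLocalization.coeSubmodule (FractionRing R) J) :=
    inferInstanceAs (Module.Invertible R (hu'.unit : Submodule R (FractionRing R)))
  let e : J ≃ₗ[R] IsLocalization.coeSubmodule (FractionRing R) J :=
    Submodule.equivMapOfInjective (Algebra.linearMap R (FractionRing R))
      (IsFractionRing.injective R (FractionRing R)) J
  exact Module.Invertible.congr e.symm

/-- A prime of height one in a domain which is locally principal on the complement of the zero
locus of `x`. -/
lemma isPrincipal_map_of_hasFreeResolution {A : Type u} [CommRing A] [IsDomain A]
    [IsNoetherianRing A] (S : Submonoid A) (hS : S ≤ nonZeroDivisors A) (p : Ideal A) (hp : p ≠ ⊥)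
    (n : ℕ) (hres : HasFreeResolution A n p)
    (hloc : ∀ q : Ideal A, q.IsPrime → Disjoint (S : Set A) q →
      ∃ c ∈ p, ∃ s ∉ q, ∀ a ∈ p, ∃ b, s * a = c * b) :
    (p.map (algebraMap A (Localization S))).IsPrincipal := by
  have hdom : IsDomain (Localization S) := IsLocalization.isDomain_localization hS
  have hinj : Function.Injective (algebraMap A (Localization S)) :=
    IsLocalization.injective _ hS
  set J := p.map (algebraMap A (Localization S)) with hJdef
  have hJ : J ≠ ⊥ := by
    obtain ⟨a, ha, ha0⟩ := Submodule.exists_mem_ne_zero_of_ne_bot hp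
    intro h
    have : algebraMap A (Localization S) a ∈ J := Ideal.mem_map_of_mem _ ha
    rw [h, Ideal.mem_bot] at this
    exact ha0 ((map_eq_zero_iff _ hinj).mp this)
  have hinv : Module.Invertible (Localization S) J := by
    apply invertible_of_locally_principal J hJ
    intro q hq
    have hdis := ((IsLocalization.isPrime_iff_isPrime_disjoint S (Localization S) q).mp hq.isPrime)
    obtain ⟨c, hc, s, hs, hcs⟩ := hloc _ hdis.1 hdis.2
    refine ⟨algebraMap _ _ c, Ideal.mem_map_of_mem _ hc, algebraMap _ _ s, hs, ?_⟩
    intro a ha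
    obtain ⟨⟨a', t⟩, hat⟩ := (IsLocalization.mem_map_algebraMap_iff S (Localization S)).mp ha
    obtain ⟨b, hb⟩ := hcs a' a'.2
    refine ⟨IsLocalization.mk' _ b t, ?_⟩
    have hu := IsLocalization.map_units (Localization S) t
    apply hu.mul_left_inj.mp
    rw [mul_assoc, hat, ← map_mul, hb, mul_assoc, IsLocalization.mk'_spec, map_mul]
  have hloceq : Submodule.localized' (Localization S) S (Algebra.linearMap A (Localization S)) p =
      J := Ideal.localized'_eq_map _ _ _
  let e0 : LocalizedModule S p ≃ₗ[A] Submodule.localized' (Localization S) S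
      (Algebra.linearMap A (Localization S)) p :=
    IsLocalizedModule.iso S (Submodule.toLocalized' (Localization S) S
      (Algebra.linearMap A (Localization S)) p)
  let e : LocalizedModule S p ≃ₗ[Localization S] J :=
    (e0.extendScalarsOfIsLocalization S (Localization S)).trans (LinearEquiv.ofEq _ _ hloceq)
  have hinv' : Module.Invertible (Localization S) (LocalizedModule S p) := .congr e.symm
  have hproj : Module.Projective (Localization S) (LocalizedModule S p) := inferInstance
  -- A stably free invertible module is free; for an ideal this means principal, generated by the
  -- image of `1`.
  have hsf := hres.isStablyFree_localizedModule S n p hproj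
  have hfree := Module.free_of_isStablyFree_of_invertible (Localization S) (LocalizedModule S p)
  obtain ⟨e'⟩ := Module.Invertible.free_iff_linearEquiv.mp hfree
  let φ : Localization S ≃ₗ[Localization S] J := e'.symm.trans e
  refine ⟨⟨(φ 1 : Localization S), ?_⟩⟩
  apply le_antisymm
  · intro y hy
    have : (⟨y, hy⟩ : J) = φ (φ.symm ⟨y, hy⟩) := (φ.apply_symm_apply _).symm
    rw [Submodule.mem_span_singleton]
    refine ⟨φ.symm ⟨y, hy⟩, ?_⟩
    have h2 : φ (φ.symm ⟨y, hy⟩) = φ.symm ⟨y, hy⟩ • φ 1 := by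
      rw [← map_smul, smul_eq_mul, mul_one]
    rw [← Submodule.coe_smul, ← h2, ← this]
  · rw [Submodule.span_singleton_le_iff_mem]
    exact (φ 1).2

/-- **Auslander–Buchsbaum**: in a local regular ring, primes of height one are principal. -/
theorem isPrincipal_of_height_eq_one (A : Type u) [CommRing A] [IsLocalRing A]
    [IsRegularRing A] (p : Ideal A) [hpp : p.IsPrime] (hp : p.height = 1) : p.IsPrincipal := by
  classical
  obtain ⟨n, hn⟩ : ∃ n : ℕ, ringKrullDim A ≤ n := by
    have := IsRegularLocalRing.of_isRegularRing_of_isLocalRing A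
    exact ⟨_, (IsRegularLocalRing.spanFinrank_maximalIdeal (R := A)).ge⟩
  induction n generalizing A with
  | zero =>
    have := (WithBot.coe_le_coe.mpr (Ideal.height_mono (le_maximalIdeal hpp.ne_top)))
    rw [hp, maximalIdeal_height_eq_ringKrullDim] at this
    exact absurd (this.trans hn) (by norm_num)
  | succ n ih =>
    have hreg := IsRegularLocalRing.of_isRegularRing_of_isLocalRing A
    have hdom := isDomain_of_isRegularLocalRing A
    have hpb : p ≠ ⊥ := by
      rintro rfl
      simp at hp
    have hmb : maximalIdeal A ≠ ⊥ := fun h =>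
      hpb (le_bot_iff.mp (h ▸ le_maximalIdeal hpp.ne_top))
    obtain ⟨x, hx, hx2⟩ := Set.not_subset.mp (maximalIdeal_pow_two_lt hmb)
    have hx0 : x ≠ 0 := fun h => hx2 (h ▸ zero_mem _)
    obtain ⟨hregx, -⟩ := isRegularLocalRing_quotient A hx hx2
    have hxI : (Ideal.span {x}).IsPrime := (Ideal.Quotient.isDomain_iff_prime _).mp
      (isDomain_of_isRegularLocalRing _)
    have hxp : Prime x := (Ideal.span_singleton_prime hx0).mp hxI
    by_cases hxmem : x ∈ p
    · have hle : Ideal.span {x} ≤ p := (Ideal.span_singleton_le_iff_mem _).mpr hxmem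
      have : Ideal.span {x} = p := by
        by_contra hne
        have h1 := Ideal.height_add_one_le_of_lt_of_isPrime (lt_of_le_of_ne hle hne)
        have h2 : (⊥ : Ideal A) < Ideal.span {x} := bot_lt_iff_ne_bot.mpr (by
          simpa [Ideal.span_singleton_eq_bot] using hx0)
        have h3 := Ideal.height_add_one_le_of_lt_of_isPrime h2
        have h4 := (add_le_add_left h3 1).trans h1
        rw [hp, Ideal.height_bot] at h4
        exact absurd h4 (by norm_num)
      exact ⟨⟨x, this.symm⟩⟩
    -- A prime `q` avoiding `x` is not maximal, so its local ring has smaller dimension and `p` is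
    -- principal there by induction. Hence `p` becomes locally principal, and then principal, once
    -- `x` is inverted.
    let S := Submonoid.powers x
    have hS : S ≤ nonZeroDivisors A := powers_le_nonZeroDivisors_of_noZeroDivisors hx0
    have hloc : ∀ q : Ideal A, q.IsPrime → Disjoint (S : Set A) q →
        ∃ c ∈ p, ∃ s ∉ q, ∀ a ∈ p, ∃ b, s * a = c * b := by
      intro q hq hdis
      by_cases hpq : p ≤ q
      swap
      · obtain ⟨c, hc, hcq⟩ := Set.not_subset.mp hpq
        exact ⟨c, hc, c, hcq, fun a _ => ⟨a, rfl⟩⟩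
      have hxq : x ∉ q := fun h => Set.disjoint_left.mp hdis (Submonoid.mem_powers x) h
      have hqm : q < maximalIdeal A :=
        lt_of_le_of_ne (le_maximalIdeal hq.ne_top) (fun h => hxq (h ▸ hx))
      have hdimq : ringKrullDim (Localization.AtPrime q) ≤ n := by
        rw [IsLocalization.AtPrime.ringKrullDim_eq_height q]
        have h1 := WithBot.coe_le_coe.mpr (Ideal.height_add_one_le_of_lt_of_isPrime hqm)
        rw [maximalIdeal_height_eq_ringKrullDim] at h1
        have h2 := h1.trans hn
        obtain ⟨m, hm⟩ := ENat.ne_top_iff_exists.mp (Ideal.height_ne_top hq.ne_top)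
        rw [← hm] at h2 ⊢
        norm_cast at h2 ⊢
        omega
      have hregq : IsRegularRing (Localization.AtPrime q) :=
        isRegularRing_of_isLocalization q.primeCompl _
      have hdis' : Disjoint (q.primeCompl : Set A) p :=
        Set.disjoint_left.mpr fun a ha hap => ha (hpq hap)
      have hpq' : (p.map (algebraMap A (Localization.AtPrime q))).IsPrime :=
        IsLocalization.isPrime_of_isPrime_disjoint q.primeCompl _ p hpp hdis'
      have hht : (p.map (algebraMap A (Localization.AtPrime q))).height = 1 := by
        rw [← IsLocalization.height_under q.primeCompl,
          IsLocalization.under_map_of_isPrime_disjoint q.primeCompl _ hpp hdis', hp]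
      obtain ⟨⟨h, hh⟩⟩ := ih (Localization.AtPrime q) _ hht hdimq
      have hhmem : h ∈ p.map (algebraMap A (Localization.AtPrime q)) :=
        hh ▸ Submodule.mem_span_singleton_self h
      obtain ⟨⟨c, t⟩, hct⟩ := (IsLocalization.mem_map_algebraMap_iff q.primeCompl _).mp hhmem
      have hgen : ∀ a ∈ p, ∃ s ∉ q, ∃ b, s * a = c * b := by
        intro a ha
        have : algebraMap A (Localization.AtPrime q) a ∈ p.map _ := Ideal.mem_map_of_mem _ ha
        rw [hh, Submodule.mem_span_singleton] at this
        obtain ⟨r, hr⟩ := this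
        obtain ⟨⟨b, u⟩, hbu⟩ := IsLocalization.surj q.primeCompl r
        have hinj : Function.Injective (algebraMap A (Localization.AtPrime q)) :=
          IsLocalization.injective _ q.primeCompl_le_nonZeroDivisors
        refine ⟨t * u, fun hmem => (hq.mem_or_mem hmem).elim t.2 u.2, b, hinj ?_⟩
        dsimp only at hct hbu
        rw [map_mul, map_mul, map_mul, ← hr, ← hct, ← hbu, smul_eq_mul]
        ring
      obtain ⟨T, hT⟩ := IsNoetherian.noetherian p
      choose! s hsq b hsb using hgen
      -- The product of the denominators of finitely many generators serves for all of `p`.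
      refine ⟨c, c.2, ∏ a ∈ T, s a, ?_, ?_⟩
      · intro hmem
        obtain ⟨a, ha, hsa⟩ := (hq.prod_mem_iff).mp hmem
        exact hsq a (hT ▸ Submodule.subset_span ha) hsa
      · intro a ha
        rw [← hT] at ha
        induction ha using Submodule.span_induction with
        | mem a ha =>
          refine ⟨b a * ∏ a' ∈ T.erase a, s a', ?_⟩
          rw [← Finset.mul_prod_erase T s ha, mul_right_comm,
            hsb a (hT ▸ Submodule.subset_span ha), mul_assoc]
        | zero => exact ⟨0, by simp⟩
        | add a a' _ _ h h' =>
          obtain ⟨b, hb⟩ := h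
          obtain ⟨b', hb'⟩ := h'
          exact ⟨b + b', by rw [mul_add, hb, hb', mul_add]⟩
        | smul r a _ h =>
          obtain ⟨b, hb⟩ := h
          exact ⟨r * b, by rw [smul_eq_mul, mul_left_comm, hb, mul_left_comm]⟩
    obtain ⟨⟨j, hj⟩⟩ := isPrincipal_map_of_hasFreeResolution S hS p hpb _
      (hasFreeResolution_of_isRegularLocalRing _ A
        (IsRegularLocalRing.spanFinrank_maximalIdeal (R := A)).symm p) hloc
    have hjmem : j ∈ p.map (algebraMap A (Localization S)) :=
      hj ▸ Submodule.mem_span_singleton_self j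
    obtain ⟨⟨g, t⟩, hgt⟩ := (IsLocalization.mem_map_algebraMap_iff S _).mp hjmem
    dsimp only at hgt
    have hinj : Function.Injective (algebraMap A (Localization S)) := IsLocalization.injective _ hS
    have hgen : ∀ a ∈ p, ∃ k b, x ^ k * a = g * b := by
      intro a ha
      have : algebraMap A (Localization S) a ∈ p.map _ := Ideal.mem_map_of_mem _ ha
      rw [hj, Submodule.mem_span_singleton] at this
      obtain ⟨r, hr⟩ := this
      obtain ⟨⟨b, u⟩, hbu⟩ := IsLocalization.surj S r
      obtain ⟨k, hk⟩ := (t * u).2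
      refine ⟨k, b, hinj ?_⟩
      dsimp only at hbu hk
      rw [hk, map_mul, Submonoid.coe_mul, map_mul, map_mul, ← hr, ← hgt, ← hbu, smul_eq_mul]
      ring
    have hg0 : (g : A) ≠ 0 := by
      intro h0
      obtain ⟨a, ha, ha0⟩ := Submodule.exists_mem_ne_zero_of_ne_bot hpb
      obtain ⟨k, b, hkb⟩ := hgen a ha
      rw [h0, zero_mul, mul_eq_zero] at hkb
      exact hkb.elim (pow_ne_zero _ hx0) ha0
    -- All factors `x` are removed from the generator `g` over `A[1/x]`. The rest `h` stays in `p`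
    -- because `x ∉ p`, and since the prime `x` does not divide `h`, the powers of `x` cancel from
    -- `xᵏ a = g b`.
    obtain ⟨h, hgh, hxh⟩ := (FiniteMultiplicity.of_not_isUnit hxp.not_isUnit
      hg0).exists_eq_pow_mul_and_not_dvd
    have hhp : h ∈ p := by
      have := g.2
      rw [hgh] at this
      exact (hpp.mem_or_mem this).resolve_left fun h' => hxmem (hpp.mem_of_pow_mem _ h')
    refine ⟨⟨h, le_antisymm ?_ ((Submodule.span_singleton_le_iff_mem _ _).mpr hhp)⟩⟩
    intro a ha
    obtain ⟨k, b, hkb⟩ := hgen a ha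
    rw [hgh] at hkb
    have hdvd : x ^ k ∣ h * (x ^ multiplicity x (g : A) * b) := ⟨a, by rw [hkb]; ring⟩
    obtain ⟨d, hd⟩ := hxp.pow_dvd_of_dvd_mul_left k hxh hdvd
    have : a = h * d := by
      apply mul_left_cancel₀ (pow_ne_zero k hx0)
      rw [hkb, mul_assoc, mul_left_comm, hd]; ring
    rw [this]
    exact Ideal.mem_span_singleton'.mpr ⟨d, mul_comm _ _⟩

/-- Local regular rings are unique factorization domains. -/
theorem uniqueFactorizationMonoid_of_isRegularRing (A : Type u) [CommRing A] [IsLocalRing A]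
    [IsRegularRing A] [IsDomain A] : UniqueFactorizationMonoid A := by
  -- Kaplansky's criterion: it suffices that every nonzero prime contains a prime element. By
  -- Krull's theorem it contains a prime of height one.
  rw [UniqueFactorizationMonoid.iff_exists_prime_mem_of_isPrime]
  intro I hI hIp
  obtain ⟨a, ha, ha0⟩ := Submodule.exists_mem_ne_zero_of_ne_bot hI
  obtain ⟨p, hp, hpI⟩ := Ideal.exists_minimalPrimes_le
    ((Ideal.span_singleton_le_iff_mem I).mpr ha)
  have hpp := hp.1.1
  have hap : a ∈ p := (Ideal.span_singleton_le_iff_mem _).mp hp.1.2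
  have hpb : ⊥ < p := bot_lt_iff_ne_bot.mpr fun h => ha0 (by simpa [h] using hap)
  have h1 : p.height = 1 := by
    refine le_antisymm (Ideal.height_le_one_of_isPrincipal_of_mem_minimalPrimes _ p hp) ?_
    simpa using Ideal.height_add_one_le_of_lt_of_isPrime hpb
  obtain ⟨⟨h, hh⟩⟩ := isPrincipal_of_height_eq_one A p h1
  have hh' : p = Ideal.span {h} := hh
  have hh0 : h ≠ 0 := by
    rintro rfl
    exact hpb.ne' (by rw [hh']; simp)
  exact ⟨h, hpI (hh' ▸ Ideal.mem_span_singleton_self h),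
    (Ideal.span_singleton_prime hh0).mp (hh' ▸ hpp)⟩

end AuslanderBuchsbaum

end RVar
namespace RVar

open IsLocalRing

/-! ### Depth of hypersurfaces; normality of a quotient in terms of elements -/

section HypersurfaceNormality

/-- If `𝔪` is associated to `A / (a, b)` and `b`, `c` are regular modulo `a`, then `𝔪` is associated
to `A / (a, c)`. -/
lemma exists_socle_swap {A : Type*} [CommRing A] (𝔪 : Ideal A) {a b c : A} (hc : c ∈ 𝔪)
    (hb : ∀ v, b * v ∈ Ideal.span {a} → v ∈ Ideal.span {a})
    (hc' : ∀ v, c * v ∈ Ideal.span {a} → v ∈ Ideal.span {a})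
    (h : ∃ y ∉ Ideal.span {a, b}, ∀ t ∈ 𝔪, t * y ∈ Ideal.span {a, b}) :
    ∃ y ∉ Ideal.span {a, c}, ∀ t ∈ 𝔪, t * y ∈ Ideal.span {a, c} := by
  obtain ⟨y, hy, hty⟩ := h
  -- Writing `c y = u a + z b`, the socle class of `y` modulo `(a, b)` is transported to that of `z`
  -- modulo `(a, c)`.
  obtain ⟨u, z, huz⟩ := Ideal.mem_span_pair.mp (hty c hc)
  refine ⟨z, fun hz => hy ?_, fun t ht => ?_⟩
  · obtain ⟨w, v, hwv⟩ := Ideal.mem_span_pair.mp hz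
    have h1 : y - b * v ∈ Ideal.span {a} := by
      apply hc'
      rw [Ideal.mem_span_singleton']
      exact ⟨u + w * b, by rw [← hwv] at huz; linear_combination huz⟩
    obtain ⟨r, hr⟩ := Ideal.mem_span_singleton'.mp h1
    exact Ideal.mem_span_pair.mpr ⟨r, v, by linear_combination hr⟩
  · obtain ⟨r, w, hrw⟩ := Ideal.mem_span_pair.mp (hty t ht)
    have h1 : t * z - c * w ∈ Ideal.span {a} := by
      apply hb
      rw [Ideal.mem_span_singleton']
      exact ⟨c * r - t * u, by linear_combination c * hrw - t * huz⟩
    obtain ⟨s, hs⟩ := Ideal.mem_span_singleton'.mp h1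
    exact Ideal.mem_span_pair.mpr ⟨s, w, by linear_combination hs⟩

lemma mem_span_singleton_of_prime_mul {A : Type*} [CommRing A] {h c : A} (hh : Prime h)
    (hc : c ∉ Ideal.span {h}) (v : A) (hv : c * v ∈ Ideal.span {h}) : v ∈ Ideal.span {h} := by
  rw [Ideal.mem_span_singleton] at *
  exact (hh.dvd_or_dvd hv).resolve_left hc

lemma mem_span_singleton_of_mul_prime {A : Type*} [CommRing A] [IsDomain A] {h c : A} (hh : Prime h)
    (hc : c ∉ Ideal.span {h}) (v : A) (hv : h * v ∈ Ideal.span {c}) : v ∈ Ideal.span {c} := by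
  rw [Ideal.mem_span_singleton] at *
  obtain ⟨w, hw⟩ := hv
  obtain ⟨w', rfl⟩ := (hh.dvd_or_dvd (Dvd.intro _ hw)).resolve_left hc
  exact ⟨w', mul_left_cancel₀ hh.ne_zero (by rw [hw]; ring)⟩

/-- In a regular local ring of dimension at least three, a hypersurface is unmixed along
principal ideals: the maximal ideal is not associated to `A / (h, b)`. -/
theorem not_exists_socle_of_three_le_dim (A : Type*) [CommRing A] [IsRegularLocalRing A]
    (hdim : 3 ≤ ringKrullDim A) {h b : A} (hh : Prime h) (hb : b ∉ Ideal.span {h}) :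
    ¬ ∃ y ∉ Ideal.span {h, b}, ∀ t ∈ maximalIdeal A, t * y ∈ Ideal.span {h, b} := by
  have hdom := isDomain_of_isRegularLocalRing A
  have hne : ∀ (R : Type _) [CommRing R] [IsRegularLocalRing R], 1 ≤ ringKrullDim R →
      ∃ x ∈ maximalIdeal R, x ∉ maximalIdeal R ^ 2 := by
    intro R _ _ hR
    refine Set.not_subset.mp (maximalIdeal_pow_two_lt fun h => ?_)
    have := ringKrullDim_eq_zero_of_isField (isField_iff_maximalIdeal_eq.mpr h)
    rw [this] at hR
    exact absurd hR (by norm_num)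
  -- The comparison pair is `(x, y)`, with `A/(x, y)` a domain of dimension at least one. It
  -- contains a nonzero class of some `z` in `𝔪`, so it has no socle.
  obtain ⟨x, hx, hx2⟩ := hne A (le_trans (by norm_num) hdim)
  obtain ⟨hreg1, hd1⟩ := isRegularLocalRing_quotient A hx hx2
  have hdom1 := isDomain_of_isRegularLocalRing (A ⧸ Ideal.span {x})
  have hdim1 : 2 ≤ ringKrullDim (A ⧸ Ideal.span {x}) := by
    rw [← hd1, ← IsRegularLocalRing.spanFinrank_maximalIdeal (R := A ⧸ Ideal.span {x})] at hdim
    rw [← IsRegularLocalRing.spanFinrank_maximalIdeal (R := A ⧸ Ideal.span {x})]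
    norm_cast at hdim ⊢
    omega
  obtain ⟨y', hy, hy2⟩ := hne (A ⧸ Ideal.span {x}) (le_trans (by norm_num) hdim1)
  obtain ⟨hreg2, hd2⟩ := isRegularLocalRing_quotient (A ⧸ Ideal.span {x}) hy hy2
  have hdom2 := isDomain_of_isRegularLocalRing ((A ⧸ Ideal.span {x}) ⧸ Ideal.span {y'})
  have hdim2 : 1 ≤ ringKrullDim ((A ⧸ Ideal.span {x}) ⧸ Ideal.span {y'}) := by
    rw [← hd2, ← IsRegularLocalRing.spanFinrank_maximalIdeal
      (R := (A ⧸ Ideal.span {x}) ⧸ Ideal.span {y'})] at hdim1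
    rw [← IsRegularLocalRing.spanFinrank_maximalIdeal
      (R := (A ⧸ Ideal.span {x}) ⧸ Ideal.span {y'})]
    norm_cast at hdim1 ⊢
    omega
  obtain ⟨z', hz, hz2⟩ := hne _ hdim2
  obtain ⟨y, rfl⟩ := Ideal.Quotient.mk_surjective y'
  obtain ⟨z'', rfl⟩ := Ideal.Quotient.mk_surjective z'
  obtain ⟨z, rfl⟩ := Ideal.Quotient.mk_surjective z''
  have hx0 : x ≠ 0 := fun h => hx2 (h ▸ zero_mem _)
  have hxp : Prime x := (Ideal.span_singleton_prime hx0).mp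
    ((Ideal.Quotient.isDomain_iff_prime _).mp hdom1)
  have hyx : y ∉ Ideal.span {x} := fun h =>
    hy2 (by rw [Ideal.Quotient.eq_zero_iff_mem.mpr h]; exact zero_mem _)
  have hmap : ∀ w, Ideal.Quotient.mk (Ideal.span {Ideal.Quotient.mk (Ideal.span {x}) y})
      (Ideal.Quotient.mk (Ideal.span {x}) w) = 0 ↔ w ∈ Ideal.span {x, y} := by
    intro w
    rw [Ideal.Quotient.eq_zero_iff_mem, Ideal.mem_span_singleton', Ideal.mem_span_pair]
    constructor
    · rintro ⟨r', hr⟩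
      obtain ⟨r, rfl⟩ := Ideal.Quotient.mk_surjective r'
      rw [← map_mul, Ideal.Quotient.mk_eq_mk_iff_sub_mem, Ideal.mem_span_singleton'] at hr
      obtain ⟨s, hs⟩ := hr
      exact ⟨-s, r, by linear_combination -hs⟩
    · rintro ⟨s, r, rfl⟩
      refine ⟨Ideal.Quotient.mk _ r, ?_⟩
      rw [map_add, map_mul, map_mul, Ideal.Quotient.eq_zero_iff_mem.mpr
        (Ideal.mem_span_singleton_self x), mul_zero, zero_add]
  have hzmem : z ∈ maximalIdeal A := by
    by_contra hcon
    rw [mem_maximalIdeal, mem_nonunits_iff, not_not] at hcon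
    exact (mem_maximalIdeal _).mp hz ((hcon.map _).map _)
  have hz0 : z ∉ Ideal.span {x, y} := fun hmem =>
    hz2 (by rw [(hmap z).mpr hmem]; exact zero_mem _)
  have hmprin : ∀ {g : A}, Prime g → ¬ maximalIdeal A ≤ Ideal.span {g} := by
    intro g hg hle
    have hmg : maximalIdeal A = Ideal.span {g} := le_antisymm hle (le_maximalIdeal fun h =>
      hg.not_isUnit (Ideal.span_singleton_eq_top.mp h))
    have h1 := IsRegularLocalRing.spanFinrank_maximalIdeal (R := A)
    have h2 := Submodule.spanFinrank_span_le_ncard_of_finite (R := A) (Set.finite_singleton g)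
    rw [hmg] at h1
    have h3 : (Ideal.span {g}).spanFinrank ≤ 1 := by simpa using h2
    rw [← h1] at hdim
    norm_cast at hdim
    omega
  -- The element `c` is the bridge. One generator is exchanged at a time, along `(h, b)`, `(h, c)`,
  -- `(x, c)`, `(x, y)`, and `c` must be regular modulo both `h` and `x`.
  obtain ⟨c, hcm, hch, hcx⟩ : ∃ c ∈ maximalIdeal A, c ∉ Ideal.span {h} ∧ c ∉ Ideal.span {x} := by
    by_contra! hcon
    rcases (Ideal.subset_union (I := maximalIdeal A) (J := Ideal.span {h})
      (K := Ideal.span {x})).mp (fun c hc => by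
        by_cases h1 : c ∈ Ideal.span {h}
        · exact Or.inl h1
        · exact Or.inr (hcon c hc h1)) with h1 | h1
    · exact hmprin hh h1
    · exact hmprin hxp h1
  intro hs
  have s1 := exists_socle_swap (maximalIdeal A) hcm (mem_span_singleton_of_prime_mul hh hb)
    (mem_span_singleton_of_prime_mul hh hch) hs
  rw [Set.pair_comm] at s1
  have s2 := exists_socle_swap (maximalIdeal A) hx (mem_span_singleton_of_mul_prime hh hch)
    (mem_span_singleton_of_mul_prime hxp hcx) s1
  rw [Set.pair_comm] at s2
  have hym : y ∈ maximalIdeal A := by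
    by_contra hcon
    rw [mem_maximalIdeal, mem_nonunits_iff, not_not] at hcon
    exact (mem_maximalIdeal _).mp hy (hcon.map _)
  obtain ⟨w, hw, htw⟩ := exists_socle_swap (maximalIdeal A) hym
    (mem_span_singleton_of_prime_mul hxp hcx) (mem_span_singleton_of_prime_mul hxp hyx) s2
  have h1 := (hmap _).mpr (htw z hzmem)
  rw [map_mul, map_mul, mul_eq_zero] at h1
  rcases h1 with h1 | h1
  · exact hz0 ((hmap z).mp h1)
  · exact hw ((hmap w).mp h1)

/-- If a power of `𝔪` multiplies `a ∉ I` into `I` then some multiple of `a` outside `I` is killed by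
`𝔪` modulo `I`. -/
lemma exists_socle_of_pow_mul_mem {A : Type*} [CommRing A] (𝔪 I : Ideal A) {a : A} (ha : a ∉ I)
    {n : ℕ} (hn : ∀ t ∈ 𝔪 ^ n, t * a ∈ I) : ∃ y ∉ I, ∀ t ∈ 𝔪, t * y ∈ I := by
  induction n with
  | zero => exact absurd (by simpa using hn 1 (by simp)) ha
  | succ n ih =>
    by_cases h : ∀ t ∈ 𝔪 ^ n, t * a ∈ I
    · exact ih h
    · push Not at h
      obtain ⟨t, ht, hta⟩ := h
      refine ⟨t * a, hta, fun u hu => ?_⟩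
      rw [← mul_assoc]
      apply hn
      rw [pow_succ']
      exact Ideal.mul_mem_mul hu ht

variable {B : Type u} [CommRing B]

/-- The localization of `B / p` at `q` is integrally closed, expressed through elements. -/
def IsIntegrallyClosedAt (p q : Ideal B) : Prop :=
  ∀ z : FractionRing (B ⧸ p), IsIntegral (B ⧸ p) z → ∃ s ∉ q, ∃ d : B,
    algebraMap (B ⧸ p) (FractionRing (B ⧸ p)) (Ideal.Quotient.mk p s) * z =
      algebraMap (B ⧸ p) (FractionRing (B ⧸ p)) (Ideal.Quotient.mk p d)

/-- The localization of `B / I` at `q` is an integrally closed domain, expressed through elements. -/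
def IsNormalQuotientAt (I q : Ideal B) : Prop :=
  ∃ p : Ideal B, p.IsPrime ∧ I ≤ p ∧ p ≤ q ∧ (∀ a ∈ p, ∃ s ∉ q, s * a ∈ I) ∧
    IsIntegrallyClosedAt p q

/-- Normality is stable under generization: the same prime `p` and the same denominators serve at
`q`. -/
lemma IsNormalQuotientAt.mono {I q q' : Ideal B} (hq : q.IsPrime) (hIq : I ≤ q) (hqq : q ≤ q')
    (h : IsNormalQuotientAt I q') : IsNormalQuotientAt I q := by
  obtain ⟨p, hp, hIp, hpq, hloc, hint⟩ := h
  refine ⟨p, hp, hIp, fun a ha => ?_, fun a ha => ?_, fun z hz => ?_⟩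
  · obtain ⟨s, hs, hsa⟩ := hloc a ha
    exact (hq.mem_or_mem (hIq hsa)).resolve_left fun h => hs (hqq h)
  · obtain ⟨s, hs, hsa⟩ := hloc a ha
    exact ⟨s, fun h => hs (hqq h), hsa⟩
  · obtain ⟨s, hs, d, hd⟩ := hint z hz
    exact ⟨s, fun h => hs (hqq h), d, hd⟩

/-- `IsNormalQuotientAt I q` says that the local ring of `B / I` at `q` is normal. -/
lemma isNormalLocalRing_iff_isNormalQuotientAt {W S : Type*} [CommRing W] [CommRing S]
    (π : B →+* W) (hπ : Function.Surjective π) (Q : Ideal W) [Q.IsPrime] [Algebra W S]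
    [IsLocalization.AtPrime S Q] :
    IsNormalLocalRing S ↔ IsNormalQuotientAt (RingHom.ker π) (Q.comap π) := by
  let ψ : B →+* S := (algebraMap W S).comp π
  have hker : ∀ a, ψ a = 0 ↔ ∃ s ∉ Q.comap π, s * a ∈ RingHom.ker π := by
    intro a
    change algebraMap W S (π a) = 0 ↔ _
    rw [IsLocalization.map_eq_zero_iff Q.primeCompl S]
    constructor
    · rintro ⟨⟨m, hm⟩, h⟩
      obtain ⟨s, rfl⟩ := hπ m
      exact ⟨s, hm, by rw [RingHom.mem_ker, map_mul]; exact h⟩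
    · rintro ⟨s, hs, h⟩
      exact ⟨⟨π s, hs⟩, by rw [RingHom.mem_ker, map_mul] at h; exact h⟩
  -- The prime in `IsNormalQuotientAt` has no freedom: it is the kernel of the map to the local
  -- ring.
  have hpker : ∀ p : Ideal B, p.IsPrime → RingHom.ker π ≤ p → p ≤ Q.comap π →
      (∀ a ∈ p, ∃ s ∉ Q.comap π, s * a ∈ RingHom.ker π) → p = RingHom.ker ψ := by
    intro p hp hIp hpq h
    ext a
    rw [RingHom.mem_ker, hker]
    refine ⟨h a, fun ⟨s, hs, hsa⟩ => (hp.mem_or_mem (hIp hsa)).resolve_left fun h => hs (hpq h)⟩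
  have key : ∀ p : Ideal B, p.IsPrime → p = RingHom.ker ψ → p ≤ Q.comap π →
      (IsNormalLocalRing S ↔ IsIntegrallyClosedAt p (Q.comap π)) := by
    intro p hp hpψ hpq
    let M : Submonoid (B ⧸ p) := (Q.comap π).primeCompl.map (Ideal.Quotient.mk p)
    let _ : Algebra (B ⧸ p) S := (Ideal.Quotient.lift p ψ fun a ha => by
      rw [hpψ] at ha; exact ha).toAlgebra
    have halg : ∀ b, algebraMap (B ⧸ p) S (Ideal.Quotient.mk p b) = algebraMap W S (π b) :=
      fun b => rfl
    have hM : M ≤ nonZeroDivisors (B ⧸ p) := by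
      rintro _ ⟨s, hs, rfl⟩
      rw [mem_nonZeroDivisors_iff_ne_zero, Ne, Ideal.Quotient.eq_zero_iff_mem]
      exact fun h => hs (hpq h)
    have hloc : IsLocalization M S := by
      refine ⟨?_, ?_, ?_⟩
      · rintro ⟨_, s, hs, rfl⟩
        exact IsLocalization.map_units S (⟨π s, hs⟩ : Q.primeCompl)
      · intro z
        obtain ⟨⟨w, ⟨m, hm⟩⟩, h⟩ := IsLocalization.surj Q.primeCompl z
        obtain ⟨b, rfl⟩ := hπ w
        obtain ⟨s, rfl⟩ := hπ m
        exact ⟨⟨Ideal.Quotient.mk p b, ⟨Ideal.Quotient.mk p s, s, hm, rfl⟩⟩, h⟩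
      · intro x y h
        obtain ⟨a, rfl⟩ := Ideal.Quotient.mk_surjective x
        obtain ⟨b, rfl⟩ := Ideal.Quotient.mk_surjective y
        refine ⟨1, ?_⟩
        congr 1
        rw [Ideal.Quotient.mk_eq_mk_iff_sub_mem, hpψ, RingHom.mem_ker, map_sub, sub_eq_zero]
        exact h
    have hSdom : IsDomain S := IsLocalization.isDomain_of_le_nonZeroDivisors S hM
    let L := FractionRing (B ⧸ p)
    have hML : ∀ y : M, IsUnit (algebraMap (B ⧸ p) L y) := fun y =>
      IsLocalization.map_units L (⟨y.1, hM y.2⟩ : nonZeroDivisors (B ⧸ p))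
    let φ : S →+* L := IsLocalization.lift (S := S) hML
    let _ : Algebra S L := φ.toAlgebra
    have : IsScalarTower (B ⧸ p) S L := IsScalarTower.of_algebraMap_eq fun x =>
      (IsLocalization.lift_eq (S := S) hML x).symm
    have hfrac : IsFractionRing S L := IsFractionRing.isFractionRing_of_isLocalization M S L hM
    have hiff : IsNormalLocalRing S ↔ IsIntegrallyClosed S :=
      ⟨fun h => h.2, fun h => ⟨hSdom, h⟩⟩
    rw [hiff, isIntegrallyClosed_iff L]
    constructor
    · intro h z hz
      obtain ⟨y, hy⟩ := h (hz.tower_top)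
      obtain ⟨⟨x, ⟨_, s, hs, rfl⟩⟩, hx⟩ := IsLocalization.surj M y
      obtain ⟨d, rfl⟩ := Ideal.Quotient.mk_surjective x
      refine ⟨s, hs, d, ?_⟩
      rw [IsScalarTower.algebraMap_apply (B ⧸ p) S L, IsScalarTower.algebraMap_apply (B ⧸ p) S L,
        ← hx, map_mul, hy, mul_comm]
    · intro h z hz
      obtain ⟨⟨_, m, hm, rfl⟩, hmz⟩ := hz.exists_multiple_integral_of_isLocalization M z
      obtain ⟨s, hs, d, hd⟩ := h _ hmz
      have hu : IsUnit (algebraMap (B ⧸ p) S (Ideal.Quotient.mk p (s * m))) := by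
        rw [halg]
        exact IsLocalization.map_units S
          (⟨π (s * m), (Q.comap π).primeCompl.mul_mem hs hm⟩ : Q.primeCompl)
      obtain ⟨u, hu⟩ := hu
      refine ⟨↑u⁻¹ * algebraMap (B ⧸ p) S (Ideal.Quotient.mk p d), ?_⟩
      have h1 : algebraMap S L (u : S) * z = algebraMap S L
          (algebraMap (B ⧸ p) S (Ideal.Quotient.mk p d)) := by
        rw [← IsScalarTower.algebraMap_apply, ← hd, hu, ← IsScalarTower.algebraMap_apply, map_mul,
          map_mul, mul_assoc, Submonoid.smul_def, Algebra.smul_def]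
      rw [map_mul, ← h1, ← mul_assoc, ← map_mul, Units.inv_mul, map_one, one_mul]
  constructor
  · intro h
    have := h.1
    have hp : (RingHom.ker ψ).IsPrime := RingHom.ker_isPrime ψ
    have hle : RingHom.ker ψ ≤ Q.comap π := by
      intro a ha
      by_contra hcon
      have : IsUnit (ψ a) := IsLocalization.map_units S (⟨π a, hcon⟩ : Q.primeCompl)
      rw [RingHom.mem_ker.mp ha] at this
      exact not_isUnit_zero this
    refine ⟨RingHom.ker ψ, hp, fun a ha => ?_, hle, fun a ha => (hker a).mp ha,
      (key _ hp rfl hle).mp h⟩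
    rw [RingHom.mem_ker]
    change algebraMap W S (π a) = 0
    rw [RingHom.mem_ker.mp ha, map_zero]
  · rintro ⟨p, hp, hIp, hpq, h, hint⟩
    exact (key p hp (hpker p hp hIp hpq h) hpq).mpr hint

end HypersurfaceNormality

end RVar
namespace RVar

open IsLocalRing

/-! ### The non-normal locus of a hypersurface in codimension two -/

section NonNormalLocus

variable {B : Type u} [CommRing B]

/-- An element lying in all primes between `I` and `q` is nilpotent modulo `I` locally at `q`. -/
lemma exists_mul_pow_mem {I q : Ideal B} [hq : q.IsPrime] {t : B}
    (h : ∀ q' : Ideal B, q'.IsPrime → I ≤ q' → q' ≤ q → t ∈ q') :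
    ∃ s ∉ q, ∃ n : ℕ, s * t ^ n ∈ I := by
  by_contra! hcon
  -- If the conclusion fails, `I` misses the monoid generated by `t` and the complement of `q`; a
  -- prime over `I` missing it lies in `q` and omits `t`.
  let S : Submonoid B := q.primeCompl ⊔ Submonoid.powers t
  have hdis : Disjoint (I : Set B) S := by
    rw [Set.disjoint_left]
    rintro a ha haS
    obtain ⟨s, hs, _, ⟨n, rfl⟩, rfl⟩ := Submonoid.mem_sup.mp haS
    exact hcon s hs n ha
  obtain ⟨q', hq', hIq', hdis'⟩ := Ideal.exists_le_prime_disjoint I S hdis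
  refine Set.disjoint_left.mp hdis' (h q' hq' hIq' fun a ha => ?_)
    (Submonoid.mem_sup_right (Submonoid.mem_powers t))
  by_contra hcon'
  exact Set.disjoint_left.mp hdis' ha (Submonoid.mem_sup_left hcon')

lemma mem_of_algebraMap_mem_map {q p : Ideal B} [q.IsPrime] [hp : p.IsPrime] (hpq : p ≤ q) {b : B}
    (hb : algebraMap B (Localization.AtPrime q) b ∈ p.map (algebraMap B _)) : b ∈ p := by
  have hdis : Disjoint (q.primeCompl : Set B) p :=
    Set.disjoint_left.mpr fun a ha hap => ha (hpq hap)
  have := IsLocalization.under_map_of_isPrime_disjoint q.primeCompl (Localization.AtPrime q) hp hdis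
  rw [← this]
  exact hb

/-- The ideals of closed subsets all of whose components have codimension one. -/
def HasHeightOnePrimesBelow (I : Ideal B) : Prop :=
  ∀ q : Ideal B, q.IsPrime → I ≤ q → ∃ p : Ideal B, p.IsPrime ∧ p.height = 1 ∧ I ≤ p ∧ p ≤ q

lemma eq_of_le_of_height_eq_one {p p' : Ideal B} [p.IsPrime] [p'.IsPrime] (h : p ≤ p')
    (h1 : p.height = 1) (h1' : p'.height = 1) : p = p' := by
  by_contra hne
  have := Ideal.height_add_one_le_of_lt_of_isPrime (lt_of_le_of_ne h hne)
  rw [h1, h1'] at this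
  exact absurd this (by norm_num)

/-- If `p` is the only prime of height one between `I` and `q`, then `I` and `p` agree at `q`. -/
lemma exists_mul_mem_of_unique {I p q : Ideal B} (hI : I.IsRadical) [hq : q.IsPrime]
    (h1 : HasHeightOnePrimesBelow I)
    (huniq : ∀ p' : Ideal B, p'.IsPrime → p'.height = 1 → I ≤ p' → p' ≤ q → p' = p) :
    ∀ a ∈ p, ∃ s ∉ q, s * a ∈ I := by
  intro a ha
  obtain ⟨s, hs, n, hn⟩ := exists_mul_pow_mem (I := I) (q := q) (t := a) (by
    intro q' hq' hIq' hle
    obtain ⟨p', hp', hp1', hIp', hpq'⟩ := h1 q' hq' hIq'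
    exact hpq' (huniq p' hp' hp1' hIp' (hpq'.trans hle) ▸ ha))
  refine ⟨s, hs, hI ⟨n + 1, ?_⟩⟩
  have : (s * a) ^ (n + 1) = (s ^ n * a) * (s * a ^ n) := by ring
  rw [this]
  exact Ideal.mul_mem_left _ _ hn

/-- If two primes of height one between `I` and `q` exist, the quotient is not normal at `q`. -/
lemma not_isNormalQuotientAt_of_ne {I p₁ p₂ q : Ideal B} (h1 : HasHeightOnePrimesBelow I)
    [hp₁ : p₁.IsPrime] [hp₂ : p₂.IsPrime] (h₁ : p₁.height = 1) (h₂ : p₂.height = 1)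
    (hI₁ : I ≤ p₁) (hI₂ : I ≤ p₂) (hq₁ : p₁ ≤ q) (hq₂ : p₂ ≤ q) (hne : p₁ ≠ p₂) :
    ¬ IsNormalQuotientAt I q := by
  rintro ⟨p, hp, hIp, -, hloc, -⟩
  obtain ⟨p₀, hp₀, h₀, hIp₀, hp₀p⟩ := h1 p hp hIp
  have key : ∀ p' : Ideal B, p'.IsPrime → p'.height = 1 → I ≤ p' → p' ≤ q → p' = p₀ := by
    intro p' hp' h' hI' hq'
    refine (eq_of_le_of_height_eq_one (fun a ha => ?_) h₀ h').symm
    obtain ⟨s, hs, hsa⟩ := hloc a (hp₀p ha)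
    exact (hp'.mem_or_mem (hI' hsa)).resolve_left fun h => hs (hq' h)
  exact hne ((key p₁ hp₁ h₁ hI₁ hq₁).trans (key p₂ hp₂ h₂ hI₂ hq₂).symm)

/-- Primes of height one in a regular ring are locally generated by a prime element. -/
lemma exists_prime_map_eq_span [IsRegularRing B] (p q : Ideal B) [hp : p.IsPrime] [hq : q.IsPrime]
    (hp1 : p.height = 1) (hpq : p ≤ q) :
    ∃ h : Localization.AtPrime q, Prime h ∧
      p.map (algebraMap B (Localization.AtPrime q)) = Ideal.span {h} := by
  have hregq : IsRegularRing (Localization.AtPrime q) :=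
    isRegularRing_of_isLocalization q.primeCompl _
  have hdis : Disjoint (q.primeCompl : Set B) p :=
    Set.disjoint_left.mpr fun a ha hap => ha (hpq hap)
  have hpq' : (p.map (algebraMap B (Localization.AtPrime q))).IsPrime :=
    IsLocalization.isPrime_of_isPrime_disjoint q.primeCompl _ p hp hdis
  have hht : (p.map (algebraMap B (Localization.AtPrime q))).height = 1 := by
    rw [← IsLocalization.height_under q.primeCompl,
      IsLocalization.under_map_of_isPrime_disjoint q.primeCompl _ hp hdis, hp1]
  obtain ⟨⟨h, hh⟩⟩ := isPrincipal_of_height_eq_one (Localization.AtPrime q) _ hht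
  have hh0 : h ≠ 0 := by
    rintro rfl
    rw [hh] at hht
    simp at hht
  exact ⟨h, (Ideal.span_singleton_prime hh0).mp (by rw [← show p.map _ = Ideal.span {h} from hh]; exact hpq'), hh⟩

/-- Krull's height theorem: at `q` both primes are principal, so the maximal ideal there is minimal
over two elements. Two components can therefore meet only along primes whose minimal ones have
height at most two. -/
lemma height_le_two_of_minimal [IsRegularRing B] (p₁ p₂ q : Ideal B) [p₁.IsPrime] [p₂.IsPrime] [hq : q.IsPrime]
    (h₁ : p₁.height = 1) (h₂ : p₂.height = 1) (hmin : q ∈ (p₁ ⊔ p₂).minimalPrimes) :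
    q.height ≤ 2 := by
  have hp₁ : p₁ ≤ q := le_sup_left.trans hmin.1.2
  have hp₂ : p₂ ≤ q := le_sup_right.trans hmin.1.2
  obtain ⟨g₁, -, hg₁⟩ := exists_prime_map_eq_span p₁ q h₁ hp₁
  obtain ⟨g₂, -, hg₂⟩ := exists_prime_map_eq_span p₂ q h₂ hp₂
  have hmax : maximalIdeal (Localization.AtPrime q) ∈ (Ideal.span {g₁, g₂}).minimalPrimes := by
    rw [Ideal.span_insert, ← hg₁, ← hg₂, ← Ideal.map_sup]
    refine ⟨⟨inferInstance, ?_⟩, ?_⟩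
    · rw [← Localization.AtPrime.map_eq_maximalIdeal]
      exact Ideal.map_mono hmin.1.2
    · rintro Q ⟨hQ, hQle⟩ hQmax
      have h1 := (IsLocalization.isPrime_iff_isPrime_disjoint q.primeCompl _ Q).mp hQ
      rw [← Localization.AtPrime.map_eq_maximalIdeal, Ideal.map_le_iff_le_comap]
      refine hmin.2 ⟨h1.1, Ideal.map_le_iff_le_comap.mp hQle⟩ ?_
      have := Ideal.comap_mono (f := algebraMap B (Localization.AtPrime q)) hQmax
      rwa [← Ideal.under_def, ← Ideal.under_def,
        IsLocalization.AtPrime.under_maximalIdeal (Localization.AtPrime q) q] at this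
  have h := Ideal.height_le_card_of_mem_minimalPrimes_span (Set.toFinite {g₁, g₂}) hmax
  have h2 : (maximalIdeal (Localization.AtPrime q)).height = q.height := by
    rw [← IsLocalization.height_under q.primeCompl, Localization.AtPrime.under_maximalIdeal]
  rw [← h2]
  refine h.trans ?_
  exact_mod_cast (Set.ncard_insert_le g₁ {g₂}).trans (by simp)

section Noetherian

variable [IsDomain B] [IsRegularRing B]

/-- Serre's criterion for the hypersurface `B / p`, at points of codimension at least two. -/
theorem isIntegrallyClosedAt_of_three_le_height (p q : Ideal B) [hp : p.IsPrime] [hq : q.IsPrime]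
    (hp1 : p.height = 1) (hpq : p ≤ q) (h3 : 3 ≤ q.height)
    (h : ∀ q' : Ideal B, q'.IsPrime → p ≤ q' → q' < q → IsIntegrallyClosedAt p q') :
    IsIntegrallyClosedAt p q := by
  intro z hz
  obtain ⟨a', b', hb', rfl⟩ := IsFractionRing.div_surjective (A := B ⧸ p) z
  obtain ⟨a, rfl⟩ := Ideal.Quotient.mk_surjective a'
  obtain ⟨b, rfl⟩ := Ideal.Quotient.mk_surjective b'
  have hbp : b ∉ p := by
    rwa [mem_nonZeroDivisors_iff_ne_zero, Ne, Ideal.Quotient.eq_zero_iff_mem] at hb'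
  have hbL : algebraMap (B ⧸ p) (FractionRing (B ⧸ p)) (Ideal.Quotient.mk p b) ≠ 0 := by
    rw [Ne, map_eq_zero_iff _ (IsFractionRing.injective (B ⧸ p) (FractionRing (B ⧸ p)))]
    exact nonZeroDivisors.ne_zero hb'
  have hiff : ∀ s d, algebraMap (B ⧸ p) (FractionRing (B ⧸ p)) (Ideal.Quotient.mk p s) *
      (algebraMap (B ⧸ p) (FractionRing (B ⧸ p)) (Ideal.Quotient.mk p a) /
        algebraMap (B ⧸ p) (FractionRing (B ⧸ p)) (Ideal.Quotient.mk p b)) =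
      algebraMap (B ⧸ p) (FractionRing (B ⧸ p)) (Ideal.Quotient.mk p d) ↔ s * a - d * b ∈ p := by
    intro s d
    rw [← mul_div_assoc, div_eq_iff hbL, ← map_mul, ← map_mul, ← map_mul, ← map_mul,
      (IsFractionRing.injective (B ⧸ p) (FractionRing (B ⧸ p))).eq_iff,
      Ideal.Quotient.mk_eq_mk_iff_sub_mem]
  simp only [hiff]
  have hz' : ∀ q' : Ideal B, q'.IsPrime → p ≤ q' → q' < q → ∃ s ∉ q', ∃ d, s * a - d * b ∈ p := by
    intro q' hq' hpq' hlt
    obtain ⟨s, hs, d, hd⟩ := h q' hq' hpq' hlt _ hz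
    exact ⟨s, hs, d, (hiff s d).mp hd⟩
  have hmem : ∀ t, t * a ∈ p ⊔ Ideal.span {b} → ∃ d, t * a - d * b ∈ p := by
    intro t ht
    obtain ⟨x, hx, y, hy, hxy⟩ := Submodule.mem_sup.mp ht
    obtain ⟨d, rfl⟩ := Ideal.mem_span_singleton'.mp hy
    exact ⟨d, by rw [← hxy]; simpa using hx⟩
  -- `J` is the ideal of denominators of the integral fraction `a / b` modulo `p`. Normality at the
  -- primes below `q` leaves `q` as the only prime between `J` and `q`, so a power of the maximal
  -- ideal at `q` multiplies `a` into `(g, b)`, where `g` is the local equation of `p`. This yields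
  -- a socle element, excluded in dimension three.
  let J : Ideal B := Submodule.comap (LinearMap.mulRight B a) (p ⊔ Ideal.span {b})
  have hJ : ∀ t, t ∈ J ↔ t * a ∈ p ⊔ Ideal.span {b} := fun t => Iff.rfl
  by_contra! hcon
  have hJq : J ≤ q := by
    intro t ht
    by_contra htq
    obtain ⟨d, hd⟩ := hmem t ht
    exact hcon t htq d hd
  have hmin : ∀ q' : Ideal B, q'.IsPrime → J ≤ q' → q' ≤ q → q' = q := by
    intro q' hq' hJq' hle
    by_contra hne
    have hpq' : p ≤ q' := fun x hx => hJq'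
      ((hJ x).mpr (Ideal.mem_sup_left (Ideal.mul_mem_right _ _ hx)))
    obtain ⟨s, hs, d, hd⟩ := hz' q' hq' hpq' (lt_of_le_of_ne hle hne)
    apply hs
    apply hJq'
    rw [hJ, ← sub_add_cancel (s * a) (d * b)]
    exact Submodule.add_mem_sup hd (Ideal.mul_mem_left _ _ (Ideal.mem_span_singleton_self b))
  let A := Localization.AtPrime q
  obtain ⟨g, hg, hpg⟩ := exists_prime_map_eq_span p q hp1 hpq
  have hrad : maximalIdeal A ≤ (J.map (algebraMap B A)).radical := by
    rw [← Localization.AtPrime.map_eq_maximalIdeal, Ideal.map_le_iff_le_comap]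
    intro t ht
    obtain ⟨s, hs, n, hsn⟩ := exists_mul_pow_mem (I := J) (q := q) (t := t)
      (fun q' hq' hJq' hle => (hmin q' hq' hJq' hle).symm ▸ ht)
    refine ⟨n, ?_⟩
    have hu : IsUnit (algebraMap B A s) := IsLocalization.map_units A (⟨s, hs⟩ : q.primeCompl)
    rw [← Ideal.unit_mul_mem_iff_mem _ hu, ← map_pow, ← map_mul]
    exact Ideal.mem_map_of_mem _ hsn
  obtain ⟨n, hn⟩ := Ideal.exists_pow_le_of_le_radical_of_fg hrad (IsNoetherian.noetherian _)
  have hI' : (p ⊔ Ideal.span {b}).map (algebraMap B A) = Ideal.span {g, algebraMap B A b} := by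
    rw [Ideal.map_sup, hpg, Ideal.map_span, Set.image_singleton, Ideal.span_insert]
  have hinj : Function.Injective (algebraMap B A) :=
    IsLocalization.injective _ q.primeCompl_le_nonZeroDivisors
  have ha' : algebraMap B A a ∉ Ideal.span {g, algebraMap B A b} := by
    rw [← hI']
    intro hmem'
    obtain ⟨⟨c, s⟩, hcs⟩ := (IsLocalization.mem_map_algebraMap_iff q.primeCompl A).mp hmem'
    dsimp only at hcs
    rw [← map_mul] at hcs
    have : (s : B) ∈ J := by rw [hJ, mul_comm, hinj hcs]; exact c.2
    exact s.2 (hJq this)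
  have hbg : algebraMap B A b ∉ Ideal.span {g} := by
    rw [← hpg]
    exact fun hb => hbp (mem_of_algebraMap_mem_map hpq hb)
  have hdim : 3 ≤ ringKrullDim A := by
    rw [IsLocalization.AtPrime.ringKrullDim_eq_height q]
    exact WithBot.coe_le_coe.mpr h3
  refine not_exists_socle_of_three_le_dim A hdim hg hbg
    (exists_socle_of_pow_mul_mem (maximalIdeal A) _ ha' (n := n) fun t ht => ?_)
  have hle : J.map (algebraMap B A) ≤
      Submodule.comap (LinearMap.mulRight A (algebraMap B A a)) (Ideal.span {g, algebraMap B A b}) := by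
    rw [Ideal.map_le_iff_le_comap]
    intro t ht
    change algebraMap B A t * algebraMap B A a ∈ Ideal.span {g, algebraMap B A b}
    rw [← map_mul, ← hI']
    exact Ideal.mem_map_of_mem _ ht
  exact hle (hn ht)

/-- Every point of the non-normal locus of a hypersurface specializes from one of codimension two
in the ambient regular scheme. -/
theorem exists_le_height_eq_two {I : Ideal B} (hI : I.IsRadical) (h1 : HasHeightOnePrimesBelow I)
    (q : Ideal B) (hq : q.IsPrime) (hIq : I ≤ q) (hN : ¬ IsNormalQuotientAt I q) :
    ∃ q' : Ideal B, q'.IsPrime ∧ I ≤ q' ∧ q' ≤ q ∧ q'.height = 2 ∧ ¬ IsNormalQuotientAt I q' := by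
  let Z : Set (Ideal B) := {q' | q'.IsPrime ∧ I ≤ q' ∧ q' ≤ q ∧ ¬ IsNormalQuotientAt I q'}
  have hne : Z.Nonempty := ⟨q, hq, hIq, le_rfl, hN⟩
  -- A non-normal point of least height has normal points strictly below it. The heights one and at
  -- least three are then ruled out in turn.
  obtain ⟨q', ⟨hq', hIq', hqq', hN'⟩, hmin⟩ : ∃ q' ∈ Z, ∀ q'' ∈ Z, ¬ q''.height < q'.height := by
    refine ⟨Function.argminOn Ideal.height Z hne, Function.argminOn_mem _ _ _, ?_⟩
    intro q'' h'' hlt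
    exact Function.not_lt_argminOn Ideal.height Z h'' hlt
  have hlow : ∀ q'' : Ideal B, q''.IsPrime → I ≤ q'' → q'' < q' → IsNormalQuotientAt I q'' := by
    intro q'' hq'' hIq'' hlt
    by_contra hcon
    exact hmin q'' ⟨hq'', hIq'', hlt.le.trans hqq', hcon⟩ ((ENat.add_one_le_iff
      (Ideal.height_ne_top hq''.ne_top)).mp (Ideal.height_add_one_le_of_lt_of_isPrime hlt))
  obtain ⟨p, hp, hp1, hIp, hpq⟩ := h1 q' hq' hIq'
  refine ⟨q', hq', hIq', hqq', ?_, hN'⟩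
  have hge1 : p < q' := by
    refine lt_of_le_of_ne hpq ?_
    rintro rfl
    apply hN'
    refine ⟨p, hp, hIp, le_rfl, exists_mul_mem_of_unique hI h1 (fun p' hp' h' _ hle =>
      eq_of_le_of_height_eq_one hle h' hp1), fun z hz => ?_⟩
    obtain ⟨a', b', hb', rfl⟩ := IsFractionRing.div_surjective (A := B ⧸ p) z
    obtain ⟨a, rfl⟩ := Ideal.Quotient.mk_surjective a'
    obtain ⟨b, rfl⟩ := Ideal.Quotient.mk_surjective b'
    have hbL : algebraMap (B ⧸ p) (FractionRing (B ⧸ p)) (Ideal.Quotient.mk p b) ≠ 0 := by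
      rw [Ne, map_eq_zero_iff _ (IsFractionRing.injective (B ⧸ p) (FractionRing (B ⧸ p)))]
      exact nonZeroDivisors.ne_zero hb'
    -- At the generic point of a component the local ring is a field: every denominator outside `p`
    -- is allowed.
    refine ⟨b, ?_, a, by field_simp⟩
    rwa [mem_nonZeroDivisors_iff_ne_zero, Ne, Ideal.Quotient.eq_zero_iff_mem] at hb'
  have hge2 : 2 ≤ q'.height := by
    have := Ideal.height_add_one_le_of_lt_of_isPrime hge1
    rwa [hp1, one_add_one_eq_two] at this
  refine le_antisymm ?_ hge2
  by_contra hgt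
  have hge3 : 3 ≤ q'.height := by
    have := Order.add_one_le_of_lt (not_le.mp hgt)
    rwa [two_add_one_eq_three] at this
  apply hN'
  by_cases huniq : ∀ p' : Ideal B, p'.IsPrime → p'.height = 1 → I ≤ p' → p' ≤ q' → p' = p
  · refine ⟨p, hp, hIp, hpq, exists_mul_mem_of_unique hI h1 huniq, ?_⟩
    refine isIntegrallyClosedAt_of_three_le_height p q' hp1 hpq hge3 fun q'' hq'' hpq'' hlt => ?_
    obtain ⟨p₀, hp₀, hIp₀, hp₀q, hloc, hint⟩ := hlow q'' hq'' (hIp.trans hpq'') hlt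
    obtain ⟨p₁, hp₁, h₁, hIp₁, hp₁p₀⟩ := h1 p₀ hp₀ hIp₀
    have hp₁p := huniq p₁ hp₁ h₁ hIp₁ (hp₁p₀.trans (hp₀q.trans hlt.le))
    have hp₀p : p₀ = p := by
      refine le_antisymm (fun a ha => ?_) (hp₁p ▸ hp₁p₀)
      obtain ⟨s, hs, hsa⟩ := hloc a ha
      exact (hp.mem_or_mem (hIp hsa)).resolve_left fun h => hs (hpq'' h)
    rwa [hp₀p] at hint
  · push Not at huniq
    obtain ⟨p', hp', h', hIp', hpq', hne'⟩ := huniq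
    exfalso
    -- Two components through `q'` already meet in a prime of height at most two below it, where the
    -- quotient is not a domain. This contradicts minimality.
    obtain ⟨q'', hq'', hle⟩ := Ideal.exists_minimalPrimes_le (sup_le hpq hpq')
    have hq''p := hq''.1.1
    have h2 := height_le_two_of_minimal p p' q'' hp1 h' hq''
    have hlt : q'' < q' := lt_of_le_of_ne hle (by rintro rfl; exact hgt h2)
    exact not_isNormalQuotientAt_of_ne h1 hp1 h' hIp hIp' (le_sup_left.trans hq''.1.2)
      (le_sup_right.trans hq''.1.2) hne'.symm
      (hlow q'' hq''p (hIp.trans (le_sup_left.trans hq''.1.2)) hlt)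

/-- `B / p` is generically normal. -/
def IsGenericallyNormal (p : Ideal B) : Prop :=
  ∃ f ∉ p, ∀ z : FractionRing (B ⧸ p), IsIntegral (B ⧸ p) z → ∃ k : ℕ, ∃ d : B,
    algebraMap (B ⧸ p) (FractionRing (B ⧸ p)) (Ideal.Quotient.mk p (f ^ k)) * z =
      algebraMap (B ⧸ p) (FractionRing (B ⧸ p)) (Ideal.Quotient.mk p d)

/-- The non-normal locus has finitely many points of codimension two. -/
theorem finite_height_eq_two {I : Ideal B} (hI : I.IsRadical) (h1 : HasHeightOnePrimesBelow I)
    (hgen : ∀ p : Ideal B, p.IsPrime → IsGenericallyNormal p) :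
    {q : Ideal B | q.IsPrime ∧ I ≤ q ∧ q.height = 2 ∧ ¬ IsNormalQuotientAt I q}.Finite := by
  choose! f hfp hf using hgen
  let P : Set (Ideal B) := {p | p.IsPrime ∧ p.height = 1 ∧ I ≤ p}
  have hP : P.Finite := by
    refine (I.finite_minimalPrimes_of_isNoetherianRing B).subset ?_
    rintro p ⟨hp, hp1, hIp⟩
    obtain ⟨q, hq, hqp⟩ := Ideal.exists_minimalPrimes_le hIp
    have hqq := hq.1.1
    obtain ⟨p', hp', hp1', hIp', hp'q⟩ := h1 q hq.1.1 hq.1.2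
    have h2 := eq_of_le_of_height_eq_one (hp'q.trans hqp) hp1' hp1
    rwa [← le_antisymm hqp (h2 ▸ hp'q)]
  -- The candidates: a non-normal point of height two lies on two components, or on one component
  -- `p` and on `f p = 0`, outside which `B / p` is normal. Having height two, it is minimal over
  -- the corresponding sum of ideals.
  have hfin : ((⋃ p ∈ P, ⋃ p' ∈ P, (p ⊔ p').minimalPrimes) ∪
      ⋃ p ∈ P, (p ⊔ Ideal.span {f p}).minimalPrimes).Finite := by
    refine Set.Finite.union (hP.biUnion fun p _ => hP.biUnion fun p' _ => ?_)
      (hP.biUnion fun p _ => ?_)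
    · exact Ideal.finite_minimalPrimes_of_isNoetherianRing B _
    · exact Ideal.finite_minimalPrimes_of_isNoetherianRing B _
  refine hfin.subset ?_
  rintro q ⟨hq, hIq, h2, hN⟩
  obtain ⟨p, hp, hp1, hIp, hpq⟩ := h1 q hq hIq
  have hmin : ∀ q' : Ideal B, q'.IsPrime → p ≤ q' → q' ≤ q → q' ≠ p → q' = q := by
    intro q' hq' hpq' hle hne
    by_contra hne'
    have h3 := Ideal.height_add_one_le_of_lt_of_isPrime (lt_of_le_of_ne hpq' hne.symm)
    have h4 := Ideal.height_add_one_le_of_lt_of_isPrime (lt_of_le_of_ne hle hne')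
    have h5 := (add_le_add_left h3 1).trans h4
    rw [hp1, h2] at h5
    exact absurd h5 (by norm_num)
  by_cases huniq : ∀ p' : Ideal B, p'.IsPrime → p'.height = 1 → I ≤ p' → p' ≤ q → p' = p
  · refine Or.inr (Set.mem_biUnion (x := p) ⟨hp, hp1, hIp⟩ ?_)
    have hfq : f p ∈ q := by
      by_contra hfq
      refine hN ⟨p, hp, hIp, hpq, exists_mul_mem_of_unique hI h1 huniq, fun z hz => ?_⟩
      obtain ⟨k, d, hd⟩ := hf p hp z hz
      exact ⟨f p ^ k, fun h => hfq (hq.mem_of_pow_mem _ h), d, hd⟩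
    refine ⟨⟨hq, sup_le hpq ((Ideal.span_singleton_le_iff_mem _).mpr hfq)⟩, ?_⟩
    rintro q' ⟨hq', hle'⟩ hle
    refine (hmin q' hq' (le_sup_left.trans hle') hle ?_).ge
    rintro rfl
    exact hfp q' hq' (hle' (Ideal.mem_sup_right (Ideal.mem_span_singleton_self _)))
  · push Not at huniq
    obtain ⟨p', hp', h', hIp', hpq', hne'⟩ := huniq
    refine Or.inl (Set.mem_biUnion (x := p) ⟨hp, hp1, hIp⟩
      (Set.mem_biUnion (x := p') ⟨hp', h', hIp'⟩ ?_))
    refine ⟨⟨hq, sup_le hpq hpq'⟩, ?_⟩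
    rintro q' ⟨hq', hle'⟩ hle
    refine (hmin q' hq' (le_sup_left.trans hle') hle ?_).ge
    rintro rfl
    exact hne' (eq_of_le_of_height_eq_one (le_sup_right.trans hle') h' hp1)

end Noetherian

end NonNormalLocus

end RVar
namespace RVar

/-! ### Formal power series rings are normal -/

/-- A domain is completely integrally closed if it contains all fractions that are almost integral
over it. -/
def IsCompletelyIntegrallyClosed (A : Type*) [CommRing A] : Prop :=
  ∀ a b r : A, b ≠ 0 → r ≠ 0 → (∀ n : ℕ, b ^ n ∣ r * a ^ n) → b ∣ a

/-- If `b = a u` with `u` a non-unit, the divisibilities say that every `uⁿ` divides `r`. This is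
impossible for `r ≠ 0` in a Noetherian domain. -/
lemma isCompletelyIntegrallyClosed_of_valuationRing (A : Type*) [CommRing A] [IsDomain A]
    [ValuationRing A] [IsNoetherianRing A] : IsCompletelyIntegrallyClosed A := by
  intro a b r hb hr h
  rcases ValuationRing.dvd_total b a with h1 | ⟨u, hu⟩
  · exact h1
  · by_cases hu' : IsUnit u
    · obtain ⟨v, rfl⟩ := hu'
      exact ⟨↑v⁻¹, by rw [hu]; simp [mul_assoc]⟩
    · exfalso
      have ha : a ≠ 0 := by rintro rfl; simp at hu; exact hb hu
      obtain ⟨n, hn⟩ := FiniteMultiplicity.of_not_isUnit hu' hr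
      apply hn
      have := h (n + 1)
      rw [hu, mul_pow, mul_comm r] at this
      exact (mul_dvd_mul_iff_left (pow_ne_zero _ ha)).mp this

lemma IsCompletelyIntegrallyClosed.isIntegrallyClosed {A : Type*} [CommRing A] [IsDomain A]
    (h : IsCompletelyIntegrallyClosed A) : IsIntegrallyClosed A := by
  rw [isIntegrallyClosed_iff (FractionRing A)]
  intro x hx
  obtain ⟨r, hr, hr'⟩ := hx.isAlmostIntegral
  obtain ⟨a, b, hb, rfl⟩ := IsFractionRing.div_surjective (A := A) x
  have hb0 : algebraMap A (FractionRing A) b ≠ 0 := by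
    simpa using nonZeroDivisors.ne_zero hb
  obtain ⟨c, hc⟩ := h a b r (nonZeroDivisors.ne_zero hb) (nonZeroDivisors.ne_zero hr) fun n ↦ by
    obtain ⟨c, hc⟩ := hr' n
    refine ⟨c, ?_⟩
    apply IsFractionRing.injective A (FractionRing A)
    rw [Algebra.smul_def, div_pow] at hc
    simp only [map_mul, map_pow]
    rw [hc]
    field_simp
  exact ⟨c, by rw [hc, map_mul]; field_simp⟩

section

variable {A F : Type*} [CommRing A] [IsDomain A] [Field F] [Algebra A F] [IsFractionRing A F]

open PowerSeries in
-- In `r wⁿ` the coefficient at the order of `r` is the lowest coefficient of `r` times the `n`-th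
-- power of the constant term of `w`. So the lowest coefficient of `r` is a common denominator for
-- these powers.
lemma constantCoeff_mem_range_of_isAlmostIntegral (hA : IsCompletelyIntegrallyClosed A)
    {w : F⟦X⟧} (hw : IsAlmostIntegral A⟦X⟧ w) : ∃ a, algebraMap A F a = constantCoeff w := by
  obtain ⟨r, hr, h⟩ := hw
  have hr0 := nonZeroDivisors.ne_zero hr
  obtain ⟨a, b, hb, hab⟩ := IsFractionRing.div_surjective (A := A) (constantCoeff w)
  have hb0 : algebraMap A F b ≠ 0 := by simpa using nonZeroDivisors.ne_zero hb
  set m := r.order.toNat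
  obtain ⟨c, hc⟩ := hA a b (coeff m r) (nonZeroDivisors.ne_zero hb) (coeff_order hr0) fun n ↦ by
    obtain ⟨c, hc⟩ := h n
    refine ⟨coeff m c, ?_⟩
    apply IsFractionRing.injective A F
    have h2 : algebraMap A F (coeff m c) = algebraMap A F (coeff m r) * constantCoeff w ^ n := by
      have h3 := congrArg (coeff m) hc
      obtain ⟨r', hr'⟩ := X_pow_order_dvd (φ := r)
      rw [Algebra.smul_def, algebraMap_apply'', algebraMap_apply'', coeff_map] at h3
      have h4 : map (algebraMap A F) r = X ^ m * map (algebraMap A F) r' := by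
        simpa using congrArg (map (algebraMap A F)) hr'
      have h5 : coeff m r = constantCoeff r' := by
        simpa [coeff_X_pow_mul', m] using congrArg (coeff m) hr'
      rw [h3, h4, h5, mul_assoc, coeff_X_pow_mul', if_pos le_rfl, Nat.sub_self,
        coeff_zero_eq_constantCoeff_apply, map_mul, map_pow]
      congr 1
    rw [map_mul, map_mul, h2, ← hab, div_pow, map_pow, map_pow]
    field_simp
  exact ⟨c, by rw [← hab, hc, map_mul]; field_simp⟩

open PowerSeries in
-- Once the constant term is known to lie in `A`, it may be subtracted; dividing the rest by `X`
-- preserves almost integrality and shifts the coefficients by one.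
lemma coeff_mem_range_of_isAlmostIntegral (hA : IsCompletelyIntegrallyClosed A) (n : ℕ)
    {w : F⟦X⟧} (hw : IsAlmostIntegral A⟦X⟧ w) : ∃ a, algebraMap A F a = coeff n w := by
  induction n generalizing w with
  | zero => simpa using constantCoeff_mem_range_of_isAlmostIntegral hA hw
  | succ n ih =>
    obtain ⟨a, ha⟩ := constantCoeff_mem_range_of_isAlmostIntegral hA hw
    have h1 : IsAlmostIntegral A⟦X⟧ (w - C (constantCoeff w)) := by
      refine (completeIntegralClosure A⟦X⟧ F⟦X⟧).sub_mem hw ?_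
      have : C (constantCoeff w) = algebraMap A⟦X⟧ F⟦X⟧ (C a) := by
        rw [algebraMap_apply'', map_C, ha]
      rw [this]
      exact Subalgebra.algebraMap_mem _ _
    have h2 := eq_X_mul_shift_add_const w
    set w' : F⟦X⟧ := PowerSeries.mk fun p ↦ coeff (p + 1) w with hw'
    have h3 : w - C (constantCoeff w) = X * w' := by rw [sub_eq_iff_eq_add, ← h2]
    rw [h3] at h1
    obtain ⟨a, ha⟩ := ih (w := w') <| by
      obtain ⟨r, hr, h⟩ := h1
      refine ⟨r, hr, fun n ↦ ?_⟩
      obtain ⟨c, hc⟩ := h n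
      rw [Algebra.smul_def, algebraMap_apply'', algebraMap_apply'', mul_pow, mul_left_comm] at hc
      have h4 : (X : A⟦X⟧) ^ n ∣ c := by
        rw [X_pow_dvd_iff]
        intro m hm
        have := (X_pow_dvd_iff (n := n)).mp (Dvd.intro _ hc.symm) m hm
        rw [coeff_map] at this
        simpa using this
      obtain ⟨c', rfl⟩ := h4
      refine ⟨c', ?_⟩
      rw [map_mul, map_pow, map_X] at hc
      rw [Algebra.smul_def, algebraMap_apply'', algebraMap_apply'']
      exact mul_left_cancel₀ (pow_ne_zero _ X_ne_zero) hc
    exact ⟨a, by rw [ha, hw', coeff_mk]⟩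

end

open PowerSeries in
-- This permanence, which needs no Noetherian hypothesis, is why complete integral closedness
-- carries the induction on the number of variables. The quotient exists over the fraction field,
-- where power series form a valuation ring, and its coefficients descend to `A`.
lemma IsCompletelyIntegrallyClosed.powerSeries {A : Type*} [CommRing A] [IsDomain A]
    (hA : IsCompletelyIntegrallyClosed A) : IsCompletelyIntegrallyClosed A⟦X⟧ := by
  intro f g r hg hr h
  let F := FractionRing A
  have hinj : Function.Injective (map (algebraMap A F)) := by
    intro x y hxy
    ext n
    apply IsFractionRing.injective A F
    simpa using congrArg (coeff n) hxy
  have hne : ∀ {x : A⟦X⟧}, x ≠ 0 → map (algebraMap A F) x ≠ 0 := fun hx ↦ by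
    rwa [ne_eq, map_eq_zero_iff _ hinj]
  obtain ⟨w, hw⟩ := isCompletelyIntegrallyClosed_of_valuationRing F⟦X⟧ (map (algebraMap A F) f)
    (map (algebraMap A F) g) (map (algebraMap A F) r) (hne hg) (hne hr) fun n ↦ by
      simpa using map_dvd (map (algebraMap A F)) (h n)
  have hai : IsAlmostIntegral A⟦X⟧ w := by
    refine ⟨r, mem_nonZeroDivisors_of_ne_zero hr, fun n ↦ ?_⟩
    obtain ⟨c, hc⟩ := h n
    refine ⟨c, ?_⟩
    rw [Algebra.smul_def, algebraMap_apply'', algebraMap_apply'']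
    have := congrArg (map (algebraMap A F)) hc
    simp only [map_mul, map_pow, hw, mul_pow] at this
    rw [mul_left_comm] at this
    exact (mul_left_cancel₀ (pow_ne_zero _ (hne hg)) this).symm
  choose a ha using fun n ↦ coeff_mem_range_of_isAlmostIntegral (F := F) hA n hai
  refine ⟨PowerSeries.mk a, hinj ?_⟩
  rw [hw, map_mul]
  congr 1
  ext n
  simp [ha]

lemma IsCompletelyIntegrallyClosed.of_equiv {A B : Type*} [CommRing A] [CommRing B] (e : A ≃+* B)
    (hA : IsCompletelyIntegrallyClosed A) : IsCompletelyIntegrallyClosed B := by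
  intro a b r hb hr h
  have := hA (e.symm a) (e.symm b) (e.symm r) (by simpa) (by simpa) fun n ↦ by
    simpa using map_dvd e.symm (h n)
  simpa using map_dvd e this

instance isDomain_mvPowerSeries (σ K : Type*) [Field K] : IsDomain (MvPowerSeries σ K) :=
  NoZeroDivisors.to_isDomain _

lemma isCompletelyIntegrallyClosed_mvPowerSeries (K : Type*) [Field K] (n : ℕ) :
    IsCompletelyIntegrallyClosed (MvPowerSeries (Fin n) K) := by
  induction n with
  | zero =>
    intro a b r hb _ _
    refine IsUnit.dvd ?_
    rw [MvPowerSeries.isUnit_iff_constantCoeff, isUnit_iff_ne_zero]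
    intro h0
    apply hb
    ext m
    rw [Subsingleton.elim m 0]
    simpa using h0
  | succ n ih => exact (ih.powerSeries).of_equiv (MvPowerSeries.finSuccEquiv K n).symm.toRingEquiv

instance isIntegrallyClosed_mvPowerSeries (K : Type*) [Field K] (n : ℕ) :
    IsIntegrallyClosed (MvPowerSeries (Fin n) K) :=
  (isCompletelyIntegrallyClosed_mvPowerSeries K n).isIntegrallyClosed

end RVar
namespace RVar

/-! ### Normalization of quotients of formal power series rings -/

lemma mem_smul_top_pi_iff {A : Type*} [CommRing A] (I : Ideal A) {k : ℕ} (x : Fin k → A) :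
    x ∈ (I • ⊤ : Submodule A (Fin k → A)) ↔ ∀ i, x i ∈ I := by
  constructor
  · intro hx i
    have := Submodule.mem_map_of_mem (f := LinearMap.proj (R := A) (φ := fun _ : Fin k ↦ A) i) hx
    rw [Submodule.map_smul''] at this
    have h2 : (I • Submodule.map (LinearMap.proj i) (⊤ : Submodule A (Fin k → A)) : Submodule A A)
        ≤ I := Submodule.smul_le.mpr fun a ha b _ ↦ Ideal.mul_mem_right _ _ ha
    exact h2 this
  · intro hx
    rw [pi_eq_sum_univ x]
    exact Submodule.sum_mem _ fun i _ ↦ Submodule.smul_mem_smul (hx i) trivial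

lemma isPrecomplete_pi {A : Type*} [CommRing A] (I : Ideal A) [IsPrecomplete I A] (k : ℕ) :
    IsPrecomplete I (Fin k → A) := by
  refine ⟨fun f hf ↦ ?_⟩
  have h1 : ∀ i : Fin k, ∃ L : A, ∀ n, f n i ≡ L [SMOD (I ^ n • ⊤ : Submodule A A)] := by
    intro i
    refine IsPrecomplete.prec ‹_› (f := fun n ↦ f n i) fun {m n} hmn ↦ ?_
    have := hf hmn
    rw [SModEq.sub_mem, mem_smul_top_pi_iff] at this
    rw [SModEq.sub_mem]
    simpa using this i
  choose L hL using h1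
  refine ⟨L, fun n ↦ ?_⟩
  rw [SModEq.sub_mem, mem_smul_top_pi_iff]
  intro i
  have := hL i n
  rw [SModEq.sub_mem] at this
  simpa using this

/-- `A` maps onto the residue field, so each layer `𝔪ⁿ / 𝔪ⁿ⁺¹` is spanned over `A` by generators of
`𝔪ⁿ`. -/
lemma exists_fg_sup_maximalIdeal_pow {A D : Type*} [CommRing A] [CommRing D] [IsLocalRing D]
    [IsNoetherianRing D] [Algebra A D]
    (hres : ∀ y : D, ∃ a : A, y - algebraMap A D a ∈ IsLocalRing.maximalIdeal D) (n : ℕ) :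
    ∃ W : Submodule A D, W.FG ∧
      ∀ y : D, ∃ w ∈ W, y - w ∈ IsLocalRing.maximalIdeal D ^ n := by
  induction n with
  | zero => exact ⟨⊥, Submodule.fg_bot, fun y ↦ ⟨0, by simp⟩⟩
  | succ n ih =>
    obtain ⟨W, hW, h⟩ := ih
    obtain ⟨s, hs⟩ := (isNoetherianRing_iff_ideal_fg D).mp ‹_› (IsLocalRing.maximalIdeal D ^ n)
    refine ⟨W ⊔ Submodule.span A (s : Set D), hW.sup (Submodule.fg_span s.finite_toSet),
      fun y ↦ ?_⟩
    obtain ⟨w, hw, hyw⟩ := h y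
    have key : ∀ x ∈ Submodule.span D (s : Set D), ∃ v ∈ Submodule.span A (s : Set D),
        x - v ∈ IsLocalRing.maximalIdeal D ^ (n + 1) := by
      intro x hx
      induction hx using Submodule.span_induction with
      | mem x hx => exact ⟨x, Submodule.subset_span hx, by simp⟩
      | zero => exact ⟨0, zero_mem _, by simp⟩
      | add x y _ _ h1 h2 =>
        obtain ⟨v1, hv1, h1⟩ := h1
        obtain ⟨v2, hv2, h2⟩ := h2
        exact ⟨v1 + v2, add_mem hv1 hv2, by
          have := add_mem h1 h2
          rwa [sub_add_sub_comm] at this⟩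
      | smul a x hx h1 =>
        obtain ⟨v, hv, h1⟩ := h1
        obtain ⟨c, hc⟩ := hres a
        refine ⟨c • v, Submodule.smul_mem _ _ hv, ?_⟩
        have hx' : x ∈ IsLocalRing.maximalIdeal D ^ n := by rw [← hs]; exact hx
        have e : a • x - c • v = (a - algebraMap A D c) * x + algebraMap A D c * (x - v) := by
          rw [smul_eq_mul, Algebra.smul_def]; ring
        rw [e, pow_succ']
        refine add_mem (Ideal.mul_mem_mul hc hx') ?_
        rw [← pow_succ']
        exact Ideal.mul_mem_left _ _ h1
    obtain ⟨v, hv, hv2⟩ := key (y - w) (by rw [← hs] at hyw; exact hyw)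
    exact ⟨w + v, add_mem (Submodule.mem_sup_left hw) (Submodule.mem_sup_right hv), by
      rwa [← sub_sub]⟩

/-- Nakayama's lemma for complete rings: `D` is finite modulo `J`, separated for the `J`-adic
topology, and `A` is precomplete, so lifts of generators modulo `J` generate. -/
lemma finite_of_maximalIdeal_pow_le {A D : Type*} [CommRing A] [CommRing D] [IsLocalRing D]
    [IsNoetherianRing D] [Algebra A D] (J : Ideal A) [IsPrecomplete J A]
    (hres : ∀ y : D, ∃ a : A, y - algebraMap A D a ∈ IsLocalRing.maximalIdeal D) (n : ℕ)
    (hn : IsLocalRing.maximalIdeal D ^ n ≤ J.map (algebraMap A D))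
    (hJ : J.map (algebraMap A D) ≤ IsLocalRing.maximalIdeal D) : Module.Finite A D := by
  obtain ⟨W, hW, h⟩ := exists_fg_sup_maximalIdeal_pow hres n
  have : IsHausdorff (J.map (algebraMap A D)) D :=
    .of_le_jacobson _ _ (hJ.trans (IsLocalRing.maximalIdeal_le_jacobson _))
  have : IsHausdorff J D := IsHausdorff.map_algebraMap_iff.mp this
  obtain ⟨k, g, hg⟩ := Submodule.fg_iff_exists_fin_generating_family.mp hW
  have := isPrecomplete_pi J k
  have hsurj : Function.Surjective (Fintype.linearCombination A g) := by
    refine surjective_of_mkQ_comp_surjective (I := J) fun z ↦ ?_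
    obtain ⟨y, rfl⟩ := Submodule.mkQ_surjective _ z
    obtain ⟨w, hw, hyw⟩ := h y
    rw [← hg, ← Fintype.range_linearCombination] at hw
    obtain ⟨c, rfl⟩ := hw
    refine ⟨c, ?_⟩
    rw [LinearMap.comp_apply, eq_comm, ← sub_eq_zero, ← map_sub, Submodule.mkQ_apply,
      Submodule.Quotient.mk_eq_zero, Ideal.smul_top_eq_map]
    exact hn hyw
  exact Module.Finite.of_surjective _ hsurj

open MvPowerSeries in
lemma exists_finite_algHom_quotient {K : Type*} [Field K] {d : ℕ}
    (I : Ideal (MvPowerSeries (Fin d) K)) (hI : I ≠ ⊤) :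
    ∃ (e : ℕ) (φ : MvPowerSeries (Fin e) K →+* MvPowerSeries (Fin d) K ⧸ I),
      (e : WithBot ℕ∞) = ringKrullDim (MvPowerSeries (Fin d) K ⧸ I) ∧ φ.Finite := by
  set D := MvPowerSeries (Fin d) K ⧸ I
  have : Nontrivial D := Ideal.Quotient.nontrivial_iff.mpr hI
  have : IsLocalRing D := .of_surjective' (Ideal.Quotient.mk I) Ideal.Quotient.mk_surjective
  -- A system of parameters of `D`. Its members are the images of the new variables, and since it
  -- generates an ideal containing a power of the maximal ideal, `D` is finite over them.
  obtain ⟨s, hs, hcard⟩ := (IsLocalRing.maximalIdeal D).exists_finset_card_eq_height_of_isNoetherianRing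
  set e := s.card
  let z : Fin e → D := fun i ↦ (s.equivFin.symm i : D)
  have hz : Set.range z = s := by
    ext x
    constructor
    · rintro ⟨i, rfl⟩; exact (s.equivFin.symm i).2
    · intro hx; exact ⟨s.equivFin ⟨x, hx⟩, by simp [z]⟩
  have hmk : ∀ x : MvPowerSeries (Fin d) K, constantCoeff x = 0 ↔
      Ideal.Quotient.mk I x ∈ IsLocalRing.maximalIdeal D := by
    intro x
    have := IsLocalHom.of_surjective (Ideal.Quotient.mk I) Ideal.Quotient.mk_surjective
    rw [IsLocalRing.mem_maximalIdeal, mem_nonunits_iff, isUnit_map_iff,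
      MvPowerSeries.isUnit_iff_constantCoeff, isUnit_iff_ne_zero, not_not]
  choose y hy using fun i ↦ Ideal.Quotient.mk_surjective (z i)
  have hsub : HasSubst y := hasSubst_of_constantCoeff_zero fun i ↦ by
    rw [hmk, hy]
    exact hs.1.2 (Ideal.subset_span (hz ▸ ⟨i, rfl⟩))
  let φ : MvPowerSeries (Fin e) K →ₐ[K] D :=
    (Ideal.Quotient.mkₐ K I).comp (substAlgHom hsub)
  refine ⟨e, φ.toRingHom, ?_, ?_⟩
  · rw [← IsLocalRing.maximalIdeal_height_eq_ringKrullDim, ← hcard]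
    simp [e]
  · algebraize [φ.toRingHom]
    have hmap : (Ideal.span (Set.range X)).map (algebraMap (MvPowerSeries (Fin e) K) D) =
        Ideal.span (s : Set D) := by
      rw [Ideal.map_span, ← hz, ← Set.range_comp]
      congr 2
      funext i
      change Ideal.Quotient.mk I (substAlgHom hsub (X i)) = z i
      rw [substAlgHom_X, hy]
    have hle : IsLocalRing.maximalIdeal D ≤ (Ideal.span (s : Set D)).radical := by
      rw [Ideal.radical_eq_sInf]
      refine le_sInf fun P hP ↦ hs.2 ⟨hP.2, hP.1⟩ (IsLocalRing.le_maximalIdeal hP.2.ne_top)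
    obtain ⟨n, hn⟩ := Ideal.exists_pow_le_of_le_radical_of_fg hle
      ((isNoetherianRing_iff_ideal_fg D).mp inferInstance _)
    refine finite_of_maximalIdeal_pow_le (Ideal.span (Set.range X)) (fun a ↦ ?_) n
      (hmap ▸ hn) (hmap ▸ hs.1.2)
    obtain ⟨x, rfl⟩ := Ideal.Quotient.mk_surjective a
    refine ⟨algebraMap K _ (constantCoeff x), ?_⟩
    have : algebraMap (MvPowerSeries (Fin e) K) D (algebraMap K _ (constantCoeff x)) =
        Ideal.Quotient.mk I (C (constantCoeff x)) := φ.commutes _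
    rw [this, ← map_sub, ← hmk]
    simp

open MvPowerSeries in
lemma mem_span_range_X_of_constantCoeff_eq_zero {K : Type*} [Field K] {d : ℕ}
    (f : MvPowerSeries (Fin d) K) (hf : constantCoeff f = 0) :
    f ∈ Ideal.span (Set.range (X : Fin d → MvPowerSeries (Fin d) K)) := by
  have h : ∀ m : Fin d →₀ ℕ, m ≠ 0 → ∃ i, m i ≠ 0 := fun m hm ↦ by
    by_contra! h
    exact hm (Finsupp.ext h)
  rcases isEmpty_or_nonempty (Fin d) with hd | hd
  · have : f = 0 := by
      ext m
      rw [Subsingleton.elim m 0]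
      simpa using hf
    rw [this]
    exact zero_mem _
  choose! j hj using h
  -- Every nonconstant monomial `m` is assigned to one variable `j m` that divides it.
  let g : Fin d → MvPowerSeries (Fin d) K := fun i m ↦ if m ≠ 0 ∧ j m = i then coeff m f else 0
  have hcg : ∀ i m, coeff m (g i) = if m ≠ 0 ∧ j m = i then coeff m f else 0 := fun _ _ ↦ rfl
  have hsum : f = ∑ i, g i := by
    ext m
    rw [map_sum]
    simp only [hcg]
    by_cases hm : m = 0
    · subst hm; simpa using hf
    · simp [hm]
  rw [hsum]
  refine Ideal.sum_mem _ fun i _ ↦ ?_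
  have : X i ∣ g i := by
    rw [X_dvd_iff]
    intro m hm
    rw [hcg, if_neg]
    rintro ⟨h1, rfl⟩
    exact hj m h1 hm
  exact Ideal.mem_of_dvd _ this (Ideal.subset_span ⟨i, rfl⟩)

lemma ringKrullDim_mvPowerSeries_le (K : Type*) [Field K] (d : ℕ) :
    ringKrullDim (MvPowerSeries (Fin d) K) ≤ d := by
  have h : IsLocalRing.maximalIdeal (MvPowerSeries (Fin d) K) =
      Ideal.span (Set.range MvPowerSeries.X) := by
    refine le_antisymm (fun f hf ↦ mem_span_range_X_of_constantCoeff_eq_zero f ?_)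
      (Ideal.span_le.mpr ?_)
    · rw [IsLocalRing.mem_maximalIdeal, mem_nonunits_iff,
        MvPowerSeries.isUnit_iff_constantCoeff, isUnit_iff_ne_zero, not_not] at hf
      exact hf
    · rintro _ ⟨i, rfl⟩
      rw [SetLike.mem_coe, IsLocalRing.mem_maximalIdeal, mem_nonunits_iff,
        MvPowerSeries.isUnit_iff_constantCoeff]
      simp
  have hfin : (Set.range (MvPowerSeries.X : Fin d → MvPowerSeries (Fin d) K)).Finite :=
    Set.finite_range _
  have h1 : (IsLocalRing.maximalIdeal (MvPowerSeries (Fin d) K)).spanFinrank ≤ d := by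
    rw [h]
    refine (Submodule.spanFinrank_span_le_ncard_of_finite hfin).trans ?_
    rw [← Set.image_univ]
    exact (Set.ncard_image_le Set.finite_univ).trans (by simp [Set.ncard_univ])
  rw [← IsLocalRing.maximalIdeal_height_eq_ringKrullDim]
  have h2 := Ideal.height_le_spanFinrank (IsLocalRing.maximalIdeal (MvPowerSeries (Fin d) K))
    (IsLocalRing.maximalIdeal.isMaximal _).ne_top
  exact_mod_cast h2.trans (by exact_mod_cast h1)

/-- Noether normalization for quotients of formal power series rings. -/
lemma exists_finite_injective_quotient {K : Type*} [Field K] {d : ℕ}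
    (I : Ideal (MvPowerSeries (Fin d) K)) (hI : I ≠ ⊤) :
    ∃ (e : ℕ) (φ : MvPowerSeries (Fin e) K →+* MvPowerSeries (Fin d) K ⧸ I),
      φ.Finite ∧ Function.Injective φ := by
  classical
  have hex : ∃ (e : ℕ) (φ : MvPowerSeries (Fin e) K →+* MvPowerSeries (Fin d) K ⧸ I),
      φ.Finite := by
    obtain ⟨e, φ, -, h⟩ := exists_finite_algHom_quotient I hI
    exact ⟨e, φ, h⟩
  -- The number of variables is minimal. A nonzero `a` killed by `φ` would make `φ` factor through
  -- the quotient by `a`, which has smaller dimension and is finite over a power series ring in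
  -- fewer variables.
  obtain ⟨φ, hφ⟩ := Nat.find_spec hex
  refine ⟨Nat.find hex, φ, hφ, ?_⟩
  rw [injective_iff_map_eq_zero]
  by_contra! h
  obtain ⟨a, ha, ha0⟩ := h
  have : Nontrivial (MvPowerSeries (Fin d) K ⧸ I) := Ideal.Quotient.nontrivial_iff.mpr hI
  have hne : Ideal.span {a} ≠ ⊤ := by
    intro h
    have : φ 1 = 0 := by
      have h1 : (1 : MvPowerSeries (Fin (Nat.find hex)) K) ∈ Ideal.span {a} := h ▸ trivial
      obtain ⟨b, hb⟩ := Ideal.mem_span_singleton.mp h1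
      rw [hb, map_mul, ha, zero_mul]
    simp at this
  obtain ⟨e, ψ, he, hψ⟩ := exists_finite_algHom_quotient (Ideal.span {a}) hne
  have hlt : e < Nat.find hex := by
    have h1 := ringKrullDim_quotient_succ_le_of_nonZeroDivisor (mem_nonZeroDivisors_of_ne_zero ha0)
    rw [← he] at h1
    have h2 := h1.trans (ringKrullDim_mvPowerSeries_le K _)
    have h3 : e + 1 ≤ Nat.find hex := by exact_mod_cast h2
    omega
  have hlift : ∀ x ∈ Ideal.span {a}, φ x = 0 := fun x hx ↦ by
    obtain ⟨b, rfl⟩ := Ideal.mem_span_singleton.mp hx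
    rw [map_mul, ha, zero_mul]
  refine Nat.find_min hex hlt ⟨(Ideal.Quotient.lift _ φ hlift).comp ψ, ?_⟩
  refine RingHom.Finite.comp (RingHom.Finite.of_comp_finite (f := Ideal.Quotient.mk _) ?_) hψ
  rwa [Ideal.Quotient.lift_comp_mk]

end RVar
namespace RVar

/-! ### Generic normality -/

lemma isIntegrallyClosed_mvPolynomial_fin (A : Type*) [CommRing A] [IsDomain A]
    [IsIntegrallyClosed A] (n : ℕ) : IsIntegrallyClosed (MvPolynomial (Fin n) A) := by
  induction n with
  | zero => exact IsIntegrallyClosed.of_equiv (MvPolynomial.isEmptyRingEquiv A (Fin 0)).symm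
  | succ n ih => exact IsIntegrallyClosed.of_equiv (MvPolynomial.finSuccEquiv A n).symm.toRingEquiv

lemma isIntegrallyClosed_mvPolynomial (A : Type*) [CommRing A] [IsDomain A]
    [IsIntegrallyClosed A] (σ : Type*) [Finite σ] : IsIntegrallyClosed (MvPolynomial σ A) := by
  obtain ⟨n, ⟨e⟩⟩ := Finite.exists_equiv_fin σ
  have := isIntegrallyClosed_mvPolynomial_fin A n
  exact IsIntegrallyClosed.of_equiv (MvPolynomial.renameEquiv A e.symm).toRingEquiv

open scoped nonZeroDivisors

/-- After inverting `b` the image of `D` becomes integral, so `z` is integral over `P[1/b]` by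
transitivity; a power of `b` then clears the denominators. -/
lemma exists_pow_smul_isIntegral {P D L : Type*} [CommRing P] [CommRing D] [Field L] [Algebra P D]
    [Algebra D L] [Algebra P L] [IsScalarTower P D L] (b : P) (hb : algebraMap P L b ≠ 0)
    (h : ∀ y : D, ∃ k : ℕ, IsIntegral P (b ^ k • algebraMap D L y)) {z : L}
    (hz : IsIntegral D z) : ∃ k : ℕ, IsIntegral P (b ^ k • z) := by
  have hbL : IsUnit (algebraMap P L b) := isUnit_iff_ne_zero.mpr hb
  let P' := Localization.Away b
  let _ : Algebra P' L := (IsLocalization.Away.lift b hbL).toAlgebra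
  have : IsScalarTower P P' L := .of_algebraMap_eq fun x ↦
    (IsLocalization.Away.lift_eq b hbL x).symm
  have hD : ∀ y : D, algebraMap D L y ∈ integralClosure P' L := by
    intro y
    obtain ⟨k, hk⟩ := h y
    have h3 : algebraMap D L y =
        IsLocalization.Away.invSelf (S := P') b ^ k • (b ^ k • algebraMap D L y) := by
      rw [Algebra.smul_def (b ^ k), Algebra.smul_def, IsScalarTower.algebraMap_apply P P' L,
        ← mul_assoc, ← map_mul, map_pow, ← mul_pow, mul_comm (IsLocalization.Away.invSelf b),
        IsLocalization.Away.mul_invSelf, one_pow, map_one, one_mul]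
    rw [h3]
    exact (hk.tower_top (A := P')).smul _
  have hz2 : IsIntegral (integralClosure P' L) z := by
    obtain ⟨p, hp, hpz⟩ := hz
    let g : D →+* integralClosure P' L := (algebraMap D L).codRestrict _ hD
    refine ⟨p.map g, hp.map _, ?_⟩
    rw [Polynomial.eval₂_map]
    exact hpz
  have hz3 : IsIntegral P' z := isIntegral_trans z hz2
  obtain ⟨⟨_, k, rfl⟩, hk⟩ :=
    IsIntegral.exists_multiple_integral_of_isLocalization (Submonoid.powers b) z hz3
  exact ⟨k, hk⟩

lemma exists_integral_multiple_of_isAlgebraic {P D L : Type*} [CommRing P] [IsDomain P]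
    [CommRing D] [Field L] [Algebra P D] [Algebra D L] [Algebra P L] [IsScalarTower P D L]
    [FaithfulSMul P L] [Algebra.FiniteType P D] [Algebra.IsAlgebraic P D] :
    ∃ c : P, c ≠ 0 ∧ ∀ z : L, IsIntegral D z → ∃ k : ℕ, IsIntegral P (c ^ k • z) := by
  obtain ⟨s, hs⟩ := Algebra.FiniteType.out (R := P) (A := D)
  have h1 : ∀ y : D, ∃ c : P, c ≠ 0 ∧ IsIntegral P (c • y) := fun y ↦
    (Algebra.IsAlgebraic.isAlgebraic (R := P) y).exists_integral_multiple
  choose c hc0 hc using h1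
  let b := ∏ y ∈ s, c y
  have hb0 : b ≠ 0 := Finset.prod_ne_zero_iff.mpr fun y _ ↦ hc0 y
  have hb : ∀ y ∈ s, IsIntegral P (b • y) := by
    classical
    intro y hy
    have : b = (∏ x ∈ s.erase y, c x) * c y := (Finset.prod_erase_mul _ _ hy).symm
    rw [this, mul_smul]
    exact (hc y).smul _
  have hD : ∀ y : D, ∃ k : ℕ, IsIntegral P (b ^ k • y) := by
    intro y
    have hy : y ∈ Algebra.adjoin P (s : Set D) := hs ▸ trivial
    induction hy using Algebra.adjoin_induction with
    | mem y hy => exact ⟨1, by rw [pow_one]; exact hb y hy⟩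
    | algebraMap r => exact ⟨0, by rw [pow_zero, one_smul]; exact isIntegral_algebraMap⟩
    | add x y _ _ hx hy =>
      obtain ⟨k, hx⟩ := hx
      obtain ⟨l, hy⟩ := hy
      refine ⟨k + l, ?_⟩
      rw [smul_add]
      refine .add ?_ ?_
      · rw [pow_add, mul_comm, mul_smul]
        exact hx.smul _
      · rw [pow_add, mul_smul]
        exact hy.smul _
    | mul x y _ _ hx hy =>
      obtain ⟨k, hx⟩ := hx
      obtain ⟨l, hy⟩ := hy
      refine ⟨k + l, ?_⟩
      rw [pow_add, ← smul_mul_smul_comm]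
      exact hx.mul hy
  refine ⟨b, hb0, fun z hz ↦ exists_pow_smul_isIntegral (D := D) b ?_ (fun y ↦ ?_) hz⟩
  · rwa [ne_eq, FaithfulSMul.algebraMap_eq_zero_iff]
  · obtain ⟨k, hk⟩ := hD y
    refine ⟨k, ?_⟩
    have := hk.algebraMap (B := L)
    rwa [Algebra.smul_def, map_mul, ← IsScalarTower.algebraMap_apply, ← Algebra.smul_def] at this

lemma finiteDimensional_of_isAlgebraic (P D Q L : Type*) [CommRing P] [IsDomain P]
    [CommRing D] [IsDomain D] [Field Q] [Field L] [Algebra P D] [Algebra D L] [Algebra P L]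
    [IsScalarTower P D L] [IsFractionRing D L] [Algebra P Q] [Algebra Q L]
    [IsScalarTower P Q L] [IsFractionRing P Q] [Algebra.FiniteType P D]
    [Algebra.IsAlgebraic P L] : FiniteDimensional Q L := by
  have : Algebra.EssFiniteType D L := .of_isLocalization _ D⁰
  have : Algebra.EssFiniteType P L := .comp P D L
  have : Algebra.EssFiniteType Q L := .of_comp P Q L
  have : Algebra.IsAlgebraic Q L := .extendScalars (IsFractionRing.injective P Q)
  have h := IntermediateField.fg_top Q L
  obtain ⟨s, hs⟩ := h
  have := IntermediateField.finiteDimensional_adjoin (K := Q) (S := (s : Set L)) fun x _ ↦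
    Algebra.IsIntegral.isIntegral x
  rw [hs] at this
  exact IntermediateField.topEquiv.toLinearEquiv.finiteDimensional

/-- In characteristic zero the integral closure of the normal ring `P` in the fraction field of `D`
is a finite `P`-module, so one `b` multiplies it into `D`. Some `c` in `P` has powers carrying
elements integral over `D` into that closure. The product `b c` serves as `f`. -/
lemma exists_conductor_of_isAlgebraic (P D : Type*) [CommRing P] [IsDomain P]
    [IsNoetherianRing P] [IsIntegrallyClosed P] [CharZero P] [CommRing D] [IsDomain D]
    [Algebra P D] [FaithfulSMul P D] [Algebra.FiniteType P D] [Algebra.IsAlgebraic P D] :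
    ∃ f : D, f ≠ 0 ∧ ∀ z : FractionRing D, IsIntegral D z → ∃ (k : ℕ) (d : D),
      algebraMap D (FractionRing D) (f ^ k) * z = algebraMap D (FractionRing D) d := by
  let L := FractionRing D
  let Q := FractionRing P
  have : FaithfulSMul P L := (faithfulSMul_iff_algebraMap_injective _ _).mpr <| by
    rw [IsScalarTower.algebraMap_eq P D L]
    exact (IsFractionRing.injective D L).comp (FaithfulSMul.algebraMap_injective P D)
  let _ : Algebra Q L := FractionRing.liftAlgebra P L
  have : IsScalarTower P Q L := FractionRing.isScalarTower_liftAlgebra P L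
  have : Algebra.IsAlgebraic P L := (IsFractionRing.isAlgebraic_iff' P D L).mp inferInstance
  have := finiteDimensional_of_isAlgebraic P D Q L
  have : CharZero Q := charZero_of_injective_algebraMap (IsFractionRing.injective P Q)
  have := IsIntegralClosure.finite P Q L (integralClosure P L)
  obtain ⟨s, hs⟩ := (Module.Finite.iff_fg (N := (integralClosure P L).toSubmodule)).mp this
  obtain ⟨b, hb⟩ := IsLocalization.exist_integer_multiples_of_finset D⁰ s
  obtain ⟨c, hc0, hc⟩ := exists_integral_multiple_of_isAlgebraic (P := P) (D := D) (L := L)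
  refine ⟨b * algebraMap P D c, mul_ne_zero (nonZeroDivisors.ne_zero b.2) ?_, fun z hz ↦ ?_⟩
  · rwa [ne_eq, FaithfulSMul.algebraMap_eq_zero_iff]
  · obtain ⟨k, hk⟩ := hc z hz
    have h1 : ∀ x ∈ Submodule.span P (s : Set L), ∃ d, algebraMap D L d = (b : D) • x := by
      intro x hx
      induction hx using Submodule.span_induction with
      | mem x hx => exact hb x hx
      | zero => exact ⟨0, by simp⟩
      | add x y _ _ h1 h2 =>
        obtain ⟨d1, h1⟩ := h1
        obtain ⟨d2, h2⟩ := h2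
        exact ⟨d1 + d2, by rw [map_add, h1, h2, smul_add]⟩
      | smul a x _ h1 =>
        obtain ⟨d1, h1⟩ := h1
        exact ⟨a • d1, by rw [Algebra.smul_def, map_mul, h1, ← IsScalarTower.algebraMap_apply,
          ← Algebra.smul_def, smul_comm]⟩
    obtain ⟨d, hd⟩ := h1 (c ^ k • z) (by rw [hs]; exact hk)
    refine ⟨k + 1, (b : D) ^ k * algebraMap P D c * d, ?_⟩
    rw [map_mul, hd, Algebra.smul_def, Algebra.smul_def, IsScalarTower.algebraMap_apply P D L]
    simp only [map_mul, map_pow]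
    ring

/-- A transcendence basis chosen among the generators of `D` spans a polynomial ring over `A`, which
is again normal and Noetherian, and over which `D` is algebraic. -/
lemma exists_conductor (A D : Type*) [CommRing A] [IsDomain A]
    [IsNoetherianRing A] [IsIntegrallyClosed A] [CharZero A] [CommRing D] [IsDomain D]
    [Algebra A D] [FaithfulSMul A D] [Algebra.FiniteType A D] :
    ∃ f : D, f ≠ 0 ∧ ∀ z : FractionRing D, IsIntegral D z → ∃ (k : ℕ) (d : D),
      algebraMap D (FractionRing D) (f ^ k) * z = algebraMap D (FractionRing D) d := by
  obtain ⟨s, hs⟩ := Algebra.FiniteType.out (R := A) (A := D)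
  have : Algebra.IsAlgebraic (Algebra.adjoin A (s : Set D)) D := by
    rw [hs]
    exact ⟨fun x ↦ isAlgebraic_algebraMap (⟨x, trivial⟩ : (⊤ : Subalgebra A D))⟩
  obtain ⟨t, hts, ht⟩ := exists_isTranscendenceBasis_subset (R := A) (s : Set D)
  have hfin : Finite t := (s.finite_toSet.subset hts).to_subtype
  have halg := ht.isAlgebraic
  have e := ht.1.aevalEquiv
  have := isIntegrallyClosed_mvPolynomial A t
  have : IsIntegrallyClosed (Algebra.adjoin A (Set.range ((↑) : t → D))) :=
    .of_equiv e.toRingEquiv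
  have : IsNoetherianRing (Algebra.adjoin A (Set.range ((↑) : t → D))) :=
    isNoetherianRing_of_ringEquiv _ e.toRingEquiv
  have : CharZero (Algebra.adjoin A (Set.range ((↑) : t → D))) :=
    charZero_of_injective_algebraMap (R := A) (FaithfulSMul.algebraMap_injective _ _)
  have : Algebra.FiniteType (Algebra.adjoin A (Set.range ((↑) : t → D))) D :=
    .of_restrictScalars_finiteType A _ _
  exact exists_conductor_of_isAlgebraic (Algebra.adjoin A (Set.range ((↑) : t → D))) D

/-- Algebras of finite type over a formal power series ring in characteristic zero are generically
normal along each prime. -/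
lemma isGenericallyNormal_of_finiteType {K : Type*} [Field K] [CharZero K] {d : ℕ} {B : Type*}
    [CommRing B] (g : MvPowerSeries (Fin d) K →+* B) (hg : g.FiniteType) (p : Ideal B)
    [hp : p.IsPrime] : IsGenericallyNormal p := by
  -- The image of the base in `B / p` need not be normal; Noether normalization replaces it by a
  -- power series ring, which is.
  obtain ⟨e, φ, hφ, hφi⟩ := exists_finite_injective_quotient (p.comap g)
    (hp.comap g).ne_top
  let ψ : MvPowerSeries (Fin e) K →+* B ⧸ p :=
    (Ideal.quotientMap p g le_rfl).comp φ
  have hψ : ψ.FiniteType := by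
    refine RingHom.FiniteType.comp ?_ hφ.finiteType
    refine RingHom.FiniteType.of_comp_finiteType (f := Ideal.Quotient.mk _) ?_
    rw [Ideal.quotientMap_comp_mk]
    exact (RingHom.FiniteType.of_surjective _ Ideal.Quotient.mk_surjective).comp hg
  have hψi : Function.Injective ψ := (Ideal.quotientMap_injective).comp hφi
  algebraize [ψ]
  have : FaithfulSMul (MvPowerSeries (Fin e) K) (B ⧸ p) :=
    (faithfulSMul_iff_algebraMap_injective _ _).mpr hψi
  have : CharZero (MvPowerSeries (Fin e) K) :=
    charZero_of_injective_algebraMap (R := K) (FaithfulSMul.algebraMap_injective _ _)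
  obtain ⟨f, hf0, hf⟩ := exists_conductor (MvPowerSeries (Fin e) K) (B ⧸ p)
  obtain ⟨f, rfl⟩ := Ideal.Quotient.mk_surjective f
  refine ⟨f, fun h ↦ hf0 (Ideal.Quotient.eq_zero_iff_mem.mpr h), fun z hz ↦ ?_⟩
  obtain ⟨k, d, h⟩ := hf z hz
  obtain ⟨d, rfl⟩ := Ideal.Quotient.mk_surjective d
  exact ⟨k, d, by rw [map_pow]; exact h⟩

end RVar
namespace RVar

/-! ### A chart of the blow-up of a regular centre of codimension two -/

/-- Regular sequences are quasi-regular. The top term shows that `f` divides the top coefficient,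
say with quotient `c`; absorbing `c g` into the next coefficient and cancelling `f` lowers the
degree. -/
lemma mem_span_pair_of_sum_eq_zero {A : Type*} [CommRing A] [IsDomain A] {f g : A} (hf : f ≠ 0)
    (hfg : ∀ x, f ∣ g * x → f ∣ x) (N : ℕ) (a : ℕ → A)
    (h : ∑ i ∈ Finset.range (N + 1), a i * g ^ i * f ^ (N - i) = 0) :
    ∀ i ≤ N, a i ∈ Ideal.span {f, g} := by
  induction N generalizing a with
  | zero =>
    intro i hi
    obtain rfl : i = 0 := by omega
    simp at h
    simp [h]
  | succ N ih =>
    have hpow : ∀ (n : ℕ) x, f ∣ g ^ n * x → f ∣ x := by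
      intro n
      induction n with
      | zero => simp
      | succ n ihn => intro x hx; exact ihn x (hfg _ (by rwa [pow_succ', mul_assoc] at hx))
    have e1 : ∑ i ∈ Finset.range (N + 1), a i * g ^ i * f ^ (N + 1 - i) =
        f * ∑ i ∈ Finset.range (N + 1), a i * g ^ i * f ^ (N - i) := by
      rw [Finset.mul_sum]
      refine Finset.sum_congr rfl fun i hi ↦ ?_
      rw [Finset.mem_range] at hi
      rw [show N + 1 - i = (N - i) + 1 by omega, pow_succ]
      ring
    rw [Finset.sum_range_succ, e1, Nat.sub_self, pow_zero, mul_one] at h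
    obtain ⟨c, hc⟩ : f ∣ a (N + 1) := hpow (N + 1) _ ⟨-∑ i ∈ Finset.range (N + 1),
      a i * g ^ i * f ^ (N - i), by linear_combination h⟩
    have h2 : ∑ i ∈ Finset.range (N + 1), a i * g ^ i * f ^ (N - i) + c * g ^ (N + 1) = 0 := by
      apply mul_left_cancel₀ hf
      rw [hc] at h
      linear_combination h
    have h3 := ih (fun i ↦ if i = N then a N + c * g else a i) <| by
      rw [← h2, Finset.sum_range_succ, Finset.sum_range_succ, if_pos rfl]
      have : ∀ i ∈ Finset.range N, (if i = N then a N + c * g else a i) * g ^ i * f ^ (N - i) =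
          a i * g ^ i * f ^ (N - i) := fun i hi ↦ by
        rw [if_neg (Finset.mem_range.mp hi).ne]
      rw [Finset.sum_congr rfl this, Nat.sub_self]
      ring
    intro i hi
    rcases Nat.lt_or_ge i N with hlt | hge
    · simpa [hlt.ne] using h3 i hlt.le
    · rcases Nat.eq_or_lt_of_le hge with rfl | hgt
      · have h4 := h3 N le_rfl
        rw [if_pos rfl] at h4
        have h5 : c * g ∈ Ideal.span {f, g} :=
          Ideal.mul_mem_left _ _ (Ideal.subset_span (by simp))
        simpa using sub_mem h4 h5
      · obtain rfl : i = N + 1 := by omega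
        rw [hc]
        exact Ideal.mul_mem_right _ _ (Ideal.subset_span (by simp))

open IsLocalRing in
-- If `f` were in `𝔪²`, Nakayama would give `𝔪 = (g)`, against height two. So `A / f` is regular,
-- hence a domain, and `g` is nonzero in it.
lemma dvd_of_dvd_mul_of_maximalIdeal_eq_span_pair (A : Type*) [CommRing A] [IsRegularLocalRing A]
    (hdim : ringKrullDim A = 2) {f g : A} (hm : maximalIdeal A = Ideal.span {f, g}) :
    f ≠ 0 ∧ f ∉ maximalIdeal A ^ 2 ∧ ∀ x, f ∣ g * x → f ∣ x := by
  have hdom := isDomain_of_isRegularLocalRing A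
  have hht : (maximalIdeal A).height = 2 := by
    have := maximalIdeal_height_eq_ringKrullDim (R := A)
    rw [hdim] at this
    exact WithBot.coe_injective this
  have hnot : ∀ x, maximalIdeal A ≠ Ideal.span {x} := by
    intro x hx
    have h1 : (maximalIdeal A).height ≤ 1 :=
      Ideal.height_le_one_of_isPrincipal_of_mem_minimalPrimes (Ideal.span {x}) _
        ⟨⟨inferInstance, hx.ge⟩, fun y hy _ ↦ hx.le.trans hy.2⟩
    rw [hht] at h1
    exact absurd h1 (by norm_num)
  have hfm : f ∈ maximalIdeal A := hm ▸ Ideal.subset_span (by simp)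
  have hgm : g ∈ maximalIdeal A := hm ▸ Ideal.subset_span (by simp)
  have hf2 : f ∉ maximalIdeal A ^ 2 := by
    intro hf
    refine hnot g (le_antisymm ?_ ((Ideal.span_singleton_le_iff_mem _).mpr hgm))
    refine Submodule.le_of_le_smul_of_le_jacobson_bot (I := maximalIdeal A)
      (IsNoetherian.noetherian _) (maximalIdeal_le_jacobson _) ?_
    rw [smul_eq_mul, ← pow_two]
    conv_lhs => rw [hm]
    rw [Ideal.span_le]
    rintro x (rfl | rfl)
    · exact Ideal.mem_sup_right hf
    · exact Ideal.mem_sup_left (Ideal.subset_span rfl)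
  obtain ⟨hreg, -⟩ := isRegularLocalRing_quotient A hfm hf2
  have hdomq := isDomain_of_isRegularLocalRing (A ⧸ Ideal.span {f})
  rw [Ideal.Quotient.isDomain_iff_prime] at hdomq
  refine ⟨by rintro rfl; exact hf2 (zero_mem _), hf2, fun x hx ↦ ?_⟩
  rw [← Ideal.mem_span_singleton] at hx ⊢
  refine (hdomq.mem_or_mem hx).resolve_left fun h ↦ hnot f ?_
  rw [hm]
  refine le_antisymm (Ideal.span_le.mpr ?_) (Ideal.span_mono (by simp))
  rintro x (rfl | rfl)
  · exact Ideal.subset_span rfl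
  · exact h

/-- The chart `B[g / f]` of the blow-up of `(f, g)`. -/
noncomputable def blowupChart (B : Type*) [CommRing B] [IsDomain B] (f g : B) :
    Subalgebra B (FractionRing B) :=
  Algebra.adjoin B {algebraMap B (FractionRing B) g / algebraMap B (FractionRing B) f}

section

variable {B : Type*} [CommRing B] [IsDomain B] {f g : B}

lemma finiteType_blowupChart (f g : B) : Algebra.FiniteType B (blowupChart B f g) :=
  (Subalgebra.fg_iff_finiteType _).mp ⟨{_}, by rw [Finset.coe_singleton]; rfl⟩

lemma mem_blowupChart_iff {z : FractionRing B} : z ∈ blowupChart B f g ↔ ∃ p : Polynomial B,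
    Polynomial.aeval (algebraMap B (FractionRing B) g / algebraMap B (FractionRing B) f) p = z := by
  rw [blowupChart, Algebra.adjoin_singleton_eq_range_aeval]
  rfl

lemma exists_pow_mul_mem_range_of_mem_blowupChart (hf : f ≠ 0) {z : FractionRing B}
    (hz : z ∈ blowupChart B f g) :
    ∃ (n : ℕ) (b : B), algebraMap B (FractionRing B) f ^ n * z = algebraMap B _ b := by
  have hf' : algebraMap B (FractionRing B) f ≠ 0 := by simpa
  induction hz using Algebra.adjoin_induction with
  | mem x hx =>
    obtain rfl := hx
    exact ⟨1, g, by field_simp⟩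
  | algebraMap r => exact ⟨0, r, by simp⟩
  | add x y _ _ hx hy =>
    obtain ⟨n, b, hb⟩ := hx
    obtain ⟨m, c, hc⟩ := hy
    refine ⟨n + m, f ^ m * b + f ^ n * c, ?_⟩
    rw [map_add, map_mul, map_mul, ← hb, ← hc, map_pow, map_pow]
    ring
  | mul x y _ _ hx hy =>
    obtain ⟨n, b, hb⟩ := hx
    obtain ⟨m, c, hc⟩ := hy
    refine ⟨n + m, b * c, ?_⟩
    rw [map_mul, ← hb, ← hc]
    ring

/-- Descent on the denominator: if `fᵏ⁺¹ z = c`, the integral equation makes `f` divide a power of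
`c`, hence `c`, and the exponent drops. -/
lemma isIntegrallyClosed_of_prime {C F : Type*} [CommRing C] [IsDomain C] [Field F] [Algebra C F]
    [IsFractionRing C F] {f : C} (hf : Prime f)
    (h : ∀ z : F, IsIntegral C z → ∃ (k : ℕ) (c : C), algebraMap C F f ^ k * z = algebraMap C F c) :
    IsIntegrallyClosed C := by
  classical
  rw [isIntegrallyClosed_iff F]
  intro z hz
  have hex := h z hz
  obtain ⟨c, hc⟩ := Nat.find_spec hex
  rcases hk : Nat.find hex with _ | k
  · rw [hk, pow_zero, one_mul] at hc
    exact ⟨c, hc.symm⟩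
  · exfalso
    rw [hk] at hc
    obtain ⟨p, hp, hpz⟩ := hz
    have h1 := Polynomial.dvd_pow_natDegree_of_eval₂_eq_zero (IsFractionRing.injective C F) hp
      (f ^ (k + 1)) c z hpz (by rw [map_pow]; exact hc)
    obtain ⟨c', rfl⟩ := hf.dvd_of_dvd_pow ((dvd_pow_self f k.succ_ne_zero).trans h1)
    refine Nat.find_min hex (m := k) (by omega) ⟨c', ?_⟩
    have hf0 : algebraMap C F f ≠ 0 := by simpa using hf.ne_zero
    apply mul_left_cancel₀ hf0
    rw [← mul_assoc, ← pow_succ', hc, map_mul]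

/-- Inverting `f` gives a localization of the normal ring `B`, so an integral fraction has only
powers of the prime `f` as denominator. -/
lemma isIntegrallyClosed_blowupChart [IsIntegrallyClosed B]
    (hf : Prime (algebraMap B (blowupChart B f g) f)) :
    IsIntegrallyClosed (blowupChart B f g) := by
  refine isIntegrallyClosed_of_prime (F := FractionRing B) hf fun z hz ↦ ?_
  have hf0 : f ≠ 0 := by rintro rfl; exact hf.ne_zero (map_zero _)
  have hf' : algebraMap B (FractionRing B) f ≠ 0 := by simpa
  obtain ⟨k, hk⟩ := exists_pow_smul_isIntegral (D := blowupChart B f g) f hf' (fun y ↦ by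
    obtain ⟨n, b, hb⟩ := exists_pow_mul_mem_range_of_mem_blowupChart hf0 y.2
    refine ⟨n, ?_⟩
    rw [Algebra.smul_def, map_pow]
    exact hb ▸ isIntegral_algebraMap) hz
  obtain ⟨b, hb⟩ := IsIntegrallyClosed.isIntegral_iff.mp hk
  refine ⟨k, algebraMap B _ b, ?_⟩
  rw [Algebra.smul_def, map_pow] at hb
  exact hb.symm

/-- With `T = g / f`, a coefficient `x f + y g` equals `f (x + y T)`. -/
lemma exists_eq_mul_of_coeff_mem {q : Ideal B} (hf0 : f ≠ 0) (hfg : q = Ideal.span {f, g}) (p : Polynomial B)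
    (hp : ∀ i, p.coeff i ∈ q) : ∃ r : Polynomial B,
    Polynomial.aeval (algebraMap B (FractionRing B) g / algebraMap B (FractionRing B) f) p =
      algebraMap B (FractionRing B) f *
        Polynomial.aeval (algebraMap B (FractionRing B) g / algebraMap B (FractionRing B) f) r := by
  have hf' : algebraMap B (FractionRing B) f ≠ 0 := by simpa
  have h1 : ∀ i, ∃ x y, x * f + y * g = p.coeff i := fun i ↦
    Ideal.mem_span_pair.mp (hfg ▸ hp i)
  choose x y hxy using h1
  refine ⟨∑ i ∈ Finset.range (p.natDegree + 1),
    (Polynomial.C (x i) + Polynomial.C (y i) * Polynomial.X) * Polynomial.X ^ i, ?_⟩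
  rw [Polynomial.aeval_eq_sum_range, map_sum, Finset.mul_sum]
  refine Finset.sum_congr rfl fun i _ ↦ ?_
  rw [Algebra.smul_def, ← hxy i]
  simp only [map_mul, map_add, map_pow, Polynomial.aeval_C, Polynomial.aeval_X]
  field_simp

variable [IsRegularRing B] {q : Ideal B} [q.IsPrime]

open IsLocalRing in
-- The polynomial `p - f r` vanishes at `g / f`. Homogenized, it is a relation between `f` and `g`,
-- and quasi-regularity at `q` puts its coefficients in `q`.
lemma coeff_mem_of_aeval_eq_mul (hq : q.height = 2) (hfg : q = Ideal.span {f, g})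
    (p : Polynomial B) (r : Polynomial B)
    (h : Polynomial.aeval (algebraMap B (FractionRing B) g / algebraMap B (FractionRing B) f) p =
      algebraMap B (FractionRing B) f *
        Polynomial.aeval (algebraMap B (FractionRing B) g / algebraMap B (FractionRing B) f) r)
    (i : ℕ) : p.coeff i ∈ q := by
  let A := Localization.AtPrime q
  have hdim : ringKrullDim A = 2 := by
    rw [IsLocalization.AtPrime.ringKrullDim_eq_height q A, hq]; rfl
  have hm : maximalIdeal A = Ideal.span {algebraMap B A f, algebraMap B A g} := by
    have h1 := congrArg (Ideal.map (algebraMap B A)) hfg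
    rwa [Ideal.map_span, Set.image_pair, Localization.AtPrime.map_eq_maximalIdeal] at h1
  have hregA : IsRegularRing A := isRegularRing_of_isLocalization q.primeCompl _
  obtain ⟨hfA, -, hdvd⟩ := dvd_of_dvd_mul_of_maximalIdeal_eq_span_pair A hdim hm
  have hdomA := isDomain_of_isRegularLocalRing A
  have hf0 : f ≠ 0 := by rintro rfl; exact hfA (map_zero _)
  have hf' : algebraMap B (FractionRing B) f ≠ 0 := by simpa
  have hfq : f ∈ q := by rw [hfg]; exact Ideal.subset_span (by simp)
  set P := p - Polynomial.C f * r
  have hP : Polynomial.aeval (algebraMap B (FractionRing B) g / algebraMap B (FractionRing B) f) P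
      = 0 := by
    rw [map_sub, h, map_mul, Polynomial.aeval_C, sub_self]
  set N := P.natDegree
  have hsum : ∑ i ∈ Finset.range (N + 1), P.coeff i * g ^ i * f ^ (N - i) = 0 := by
    apply IsFractionRing.injective B (FractionRing B)
    rw [map_zero, ← mul_zero (algebraMap B (FractionRing B) f ^ N), ← hP,
      Polynomial.aeval_eq_sum_range, Finset.mul_sum, map_sum]
    refine Finset.sum_congr rfl fun i hi ↦ ?_
    have hi' : i ≤ N := Nat.lt_succ_iff.mp (Finset.mem_range.mp hi)
    obtain ⟨m, hm⟩ := Nat.exists_eq_add_of_le hi'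
    rw [Algebra.smul_def, div_pow, hm, Nat.add_sub_cancel_left]
    simp only [map_mul, map_pow]
    field_simp
    ring
  have key := mem_span_pair_of_sum_eq_zero hfA hdvd N (fun i ↦ algebraMap B A (P.coeff i)) (by
    simpa using congrArg (algebraMap B A) hsum)
  have hPq : ∀ i, P.coeff i ∈ q := by
    intro i
    rcases le_or_gt i N with hi | hi
    · have := key i hi
      rw [← hm] at this
      exact (IsLocalization.AtPrime.to_map_mem_maximal_iff A q _).mp this
    · rw [Polynomial.coeff_eq_zero_of_natDegree_lt hi]; exact zero_mem _
  have := hPq i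
  rw [Polynomial.coeff_sub, Polynomial.coeff_C_mul] at this
  simpa using add_mem this (Ideal.mul_mem_right (r.coeff i) _ hfq)

/-- `f` divides the value of `p` at `g / f` exactly when all coefficients of `p` lie in `q`. The
chart modulo `f` is thus a polynomial ring over the domain `B / q`. -/
lemma prime_algebraMap_blowupChart (hf0 : f ≠ 0) (hq : q.height = 2)
    (hfg : q = Ideal.span {f, g}) : Prime (algebraMap B (blowupChart B f g) f) := by
  have hcoe : ∀ b : B, ((algebraMap B (blowupChart B f g) b : blowupChart B f g) : FractionRing B) =
      algebraMap B _ b := fun b ↦ rfl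
  have hdvd : ∀ (p : Polynomial B) (c : blowupChart B f g), Polynomial.aeval (algebraMap B
      (FractionRing B) g / algebraMap B (FractionRing B) f) p = c →
      (algebraMap B (blowupChart B f g) f ∣ c ↔ ∀ i, p.coeff i ∈ q) := by
    intro p c hc
    constructor
    · rintro ⟨d, rfl⟩ i
      obtain ⟨r, hr⟩ := mem_blowupChart_iff.mp d.2
      refine coeff_mem_of_aeval_eq_mul hq hfg p r ?_ i
      rw [hc, hr]
      rfl
    · intro hp
      obtain ⟨r, hr⟩ := exists_eq_mul_of_coeff_mem hf0 hfg p hp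
      exact ⟨⟨_, mem_blowupChart_iff.mpr ⟨r, rfl⟩⟩, Subtype.ext (hc.symm.trans hr)⟩
  refine ⟨?_, ?_, ?_⟩
  · intro h
    have := congrArg Subtype.val h
    simp [hcoe, hf0] at this
  · intro h
    have := (hdvd 1 1 (by simp)).mp (h.dvd) 0
    rw [Polynomial.coeff_one_zero] at this
    exact Ideal.IsPrime.ne_top ‹_› ((Ideal.eq_top_iff_one _).mpr this)
  · intro a b hab
    obtain ⟨p, hp⟩ := mem_blowupChart_iff.mp a.2
    obtain ⟨r, hr⟩ := mem_blowupChart_iff.mp b.2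
    have h := (hdvd (p * r) (a * b) (by rw [map_mul, hp, hr]; rfl)).mp hab
    rw [← Ideal.mem_map_C_iff] at h
    have hpr : (q.map (Polynomial.C : B →+* Polynomial B)).IsPrime :=
      Ideal.isPrime_map_C_of_isPrime
    rcases hpr.mem_or_mem h with h | h
    · exact .inl ((hdvd p a hp).mpr (Ideal.mem_map_C_iff.mp h))
    · exact .inr ((hdvd r b hr).mpr (Ideal.mem_map_C_iff.mp h))

lemma comap_span_blowupChart (hf0 : f ≠ 0) (hq : q.height = 2) (hfg : q = Ideal.span {f, g}) :
    (Ideal.span {algebraMap B (blowupChart B f g) f}).comap (algebraMap B (blowupChart B f g)) =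
      q := by
  ext b
  rw [Ideal.mem_comap, Ideal.mem_span_singleton]
  constructor
  · rintro ⟨c, hc⟩
    obtain ⟨r, hr⟩ := mem_blowupChart_iff.mp c.2
    have := coeff_mem_of_aeval_eq_mul hq hfg (Polynomial.C b) r (by
      rw [Polynomial.aeval_C, hr]
      exact congrArg Subtype.val hc) 0
    simpa using this
  · intro hb
    obtain ⟨r, hr⟩ := exists_eq_mul_of_coeff_mem (q := q) hf0 hfg (Polynomial.C b) fun i ↦ by
      rw [Polynomial.coeff_C]
      split_ifs
      · exact hb
      · exact zero_mem _
    refine ⟨⟨_, mem_blowupChart_iff.mpr ⟨r, rfl⟩⟩, Subtype.ext ?_⟩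
    rw [Polynomial.aeval_C] at hr
    exact hr

end

end RVar
namespace RVar

/-! ### Orders and Fitting ideals -/

open IsLocalRing

lemma natCast_le_idealOrder_iff {A : Type*} [CommRing A] [IsLocalRing A] {I : Ideal A} {n : ℕ} :
    (n : ℕ∞) ≤ idealOrder A I ↔ I ≤ maximalIdeal A ^ n := by
  constructor
  · intro h
    by_contra hn
    rcases n with _ | n
    · exact hn (by simp)
    have h2 : idealOrder A I ≤ n := by
      refine iSup₂_le fun m hm ↦ ?_
      by_contra! hlt
      have hlt' : n + 1 ≤ m := by exact_mod_cast hlt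
      exact hn (hm.trans (Ideal.pow_le_pow_right hlt'))
    have := h.trans h2
    norm_cast at this
    omega
  · intro h
    exact le_iSup₂_of_le (f := fun (n : ℕ) (_ : I ≤ maximalIdeal A ^ n) ↦ (n : ℕ∞)) n h le_rfl

/-- Orders at several primes can be compared once they are all expressed by elements of the one ring
`B`. -/
lemma map_le_maximalIdeal_pow_iff {B A : Type*} [CommRing B] [CommRing A] [Algebra B A]
    [IsLocalRing A] (q : Ideal B) [q.IsPrime] [IsLocalization.AtPrime A q] (J : Ideal B) (n : ℕ) :
    J.map (algebraMap B A) ≤ maximalIdeal A ^ n ↔ ∀ a ∈ J, ∃ s ∉ q, s * a ∈ q ^ n := by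
  rw [← IsLocalization.AtPrime.map_eq_maximalIdeal q A, ← Ideal.map_pow, Ideal.map_le_iff_le_comap]
  refine forall₂_congr fun a _ ↦ ?_
  rw [Ideal.mem_comap, IsLocalization.algebraMap_mem_map_algebraMap_iff q.primeCompl]
  rfl

lemma natCast_le_idealOrder_map_iff {B A : Type*} [CommRing B] [CommRing A] [Algebra B A]
    [IsLocalRing A] (q : Ideal B) [q.IsPrime] [IsLocalization.AtPrime A q] (J : Ideal B) (n : ℕ) :
    (n : ℕ∞) ≤ idealOrder A (J.map (algebraMap B A)) ↔ ∀ a ∈ J, ∃ s ∉ q, s * a ∈ q ^ n := by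
  rw [natCast_le_idealOrder_iff, map_le_maximalIdeal_pow_iff q]

/-- Up to units, `S` consists of polynomials in `τ` over `A`, so `dτ` generates the differentials;
and `f dτ = d(f τ) = 0`, since `f` and `f τ` come from `A`. The one-by-one matrix `(f)` is a
relation matrix. -/
lemma mem_fittingIdealZero_of_adjoin {A S : Type*} [CommRing A] [CommRing S] [Algebra A S]
    (f τ : S) (hf : f ∈ (algebraMap A S).range) (hfτ : f * τ ∈ (algebraMap A S).range)
    (h : ∀ x : S, ∃ u ∈ Algebra.adjoin A {τ}, IsUnit u ∧ u * x ∈ Algebra.adjoin A {τ}) :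
    f ∈ fittingIdealZero S (KaehlerDifferential A S) := by
  let D := KaehlerDifferential.D A S
  have h1 : ∀ x ∈ Algebra.adjoin A {τ}, D x ∈ Submodule.span S {D τ} := by
    intro x hx
    induction hx using Algebra.adjoin_induction with
    | mem x hx => obtain rfl := hx; exact Submodule.mem_span_singleton_self _
    | algebraMap r => rw [Derivation.map_algebraMap]; exact zero_mem _
    | add x y _ _ hx hy => rw [map_add]; exact add_mem hx hy
    | mul x y _ _ hx hy =>
      rw [Derivation.leibniz]
      exact add_mem (Submodule.smul_mem _ _ hy) (Submodule.smul_mem _ _ hx)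
  refine Ideal.subset_span ⟨1, fun _ ↦ D τ, fun _ _ ↦ f, ?_, fun _ ↦ ?_, ?_⟩
  · rw [Set.range_const, eq_top_iff, ← KaehlerDifferential.span_range_derivation,
      Submodule.span_le]
    rintro _ ⟨x, rfl⟩
    obtain ⟨u, hu, ⟨v, rfl⟩, hux⟩ := h x
    have h2 := h1 _ hux
    rw [Derivation.leibniz] at h2
    have h3 : (v : S) • D x ∈ Submodule.span S {D τ} := by
      simpa using sub_mem h2 (Submodule.smul_mem _ x (h1 _ hu))
    have h4 := Submodule.smul_mem _ (↑v⁻¹ : S) h3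
    rwa [smul_smul, Units.inv_mul, one_smul] at h4
  · obtain ⟨a, rfl⟩ := hf
    obtain ⟨b, hb⟩ := hfτ
    have h2 : D (algebraMap A S a * τ) = 0 := by rw [← hb, Derivation.map_algebraMap]
    rw [Derivation.leibniz, Derivation.map_algebraMap, smul_zero, add_zero] at h2
    simpa using h2
  · exact Matrix.det_fin_one _

lemma idealOrder_le_one_of_mem {S : Type*} [CommRing S] [IsLocalRing S] {J : Ideal S} {f : S}
    (hf : f ∈ J) (hf2 : f ∉ maximalIdeal S ^ 2) : idealOrder S J ≤ 1 := by
  by_contra! h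
  have : ((2 : ℕ) : ℕ∞) ≤ idealOrder S J := by
    have := Order.add_one_le_of_lt h
    rwa [one_add_one_eq_two] at this
  rw [natCast_le_idealOrder_iff] at this
  exact hf2 (this hf)

lemma add_le_of_forall_natCast {a b c : ℕ∞}
    (h : ∀ m n : ℕ, (m : ℕ∞) ≤ a → (n : ℕ∞) ≤ b → ((m + n : ℕ) : ℕ∞) ≤ c) : a + b ≤ c := by
  induction a using ENat.recTopCoe with
  | top =>
    have : c = ⊤ := ENat.eq_top_iff_forall_ge.mpr fun m ↦ by simpa using h m 0 le_top (by simp)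
    rw [this]; exact le_top
  | coe a =>
    induction b using ENat.recTopCoe with
    | top =>
      have : c = ⊤ := ENat.eq_top_iff_forall_ge.mpr fun m ↦ by simpa using h 0 m (by simp) le_top
      rw [this]; exact le_top
    | coe b => exact_mod_cast h a b le_rfl le_rfl

lemma eq_one_of_add_one_eq_one_add_one {a : WithBot ℕ∞} (h : a + 1 = 1 + 1) : a = 1 := by
  induction a using WithBot.recBotCoe with
  | bot =>
    rw [WithBot.bot_add] at h
    exact absurd h.symm (WithBot.coe_ne_bot (a := (1 + 1 : ℕ∞)))
  | coe a =>
    have h2 : a + 1 = 1 + 1 := WithBot.coe_injective (a₁ := a + 1) (a₂ := (1 + 1 : ℕ∞)) h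
    rw [ENat.add_left_injective_of_ne_top ENat.one_ne_top h2]
    rfl

/-! ### Multiplicities at a non-normal point of codimension two -/

section

variable {B : Type*} [CommRing B]

lemma isIntegrallyClosedAt_of_isIntegrallyClosed {A : Type*} [CommRing A] [Algebra B A]
    (p q : Ideal B) [p.IsPrime] [q.IsPrime] [IsLocalization.AtPrime A q] (hpq : p ≤ q)
    (J : Ideal A) (hJ : p.map (algebraMap B A) = J) [IsDomain (A ⧸ J)]
    [IsIntegrallyClosed (A ⧸ J)] : IsIntegrallyClosedAt p q := by
  have hdis : Disjoint (q.primeCompl : Set B) p :=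
    Set.disjoint_left.mpr fun a ha hap ↦ ha (hpq hap)
  have hcomap : J.comap (algebraMap B A) = p := by
    rw [← hJ]
    exact IsLocalization.under_map_of_isPrime_disjoint q.primeCompl A ‹_› hdis
  let φ : B ⧸ p →+* A ⧸ J := Ideal.quotientMap J (algebraMap B A) hcomap.ge
  have hφ : Function.Injective φ := Ideal.quotientMap_injective' hcomap.le
  let L := FractionRing (A ⧸ J)
  have hinj : Function.Injective ((algebraMap (A ⧸ J) L).comp φ) :=
    (IsFractionRing.injective (A ⧸ J) L).comp hφ
  let ψ : FractionRing (B ⧸ p) →+* L := IsFractionRing.lift hinj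
  have hψ : ∀ x, ψ (algebraMap _ _ x) = algebraMap (A ⧸ J) L (φ x) := fun x ↦
    IsFractionRing.lift_algebraMap hinj x
  intro z hz
  have h1 : IsIntegral (A ⧸ J) (ψ z) := by
    obtain ⟨P, hP, hPz⟩ := hz
    refine ⟨P.map φ, hP.map _, ?_⟩
    rw [Polynomial.eval₂_map]
    have := congrArg ψ hPz
    rw [Polynomial.hom_eval₂, map_zero] at this
    rwa [show (algebraMap (A ⧸ J) L).comp φ = ψ.comp (algebraMap _ _) from
      RingHom.ext fun x ↦ (hψ x).symm]
  obtain ⟨w, hw⟩ := IsIntegrallyClosed.isIntegral_iff.mp h1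
  obtain ⟨w, rfl⟩ := Ideal.Quotient.mk_surjective w
  obtain ⟨⟨d, s⟩, hds⟩ := IsLocalization.surj q.primeCompl w
  refine ⟨s, s.2, d, ψ.injective ?_⟩
  rw [map_mul, hψ, hψ, ← hw, ← map_mul]
  congr 1
  change Ideal.Quotient.mk J (algebraMap B A s) * _ = Ideal.Quotient.mk J (algebraMap B A d)
  rw [← map_mul, mul_comm, hds]

lemma isPrincipalIdealRing_of_ringKrullDim_eq_one (A : Type*) [CommRing A] [IsRegularLocalRing A]
    (h : ringKrullDim A = 1) : IsPrincipalIdealRing A := by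
  have hdom := isDomain_of_isRegularLocalRing A
  have h1 : (maximalIdeal A).spanFinrank = 1 := by
    have : ((maximalIdeal A).spanFinrank : WithBot ℕ∞) = ringKrullDim A :=
      IsRegularLocalRing.spanFinrank_maximalIdeal
    rw [h] at this
    exact_mod_cast this
  obtain ⟨hp, -⟩ := (Submodule.spanFinrank_eq_one_iff _).mp h1
  exact ((tfae_of_isNoetherianRing_of_isLocalRing_of_isDomain A).out 0 4).mpr hp

lemma isIntegrallyClosed_of_ringKrullDim_eq_one (A : Type*) [CommRing A] [IsRegularLocalRing A]
    (h : ringKrullDim A = 1) : IsIntegrallyClosed A := by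
  have := isDomain_of_isRegularLocalRing A
  have := isPrincipalIdealRing_of_ringKrullDim_eq_one A h
  infer_instance

variable [IsDomain B] [IsRegularRing B]

/-- With two components through `q`, their local equations are coprime elements of `𝔪`, and the
product of their powers divides `a`. With a single component, its equation lies in `𝔪²`, as
otherwise the quotient would be regular of dimension one and hence normal; that component is then
counted twice, `p₁ = p₂`. -/
lemma exists_mul_mem_pow_of_not_isNormalQuotientAt {I q : Ideal B} (hI : I.IsRadical)
    (h1 : HasHeightOnePrimesBelow I) [hq : q.IsPrime] (hIq : I ≤ q) (hq2 : q.height = 2)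
    (hN : ¬ IsNormalQuotientAt I q) :
    ∃ p₁ p₂ : Ideal B, p₁.IsPrime ∧ p₂.IsPrime ∧ p₁.height = 1 ∧ p₂.height = 1 ∧ I ≤ p₁ ∧ I ≤ p₂ ∧
      p₁ ≤ q ∧ p₂ ≤ q ∧ ∀ (n₁ n₂ : ℕ) (a : B), (∃ s ∉ p₁, s * a ∈ p₁ ^ n₁) →
        (∃ s ∉ p₂, s * a ∈ p₂ ^ n₂) → ∃ s ∉ q, s * a ∈ q ^ (n₁ + n₂) := by
  let A := Localization.AtPrime q
  have hregA : IsRegularRing A := isRegularRing_of_isLocalization q.primeCompl _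
  have hdimA : ringKrullDim A = 2 := by
    rw [IsLocalization.AtPrime.ringKrullDim_eq_height q A, hq2]; rfl
  have hback : ∀ (n : ℕ) (a : B), algebraMap B A a ∈ maximalIdeal A ^ n →
      ∃ s ∉ q, s * a ∈ q ^ n := by
    intro n a ha
    refine (map_le_maximalIdeal_pow_iff (A := A) q (Ideal.span {a}) n).mp ?_ a
      (Ideal.mem_span_singleton_self a)
    rwa [Ideal.map_span, Set.image_singleton, Ideal.span_singleton_le_iff_mem]
  have hdvd : ∀ (p : Ideal B) [p.IsPrime] (_ : p ≤ q) (h : A) (_ : Prime h)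
      (_ : p.map (algebraMap B A) = Ideal.span {h}) (n : ℕ) (a : B),
      (∃ s ∉ p, s * a ∈ p ^ n) → h ^ n ∣ algebraMap B A a := by
    rintro p hp hpq h hh hph n a ⟨s, hs, hsa⟩
    have h1 : h ^ n ∣ algebraMap B A s * algebraMap B A a := by
      rw [← Ideal.mem_span_singleton, ← Ideal.span_singleton_pow, ← hph, ← Ideal.map_pow, ← map_mul]
      exact Ideal.mem_map_of_mem _ hsa
    refine hh.pow_dvd_of_dvd_mul_left n (fun h2 ↦ hs ?_) h1
    rw [← Ideal.mem_span_singleton, ← hph] at h2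
    exact mem_of_algebraMap_mem_map hpq h2
  have hmem : ∀ (p : Ideal B) (h : A), p ≤ q →
      p.map (algebraMap B A) = Ideal.span {h} → h ∈ maximalIdeal A := by
    intro p h hpq hph
    rw [← Localization.AtPrime.map_eq_maximalIdeal]
    exact Ideal.map_mono hpq (hph ▸ Ideal.mem_span_singleton_self h)
  obtain ⟨p, hp, hp1, hIp, hpq⟩ := h1 q hq hIq
  obtain ⟨h, hh, hph⟩ := exists_prime_map_eq_span p q hp1 hpq
  by_cases huniq : ∀ p' : Ideal B, p'.IsPrime → p'.height = 1 → I ≤ p' → p' ≤ q → p' = p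
  · refine ⟨p, p, hp, hp, hp1, hp1, hIp, hIp, hpq, hpq, fun n₁ n₂ a ha₁ ha₂ ↦ hback _ _ ?_⟩
    have hh2 : h ∈ maximalIdeal A ^ 2 := by
      by_contra hh2
      have hhm := hmem p h hpq hph
      obtain ⟨hreg, hdim⟩ := isRegularLocalRing_quotient A hhm hh2
      have hdim1 : ringKrullDim (A ⧸ Ideal.span {h}) = 1 := by
        rw [hdimA, ← one_add_one_eq_two] at hdim
        exact eq_one_of_add_one_eq_one_add_one hdim
      have := isIntegrallyClosed_of_ringKrullDim_eq_one _ hdim1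
      have := isDomain_of_isRegularLocalRing (A ⧸ Ideal.span {h})
      exact hN ⟨p, hp, hIp, hpq, exists_mul_mem_of_unique hI h1 huniq,
        isIntegrallyClosedAt_of_isIntegrallyClosed p q hpq _ hph⟩
    have key : ∀ n : ℕ, (∃ s ∉ p, s * a ∈ p ^ n) → algebraMap B A a ∈ maximalIdeal A ^ (2 * n) :=
      fun n hn ↦ Ideal.mem_of_dvd _ (hdvd p hpq h hh hph n a hn) (by
        rw [pow_mul]; exact Ideal.pow_mem_pow hh2 n)
    -- Here `n₁ + n₂` is at most twice the larger exponent.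
    rcases le_total n₁ n₂ with hle | hle
    · exact Ideal.pow_le_pow_right (by omega) (key n₂ ha₂)
    · exact Ideal.pow_le_pow_right (by omega) (key n₁ ha₁)
  · push Not at huniq
    obtain ⟨p', hp', hp1', hIp', hpq', hne⟩ := huniq
    obtain ⟨h', hh', hph'⟩ := exists_prime_map_eq_span p' q hp1' hpq'
    refine ⟨p, p', hp, hp', hp1, hp1', hIp, hIp', hpq, hpq', fun n₁ n₂ a ha₁ ha₂ ↦ hback _ _ ?_⟩
    obtain ⟨c, hc⟩ := hdvd p hpq h hh hph n₁ a ha₁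
    have h2 := hdvd p' hpq' h' hh' hph' n₂ a ha₂
    rw [hc] at h2
    have h3 : ¬ h' ∣ h ^ n₁ := by
      intro hd
      have h4 : h' ∣ h := hh'.dvd_of_dvd_pow hd
      refine hne (eq_of_le_of_height_eq_one (fun b hb ↦ mem_of_algebraMap_mem_map hpq' ?_)
        hp1 hp1').symm
      rw [hph']
      have h5 : algebraMap B A b ∈ Ideal.span {h} := hph ▸ Ideal.mem_map_of_mem _ hb
      exact Ideal.mem_span_singleton.mpr (h4.trans (Ideal.mem_span_singleton.mp h5))
    obtain ⟨d, rfl⟩ := hh'.pow_dvd_of_dvd_mul_left n₂ h3 h2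
    rw [hc, pow_add, ← mul_assoc]
    exact Ideal.mul_mem_right _ _ (Ideal.mul_mem_mul (Ideal.pow_mem_pow (hmem p h hpq hph) _)
      (Ideal.pow_mem_pow (hmem p' h' hpq' hph') _))

end

end RVar
namespace RVar

/-! ### Affine charts of schemes -/

section

variable {X : Scheme.{u}}

/-- The prime ideal of `Γ(X, U)` that corresponds to a point of the affine open `U`. -/
noncomputable def primeAt {U : X.Opens} (hU : IsAffineOpen U) (x : X) (hx : x ∈ U) :
    Ideal Γ(X, U) :=
  (hU.primeIdealOf ⟨x, hx⟩).asIdeal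

instance isPrime_primeAt {U : X.Opens} (hU : IsAffineOpen U) (x : X) (hx : x ∈ U) :
    (primeAt hU x hx).IsPrime :=
  (hU.primeIdealOf ⟨x, hx⟩).isPrime

variable {U : X.Opens} (hU : IsAffineOpen U)

lemma isLocalization_stalk_primeAt (x : X) (hx : x ∈ U) :
    letI : Algebra Γ(X, U) (X.presheaf.stalk x) := (X.presheaf.germ U x hx).hom.toAlgebra
    IsLocalization.AtPrime (X.presheaf.stalk x) (primeAt hU x hx) :=
  hU.isLocalization_stalk ⟨x, hx⟩

lemma exists_primeAt_eq (q : Ideal Γ(X, U)) [hq : q.IsPrime] :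
    ∃ (x : X) (hx : x ∈ U), primeAt hU x hx = q := by
  have hmem : hU.fromSpec ⟨q, hq⟩ ∈ U := by
    have : hU.fromSpec ⟨q, hq⟩ ∈ Set.range hU.fromSpec := ⟨_, rfl⟩
    rwa [hU.range_fromSpec] at this
  refine ⟨hU.fromSpec ⟨q, hq⟩, hmem, ?_⟩
  have := hU.fromSpec_primeIdealOf ⟨_, hmem⟩
  exact congrArg PrimeSpectrum.asIdeal (hU.fromSpec.isOpenEmbedding.injective this)

lemma primeAt_le_primeAt_iff {x y : X} (hx : x ∈ U) (hy : y ∈ U) :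
    primeAt hU x hx ≤ primeAt hU y hy ↔ x ⤳ y := by
  have h1 : hU.fromSpec (hU.primeIdealOf ⟨x, hx⟩) = x := hU.fromSpec_primeIdealOf ⟨x, hx⟩
  have h2 : hU.fromSpec (hU.primeIdealOf ⟨y, hy⟩) = y := hU.fromSpec_primeIdealOf ⟨y, hy⟩
  have h3 := hU.fromSpec.isOpenEmbedding.isInducing.specializes_iff
    (x := hU.primeIdealOf ⟨x, hx⟩) (y := hU.primeIdealOf ⟨y, hy⟩)
  rw [h1, h2] at h3
  rw [h3]
  exact PrimeSpectrum.le_iff_specializes _ _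

lemma height_primeAt (x : X) (hx : x ∈ U) :
    (primeAt hU x hx).height = Order.coheight x := by
  let _ : Algebra Γ(X, U) (X.presheaf.stalk x) := (X.presheaf.germ U x hx).hom.toAlgebra
  have := isLocalization_stalk_primeAt hU x hx
  have h1 := IsLocalization.AtPrime.ringKrullDim_eq_height (primeAt hU x hx) (X.presheaf.stalk x)
  rw [ringKrullDim_stalk_eq_coheight] at h1
  exact (WithBot.coe_injective h1).symm

lemma stalkIdeal_eq (I : X.IdealSheafData) (x : X) (hx : x ∈ U) :
    stalkIdeal I x = (I.ideal ⟨U, hU⟩).map (X.presheaf.germ U x hx).hom := by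
  refine le_antisymm (iSup₂_le fun V hV ↦ ?_)
    (le_iSup₂ (f := fun (U : X.affineOpens) (hx : x ∈ U.1) ↦
      (I.ideal U).map (X.presheaf.germ U.1 x hx).hom) ⟨U, hU⟩ hx)
  obtain ⟨f, g, hfg, hxf⟩ := exists_basicOpen_le_affine_inter hU V.2 x ⟨hx, hV⟩
  have key : ∀ (W V : X.Opens) (hW : IsAffineOpen W) (hV : IsAffineOpen V) (h : W ≤ V)
      (hxW : x ∈ W), (I.ideal ⟨V, hV⟩).map (X.presheaf.germ V x (h hxW)).hom =
        (I.ideal ⟨W, hW⟩).map (X.presheaf.germ W x hxW).hom := by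
    intro W V hW hV h hxW
    rw [← I.map_ideal (U := ⟨W, hW⟩) (V := ⟨V, hV⟩) h, Ideal.map_map, ← CommRingCat.hom_comp]
    erw [X.presheaf.germ_res (homOfLE h) x hxW]
  have hle : X.basicOpen f ≤ V.1 := hfg.trans_le (X.basicOpen_le g)
  have e1 := key _ _ (hU.basicOpen f) V.2 hle hxf
  have e2 := key _ _ (hU.basicOpen f) hU (X.basicOpen_le f) hxf
  rw [e2, ← e1]

lemma ideal_le_primeAt_iff (I : X.IdealSheafData) (x : X) (hx : x ∈ U) :
    I.ideal ⟨U, hU⟩ ≤ primeAt hU x hx ↔ x ∈ I.support := by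
  rw [Scheme.IdealSheafData.mem_support_iff_of_mem (U := ⟨U, hU⟩) hx]
  have h1 : hU.fromSpec (hU.primeIdealOf ⟨x, hx⟩) = x := hU.fromSpec_primeIdealOf ⟨x, hx⟩
  have h2 : hU.fromSpec (hU.primeIdealOf ⟨x, hx⟩) ∈
      X.zeroLocus (U := U) (I.ideal ⟨U, hU⟩ : Set Γ(X, U)) ↔ _ :=
    Set.ext_iff.mp (hU.fromSpec_preimage_zeroLocus (I.ideal ⟨U, hU⟩))
    (hU.primeIdealOf ⟨x, hx⟩)
  rw [h1] at h2
  exact h2.symm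

lemma isRegularRing_sections {U : X.Opens} (hU : IsAffineOpen U) (hX : IsNonsingular X) [IsLocallyNoetherian X] :
    IsRegularRing Γ(X, U) := by
  have : IsNoetherianRing Γ(X, U) := IsLocallyNoetherian.component_noetherian ⟨U, hU⟩
  rw [isRegularRing_iff]
  intro p hp
  obtain ⟨x, hx, rfl⟩ := exists_primeAt_eq hU p
  let _ : Algebra Γ(X, U) (X.presheaf.stalk x) := (X.presheaf.germ U x hx).hom.toAlgebra
  have := isLocalization_stalk_primeAt hU x hx
  have := hX x
  exact IsRegularLocalRing.of_ringEquiv (IsLocalization.algEquiv (primeAt hU x hx).primeCompl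
    (X.presheaf.stalk x) (Localization.AtPrime (primeAt hU x hx))).toRingEquiv

lemma isNormalLocalRing_subscheme_iff (I : X.IdealSheafData)
    (y : I.subscheme) (hy : I.subschemeι y ∈ U) :
    IsNormalLocalRing (I.subscheme.presheaf.stalk y) ↔
      IsNormalQuotientAt (I.ideal ⟨U, hU⟩) (primeAt hU (I.subschemeι y) hy) := by
  have hV : IsAffineOpen (I.subschemeι ⁻¹ᵁ U) := hU.preimage I.subschemeι
  have hy' : y ∈ I.subschemeι ⁻¹ᵁ U := hy
  let _ : Algebra Γ(I.subscheme, I.subschemeι ⁻¹ᵁ U) (I.subscheme.presheaf.stalk y) :=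
    (I.subscheme.presheaf.germ _ y hy').hom.toAlgebra
  have := isLocalization_stalk_primeAt hV y hy'
  rw [isNormalLocalRing_iff_isNormalQuotientAt (I.subschemeι.app U).hom
    (I.subschemeι_app_surjective ⟨U, hU⟩) (primeAt hV y hy'), I.ker_subschemeι_app ⟨U, hU⟩]
  have h := IsAffineOpen.comap_primeIdealOf_appLE (f := I.subschemeι) (x := y) U hU
    (I.subschemeι ⁻¹ᵁ U) hV le_rfl hy'
  rw [← Scheme.Hom.app_eq_appLE] at h
  have h2 : (primeAt hV y hy').comap (I.subschemeι.app U).hom =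
      primeAt hU (I.subschemeι y) hy := congrArg PrimeSpectrum.asIdeal h
  rw [h2]

variable {K : Type u} [Field K] {d : ℕ}

lemma isLocallyNoetherian_of_isRVariety {s : X ⟶ baseScheme K d} (hs : IsRVariety s) :
    IsLocallyNoetherian X := by
  have := hs.locallyOfFiniteType
  have : IsNoetherianRing (CommRingCat.of (MvPowerSeries (Fin d) K)) :=
    inferInstanceAs (IsNoetherianRing (MvPowerSeries (Fin d) K))
  exact LocallyOfFiniteType.isLocallyNoetherian s

lemma isNoetherian_of_isRVariety {s : X ⟶ baseScheme K d} (hs : IsRVariety s) :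
    IsNoetherian X := by
  have := isLocallyNoetherian_of_isRVariety hs
  have := hs.quasiCompact
  have : CompactSpace X := (quasiCompact_iff_compactSpace (f := s)).mp inferInstance
  exact {}

lemma exists_finiteType_sections {U : X.Opens} {s : X ⟶ baseScheme K d} (hs : IsRVariety s)
    (hU : IsAffineOpen U) : ∃ g : MvPowerSeries (Fin d) K →+* Γ(X, U), g.FiniteType := by
  have := hs.locallyOfFiniteType
  refine ⟨(s.appLE ⊤ U le_top).hom.comp
    (Scheme.ΓSpecIso (CommRingCat.of (MvPowerSeries (Fin d) K))).inv.hom, ?_⟩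
  refine (s.finiteType_appLE (isAffineOpen_top _) hU le_top).comp ?_
  exact RingHom.FiniteType.of_surjective _
    (Scheme.ΓSpecIso (CommRingCat.of (MvPowerSeries (Fin d) K))).symm.commRingCatIsoToRingEquiv.surjective

end

end RVar
namespace RVar

/-! ### Divisors whose centre has codimension one -/

open IsLocalRing

/-- Valuation rings are maximal under domination: a fraction of elements of `A` or its inverse lies
in `A`, and in the latter case locality of `φ` makes the inverse a unit. -/
lemma bijective_of_isLocalHom_of_valuationRing {A S : Type*} [CommRing A] [IsDomain A]
    [ValuationRing A] [CommRing S] [IsDomain S] (φ : A →+* S) [IsLocalHom φ]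
    (hφ : Function.Injective φ) (h : ∀ b, ∃ a₁ a₂, a₂ ≠ 0 ∧ b * φ a₂ = φ a₁) :
    Function.Bijective φ := by
  refine ⟨hφ, fun b ↦ ?_⟩
  obtain ⟨a₁, a₂, ha₂, hb⟩ := h b
  have ha₂' : φ a₂ ≠ 0 := (map_ne_zero_iff φ hφ).mpr ha₂
  rcases ValuationRing.dvd_total a₁ a₂ with ⟨c, hc⟩ | ⟨c, hc⟩
  · have h1 : φ a₁ ≠ 0 := by
      rintro h0
      rw [hc, map_mul, h0, zero_mul] at ha₂'
      exact ha₂' rfl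
    have h2 : b * φ c = 1 := by
      refine mul_left_cancel₀ h1 ?_
      rw [hc, map_mul] at hb
      linear_combination hb
    obtain ⟨u, hu⟩ := isUnit_of_map_unit φ c (IsUnit.of_mul_eq_one b (by rw [mul_comm, h2]))
    refine ⟨↑u⁻¹, ?_⟩
    have h3 : φ c * φ ↑u⁻¹ = 1 := by rw [← hu, ← map_mul, Units.mul_inv, map_one]
    linear_combination b * h3 - φ (↑u⁻¹ : A) * h2
  · refine ⟨c, mul_right_cancel₀ ha₂' ?_⟩
    rw [hb, hc, map_mul, mul_comm]

lemma idealOrder_map_of_bijective {A S : Type*} [CommRing A] [IsLocalRing A] [CommRing S]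
    [IsLocalRing S] (φ : A →+* S) (hφ : Function.Bijective φ) (I : Ideal A) :
    idealOrder S (I.map φ) = idealOrder A I := by
  have h (n : ℕ) : I.map φ ≤ maximalIdeal S ^ n ↔ I ≤ maximalIdeal A ^ n := by
    rw [← map_maximalIdeal_of_surjective φ hφ.2, ← Ideal.map_pow, Ideal.map_le_iff_le_comap,
      Ideal.comap_map_of_bijective φ hφ]
  simp only [idealOrder, h]

section

variable {X Y : Scheme.{u}}

lemma exists_mul_stalkSpecializes_eq [IsIntegral X] (η w : X) (hη : η = genericPoint X)
    (h : η ⤳ w) (c : X.presheaf.stalk η) : ∃ a₁ a₂ : X.presheaf.stalk w, a₂ ≠ 0 ∧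
      c * (X.presheaf.stalkSpecializes h).hom a₂ = (X.presheaf.stalkSpecializes h).hom a₁ := by
  subst hη
  obtain ⟨a₁, a₂, ha₂, h1⟩ := IsFractionRing.div_surjective (A := X.presheaf.stalk w)
    (K := X.functionField) c
  refine ⟨a₁, a₂, nonZeroDivisors.ne_zero ha₂, ?_⟩
  rw [div_eq_iff ((map_ne_zero_iff _ (IsFractionRing.injective _ _)).mpr
    (nonZeroDivisors.ne_zero ha₂))] at h1
  exact h1.symm

lemma injective_stalkSpecializes [IsIntegral X] (η w : X) (hη : η = genericPoint X)
    (h : η ⤳ w) : Function.Injective (X.presheaf.stalkSpecializes h).hom := by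
  subst hη
  exact IsFractionRing.injective (X.presheaf.stalk w) X.functionField

lemma IsBirational.exists_isIso_stalkMap {f : Y ⟶ X} (hf : IsBirational f) [IsIntegral Y]
    [IsIntegral X] : f (genericPoint Y) = genericPoint X ∧
      IsIso (f.stalkMap (genericPoint Y)) := by
  obtain ⟨φ, hφ⟩ := hf
  have hmem : ∀ {Z : Scheme.{u}} [IsIntegral Z] (U : Z.Opens), Dense (U : Set Z) →
      genericPoint Z ∈ U := by
    intro Z _ U hU
    obtain ⟨z, hz⟩ := hU.nonempty
    exact (genericPoint_specializes z).mem_open U.isOpen hz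
  constructor
  · have h1 := hmem φ.target φ.dense_target
    let w : φ.target.toScheme := ⟨_, h1⟩
    let z := φ.iso.inv w
    have h2 : f (φ.source.ι z) = genericPoint X := by
      rw [← Scheme.Hom.comp_apply, ← hφ, Scheme.Hom.comp_apply]
      have h3 : φ.iso.hom z = w := by
        rw [← Scheme.Hom.comp_apply, Iso.inv_hom_id]
        rfl
      rw [h3]
      rfl
    refine ((genericPoint_specializes _).antisymm ?_).eq.symm
    rw [← h2]
    exact (genericPoint_specializes _).map f.continuous
  · let y : φ.source.toScheme := ⟨_, hmem φ.source φ.dense_source⟩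
    have h3 : IsIso ((φ.source.ι ≫ f).stalkMap y) := by
      rw [← hφ]
      infer_instance
    rw [Scheme.Hom.stalkMap_comp] at h3
    have h4 : IsIso (f.stalkMap (φ.source.ι y) ≫ φ.source.ι.stalkMap y) := h3
    exact IsIso.of_isIso_comp_right (f.stalkMap (φ.source.ι y)) (φ.source.ι.stalkMap y)

lemma IsBirational.exists_mul_stalkMap_eq {f : Y ⟶ X} (hf : IsBirational f) [IsIntegral Y]
    [IsIntegral X] (y : Y) (b : Y.presheaf.stalk y) :
    ∃ a₁ a₂ : X.presheaf.stalk (f y), a₂ ≠ 0 ∧ b * (f.stalkMap y).hom a₂ = (f.stalkMap y).hom a₁ := by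
  obtain ⟨h1, h2⟩ := hf.exists_isIso_stalkMap
  have hy := genericPoint_specializes y
  obtain ⟨c, hc⟩ := (ConcreteCategory.bijective_of_isIso (f.stalkMap (genericPoint Y))).2
    ((Y.presheaf.stalkSpecializes hy).hom b)
  obtain ⟨a₁, a₂, ha₂, h3⟩ := exists_mul_stalkSpecializes_eq _ (f y) h1
    (hy.map f.continuous) c
  refine ⟨a₁, a₂, ha₂, injective_stalkSpecializes _ y rfl hy ?_⟩
  have h4 (a) : (Y.presheaf.stalkSpecializes hy).hom ((f.stalkMap y).hom a) =
      (f.stalkMap (genericPoint Y)).hom ((X.presheaf.stalkSpecializes (hy.map f.continuous)).hom a) :=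
    (Scheme.Hom.stalkSpecializes_stalkMap_apply f _ _ hy a).symm
  rw [map_mul, h4, h4, ← h3, map_mul, ← hc]

lemma IsBirational.injective_stalkMap {f : Y ⟶ X} (hf : IsBirational f) [IsIntegral Y]
    [IsIntegral X] (y : Y) : Function.Injective (f.stalkMap y).hom := by
  obtain ⟨h1, h2⟩ := hf.exists_isIso_stalkMap
  have hy := genericPoint_specializes y
  have h4 (a) : (Y.presheaf.stalkSpecializes hy).hom ((f.stalkMap y).hom a) =
      (f.stalkMap (genericPoint Y)).hom ((X.presheaf.stalkSpecializes (hy.map f.continuous)).hom a) :=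
    (Scheme.Hom.stalkSpecializes_stalkMap_apply f _ _ hy a).symm
  intro a b hab
  refine injective_stalkSpecializes _ _ h1 (hy.map f.continuous)
    ((ConcreteCategory.bijective_of_isIso (f.stalkMap (genericPoint Y))).1 ?_)
  have := h4 a
  rw [hab, h4 b] at this
  exact this.symm

end

section

variable {K : Type u} [Field K] {d : ℕ} {X : Scheme.{u}} {s : X ⟶ baseScheme K d}

lemma DivisorOver.centre_eq (E : DivisorOver s) : E.centre = closure {E.f E.point} := by
  rw [DivisorOver.centre, closure_image_closure E.f.continuous, Set.image_singleton]

/-- The order of an `ℝ`-ideal at a point of `X`. -/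
noncomputable def RIdeal.orderAt (𝔞 : RIdeal X) (x : X) : ℝ≥0∞ :=
  ∑ j : Fin 𝔞.n, ENNReal.ofReal (𝔞.exponent j) *
    (idealOrder (X.presheaf.stalk x) (stalkIdeal (𝔞.ideal j) x) : ℝ≥0∞)

/-- At a point of codimension one the regular local ring is a discrete valuation ring. The local
ring of the divisor dominates it and has the same fractions, so the two coincide. -/
lemma DivisorOver.ord_eq_orderAt (hs : IsRVariety s) (hX : IsNonsingular X) (𝔞 : RIdeal X)
    (E : DivisorOver s) (h : Order.coheight (E.f E.point) = 1) :
    E.ord 𝔞 = 𝔞.orderAt (E.f E.point) := by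
  have := hs.isIntegral
  have := E.isRVariety.isIntegral
  have := hX (E.f E.point)
  have hdim : ringKrullDim (X.presheaf.stalk (E.f E.point)) = 1 := by
    rw [ringKrullDim_stalk_eq_coheight, h]; rfl
  have := isPrincipalIdealRing_of_ringKrullDim_eq_one _ hdim
  have hb := bijective_of_isLocalHom_of_valuationRing (E.f.stalkMap E.point).hom
    (E.isBirational.injective_stalkMap E.point) (E.isBirational.exists_mul_stalkMap_eq E.point)
  simp only [DivisorOver.ord, RIdeal.orderAt, pullbackStalkIdeal,
    idealOrder_map_of_bijective _ hb]

/-- The relative canonical divisor is effective, so it can be dropped. -/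
lemma DivisorOver.one_le_ord_of_logDiscrepancy_le {𝔞 : RIdeal X} {E : DivisorOver s}
    (h : E.logDiscrepancy 𝔞 ≤ 0) : 1 ≤ E.ord 𝔞 := by
  rw [DivisorOver.logDiscrepancy, EReal.sub_nonpos] at h
  have h1 : ((1 : ℝ≥0∞) : EReal) ≤ (E.ord 𝔞 : EReal) := by
    refine le_trans ?_ h
    rw [EReal.coe_ennreal_one]
    exact le_add_of_nonneg_right (EReal.coe_ennreal_nonneg _)
  exact_mod_cast h1

lemma one_le_orderAt_of_isNonKltCentre (hs : IsRVariety s) (hX : IsNonsingular X) {𝔞 : RIdeal X}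
    {Z : Set X} (hZ : IsNonKltCentre s 𝔞 Z) {η : X} (hη : IsGenericPoint η Z)
    (h1 : Order.coheight η = 1) : 1 ≤ 𝔞.orderAt η := by
  obtain ⟨E, rfl, hE⟩ := hZ
  rw [DivisorOver.centre_eq] at hη
  obtain rfl : E.f E.point = η := IsGenericPoint.eq (isGenericPoint_closure) hη
  rw [← E.ord_eq_orderAt hs hX 𝔞 h1]
  exact DivisorOver.one_le_ord_of_logDiscrepancy_le hE

end

end RVar
namespace RVar

/-! ### The union of the non-klt centres of codimension one -/

section

variable {K : Type u} [Field K] {d : ℕ} {X : Scheme.{u}} {s : X ⟶ baseScheme K d}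

lemma coheight_add_one_le_of_specializes {x y : X} (h : x ⤳ y) (hne : x ≠ y) :
    Order.coheight x + 1 ≤ Order.coheight y :=
  Order.coheight_add_one_le (lt_of_le_not_ge h fun h' ↦ hne (h.antisymm h').eq)

lemma eq_genericPoint_of_coheight_eq_zero [IsIntegral X] {x : X} (h : Order.coheight x = 0) :
    x = genericPoint X :=
  (Specializes.antisymm (Order.coheight_eq_zero.mp h (genericPoint_specializes x) :)
    (genericPoint_specializes x)).eq

/-- When the locus is a proper closed set, each centre of codimension one is among the finitely many
irreducible pieces of its decomposition, so their union is already closed and every point of it lies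
on a centre. -/
lemma exists_specializes_of_mem_codimOneLocus (hs : IsRVariety s) (hX : IsNonsingular X)
    {𝔞 : RIdeal X} (hS : codimOneLocus s 𝔞 ≠ ⊤) {x : X} (hx : x ∈ codimOneLocus s 𝔞) :
    ∃ η ∈ codimOneLocus s 𝔞, Order.coheight η = 1 ∧ 1 ≤ 𝔞.orderAt η ∧ η ⤳ x := by
  have := hs.isIntegral
  have := isNoetherian_of_isRVariety hs
  set 𝒵 : Set (Set X) := {Z : Set X | IsNonKltCentre s 𝔞 Z ∧ IsCodimOne Z}
  have hle : ∀ Z ∈ 𝒵, Z ⊆ codimOneLocus s 𝔞 := fun Z hZ ↦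
    (Set.subset_sUnion_of_mem hZ).trans subset_closure
  have hclosed : ∀ Z ∈ 𝒵, IsClosed Z := by
    rintro Z ⟨⟨E, rfl, -⟩, -⟩
    exact isClosed_closure
  obtain ⟨𝒲, hfin, hcl, hirr, hcov⟩ := NoetherianSpace.exists_finite_set_isClosed_irreducible
    (codimOneLocus s 𝔞).isClosed
  have hsub : 𝒵 ⊆ 𝒲 := by
    intro Z hZ
    obtain ⟨η, hη, hη1⟩ := hZ.2
    have hmem : η ∈ (codimOneLocus s 𝔞 : Set X) := hle Z hZ hη.mem
    rw [hcov] at hmem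
    obtain ⟨W, hW, hηW⟩ := hmem
    obtain ⟨w, hw⟩ := QuasiSober.sober (hirr W hW) (hcl W hW)
    have hwη : w ⤳ η := hw.specializes hηW
    suffices w = η by
      rw [← hη.def, ← this, hw.def]
      exact hW
    -- A piece strictly larger than the centre would have the generic point of `X` as its generic
    -- point.
    by_contra hne
    have h0 := coheight_add_one_le_of_specializes hwη hne
    rw [hη1] at h0
    have h1 : Order.coheight w = 0 := by
      refine le_antisymm ?_ bot_le
      exact (ENat.add_le_add_iff_right ENat.one_ne_top).mp (by simpa using h0)
    have h2 : W ⊆ codimOneLocus s 𝔞 := by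
      rw [hcov]
      exact Set.subset_sUnion_of_mem hW
    refine hS (SetLike.coe_injective ?_)
    rw [Closeds.coe_top, ← Set.univ_subset_iff]
    refine Set.Subset.trans ?_ h2
    rw [← hw.def, eq_genericPoint_of_coheight_eq_zero h1, genericPoint_closure]
  have hS' : IsClosed (⋃₀ 𝒵) := by
    rw [Set.sUnion_eq_biUnion]
    exact (hfin.subset hsub).isClosed_biUnion hclosed
  have hx' : x ∈ ⋃₀ 𝒵 := by
    have : x ∈ closure (⋃₀ 𝒵) := hx
    rwa [hS'.closure_eq] at this
  obtain ⟨Z, hZ, hxZ⟩ := hx'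
  obtain ⟨η, hη, hη1⟩ := hZ.2
  exact ⟨η, hle Z hZ hη.mem, hη1, one_le_orderAt_of_isNonKltCentre hs hX hZ.1 hη hη1,
    hη.specializes hxZ⟩

lemma one_le_orderAt_of_mem_codimOneLocus (hs : IsRVariety s) (hX : IsNonsingular X)
    {𝔞 : RIdeal X} (hS : codimOneLocus s 𝔞 ≠ ⊤) {x : X} (hx : x ∈ codimOneLocus s 𝔞)
    (h1 : Order.coheight x = 1) : 1 ≤ 𝔞.orderAt x := by
  obtain ⟨η, -, hη1, hη, hηx⟩ := exists_specializes_of_mem_codimOneLocus hs hX hS hx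
  obtain rfl : η = x := by
    by_contra hne
    have := coheight_add_one_le_of_specializes hηx hne
    rw [hη1, h1] at this
    exact absurd this (by decide)
  exact hη

lemma mem_support_codimOneIdeal {𝔞 : RIdeal X} {x : X} :
    x ∈ (codimOneIdeal s 𝔞).support ↔ x ∈ codimOneLocus s 𝔞 := by
  rw [← SetLike.mem_coe, codimOneIdeal, Scheme.IdealSheafData.coe_support_vanishingIdeal]
  rfl

lemma isRadical_codimOneIdeal (𝔞 : RIdeal X) (U : X.affineOpens) :
    ((codimOneIdeal s 𝔞).ideal U).IsRadical := by
  rw [codimOneIdeal, Scheme.IdealSheafData.vanishingIdeal_ideal]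
  exact PrimeSpectrum.isRadical_vanishingIdeal _

lemma hasHeightOnePrimesBelow_codimOneIdeal (hs : IsRVariety s) (hX : IsNonsingular X)
    {𝔞 : RIdeal X} (hS : codimOneLocus s 𝔞 ≠ ⊤) {U : X.Opens} (hU : IsAffineOpen U) :
    HasHeightOnePrimesBelow ((codimOneIdeal s 𝔞).ideal ⟨U, hU⟩) := by
  intro q hq hIq
  obtain ⟨x, hx, rfl⟩ := exists_primeAt_eq hU q
  rw [ideal_le_primeAt_iff, mem_support_codimOneIdeal] at hIq
  obtain ⟨η, hη, hη1, -, hηx⟩ := exists_specializes_of_mem_codimOneLocus hs hX hS hIq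
  have hηU : η ∈ U := hηx.mem_open U.isOpen hx
  refine ⟨primeAt hU η hηU, inferInstance, ?_, ?_, ?_⟩
  · rw [height_primeAt, hη1]
  · rwa [ideal_le_primeAt_iff, mem_support_codimOneIdeal]
  · rwa [primeAt_le_primeAt_iff]

lemma isNormalLocalRing_stalk_of_isNonsingular (hs : IsRVariety s) (hX : IsNonsingular X) (x : X) :
    IsNormalLocalRing (X.presheaf.stalk x) := by
  have := hs.isIntegral
  have := isLocallyNoetherian_of_isRVariety hs
  obtain ⟨U, hU, hx, -⟩ := exists_isAffineOpen_mem_and_subset (U := ⊤) (x := x) trivial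
  have hreg := isRegularRing_sections hU hX
  let _ : Algebra Γ(X, U) (X.presheaf.stalk x) := (X.presheaf.germ U x hx).hom.toAlgebra
  have := isLocalization_stalk_primeAt hU x hx
  have : IsRegularRing (X.presheaf.stalk x) :=
    isRegularRing_of_isLocalization (primeAt hU x hx).primeCompl _
  have := uniqueFactorizationMonoid_of_isRegularRing (X.presheaf.stalk x)
  exact ⟨inferInstance, inferInstance⟩

/-- The reduced ideal of the whole of `X` is zero, so the subscheme has the local rings of `X`,
which are factorial. This covers zero ideals among the factors whenever they make the locus all of
`X`. -/
lemma nonNormalLocus_codimOneIdeal_eq_empty (hs : IsRVariety s) (hX : IsNonsingular X)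
    {𝔞 : RIdeal X} (hS : codimOneLocus s 𝔞 = ⊤) :
    nonNormalLocus (codimOneIdeal s 𝔞).subscheme = ∅ := by
  have := hs.isIntegral
  refine Set.eq_empty_of_forall_notMem fun y hy ↦ hy ?_
  obtain ⟨U, hU, hyU, -⟩ := exists_isAffineOpen_mem_and_subset (U := ⊤)
    (x := (codimOneIdeal s 𝔞).subschemeι y) trivial
  rw [isNormalLocalRing_subscheme_iff hU _ y hyU]
  have hbot : (codimOneIdeal s 𝔞).ideal ⟨U, hU⟩ = ⊥ := by
    rw [codimOneIdeal, hS, Scheme.IdealSheafData.vanishingIdeal_top,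
      Scheme.nilradical_eq_bot, Scheme.IdealSheafData.ideal_bot]
    rfl
  set x := (codimOneIdeal s 𝔞).subschemeι y
  have h1 := isNormalLocalRing_stalk_of_isNonsingular hs hX x
  let _ : Algebra Γ(X, U) (X.presheaf.stalk x) := (X.presheaf.germ U x hyU).hom.toAlgebra
  have := isLocalization_stalk_primeAt hU x hyU
  rw [isNormalLocalRing_iff_isNormalQuotientAt (RingHom.id Γ(X, U)) Function.surjective_id
    (primeAt hU x hyU), Ideal.comap_id] at h1
  rwa [hbot, ← (RingHom.injective_iff_ker_eq_bot (RingHom.id Γ(X, U))).mp Function.injective_id]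

end

end RVar
namespace RVar

/-! ### The exceptional divisor of a blow-up chart -/

open IsLocalRing

section

variable {B : Type*} [CommRing B] [IsDomain B] {f g : B} {A S : Type*} [CommRing A] [CommRing S]
  [Algebra B A] [Algebra A S] [Algebra B S] [IsScalarTower B A S]
  [Algebra (blowupChart B f g) S] [IsScalarTower B (blowupChart B f g) S]

lemma algebraMap_blowupChart_eq_aeval (c : blowupChart B f g) : ∃ p : Polynomial B,
    algebraMap (blowupChart B f g) S c = Polynomial.aeval (algebraMap (blowupChart B f g) S
      ⟨_, Algebra.subset_adjoin (Set.mem_singleton _)⟩) p := by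
  obtain ⟨p, hp⟩ := mem_blowupChart_iff.mp c.2
  refine ⟨p, ?_⟩
  rw [Polynomial.aeval_algebraMap_apply]
  congr 1
  refine Subtype.ext ?_
  rw [← hp]
  exact Polynomial.aeval_algHom_apply (blowupChart B f g).val
    ⟨_, Algebra.subset_adjoin (Set.mem_singleton _)⟩ p

lemma algebraMap_mem_fittingIdealZero (hf : f ≠ 0) (Q : Ideal (blowupChart B f g)) [Q.IsPrime]
    [IsLocalization.AtPrime S Q] :
    algebraMap B S f ∈ fittingIdealZero S (KaehlerDifferential A S) := by
  let τ₀ : blowupChart B f g := ⟨_, Algebra.subset_adjoin (Set.mem_singleton _)⟩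
  have hτ : algebraMap B (blowupChart B f g) f * τ₀ = algebraMap B (blowupChart B f g) g := by
    refine Subtype.ext ?_
    change algebraMap B (FractionRing B) f * (algebraMap B (FractionRing B) g / algebraMap B _ f) =
      algebraMap B (FractionRing B) g
    rw [mul_div_cancel₀]
    simpa using hf
  have hmem (c : blowupChart B f g) : algebraMap _ S c ∈
      Algebra.adjoin A {algebraMap (blowupChart B f g) S τ₀} := by
    obtain ⟨p, hp⟩ := algebraMap_blowupChart_eq_aeval (S := S) c
    rw [hp]
    refine Algebra.adjoin_le (S := (Algebra.adjoin A {algebraMap (blowupChart B f g) S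
      τ₀}).restrictScalars B) ?_ (Polynomial.aeval_mem_adjoin_singleton B _)
    exact Algebra.subset_adjoin
  refine mem_fittingIdealZero_of_adjoin (A := A) _ (algebraMap (blowupChart B f g) S τ₀)
    ⟨algebraMap B A f, (IsScalarTower.algebraMap_apply B A S f).symm⟩
    ⟨algebraMap B A g, ?_⟩ fun x ↦ ?_
  · rw [← IsScalarTower.algebraMap_apply B A S,
      IsScalarTower.algebraMap_apply B (blowupChart B f g) S, ← hτ, map_mul,
      IsScalarTower.algebraMap_apply B (blowupChart B f g) S]
  · obtain ⟨⟨c, t⟩, hc⟩ := IsLocalization.surj Q.primeCompl x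
    refine ⟨_, hmem t, IsLocalization.map_units S t, ?_⟩
    rw [mul_comm, hc]
    exact hmem c

variable [IsLocalRing S] (Q : Ideal (blowupChart B f g)) [Q.IsPrime] [IsLocalization.AtPrime S Q]

/-- The Fitting ideal contains `f`, which generates the maximal ideal of `S` and so has order one.
Only this upper bound on the canonical order is needed. -/
lemma idealOrder_fittingIdealZero_blowupChart_le_one (hf : f ≠ 0)
    (hQ : Q = Ideal.span {algebraMap B _ f}) :
    idealOrder S (fittingIdealZero S (KaehlerDifferential A S)) ≤ 1 := by
  refine idealOrder_le_one_of_mem (algebraMap_mem_fittingIdealZero hf Q) fun hmem ↦ ?_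
  have hdom : IsDomain S :=
    IsLocalization.isDomain_of_le_nonZeroDivisors S Q.primeCompl_le_nonZeroDivisors
  have hm : maximalIdeal S = Ideal.span {algebraMap B S f} := by
    rw [← IsLocalization.AtPrime.map_eq_maximalIdeal Q S, hQ, Ideal.map_span, Set.image_singleton,
      ← IsScalarTower.algebraMap_apply]
  have hf0 : algebraMap B S f ≠ 0 := by
    rw [IsScalarTower.algebraMap_apply B (blowupChart B f g) S]
    refine (map_ne_zero_iff _ (IsLocalization.injective S Q.primeCompl_le_nonZeroDivisors)).mpr ?_
    refine fun h0 ↦ hf ?_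
    have := congrArg Subtype.val h0
    exact (map_eq_zero_iff _ (IsFractionRing.injective B (FractionRing B))).mp this
  have hnu : ¬ IsUnit (algebraMap B S f) := by
    rw [← mem_nonunits_iff, ← mem_maximalIdeal, hm]
    exact Ideal.mem_span_singleton_self _
  rw [hm, Ideal.span_singleton_pow, Ideal.mem_span_singleton] at hmem
  obtain ⟨c, hc⟩ := hmem
  refine hnu (IsUnit.of_mul_eq_one c (mul_left_cancel₀ hf0 ?_))
  rw [mul_one]
  linear_combination -hc

/-- The exceptional prime lies over `q`, so elements outside `q` become units in `S` and `qⁿ` lands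
in the `n`-th power of its maximal ideal. -/
lemma add_le_idealOrder_map_blowupChart [IsRegularRing B] {q : Ideal B} [q.IsPrime] (hf : f ≠ 0) (hq : q.height = 2)
    (hfg : q = Ideal.span {f, g}) (hQ : Q = Ideal.span {algebraMap B _ f})
    {p₁ p₂ : Ideal B} [p₁.IsPrime] [p₂.IsPrime]
    (hp : ∀ (n₁ n₂ : ℕ) (a : B), (∃ s ∉ p₁, s * a ∈ p₁ ^ n₁) →
        (∃ s ∉ p₂, s * a ∈ p₂ ^ n₂) → ∃ s ∉ q, s * a ∈ q ^ (n₁ + n₂))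
    (A₁ A₂ : Type*) [CommRing A₁] [CommRing A₂] [IsLocalRing A₁] [IsLocalRing A₂] [Algebra B A₁]
    [Algebra B A₂] [IsLocalization.AtPrime A₁ p₁] [IsLocalization.AtPrime A₂ p₂] (J : Ideal B) :
    idealOrder A₁ (J.map (algebraMap B A₁)) + idealOrder A₂ (J.map (algebraMap B A₂)) ≤
      idealOrder S (J.map (algebraMap B S)) := by
  refine add_le_of_forall_natCast fun m n hm hn ↦ ?_
  rw [natCast_le_idealOrder_map_iff p₁] at hm
  rw [natCast_le_idealOrder_map_iff p₂] at hn
  rw [natCast_le_idealOrder_iff, Ideal.map_le_iff_le_comap]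
  intro a ha
  obtain ⟨s, hs, hsa⟩ := hp m n a (hm a ha) (hn a ha)
  have hcomap : Q.comap (algebraMap B _) = q := hQ ▸ comap_span_blowupChart hf hq hfg
  have hu : IsUnit (algebraMap B S s) := by
    rw [IsScalarTower.algebraMap_apply B (blowupChart B f g) S]
    refine IsLocalization.map_units S (⟨algebraMap B _ s, fun h ↦ hs ?_⟩ : Q.primeCompl)
    rw [← hcomap]
    exact h
  have hle : q.map (algebraMap B S) ≤ maximalIdeal S := by
    rw [IsScalarTower.algebraMap_eq B (blowupChart B f g) S, ← Ideal.map_map,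
      ← IsLocalization.AtPrime.map_eq_maximalIdeal Q S]
    exact Ideal.map_mono (Ideal.map_le_iff_le_comap.mpr hcomap.ge)
  rw [Ideal.mem_comap, ← Ideal.unit_mul_mem_iff_mem _ hu, ← map_mul]
  refine Ideal.pow_right_mono hle _ ?_
  rw [← Ideal.map_pow]
  exact Ideal.mem_map_of_mem _ hsa

end

end RVar
namespace RVar

/-! ### Morphisms from spectra over an affine chart -/

section

variable {X Y : Scheme.{u}}

lemma isBirational_of_isOpenImmersion {V : Scheme.{u}} [IsIntegral X] [IsIntegral Y] [Nonempty V]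
    (f : Y ⟶ X) (j : V ⟶ Y) (i : V ⟶ X) [IsOpenImmersion j] [IsOpenImmersion i] (h : j ≫ f = i) :
    IsBirational f := by
  refine ⟨⟨j.opensRange, j.opensRange.isOpen.dense (Set.range_nonempty j), i.opensRange,
    i.opensRange.isOpen.dense (Set.range_nonempty i),
    j.isoOpensRange.symm ≪≫ i.isoOpensRange⟩, ?_⟩
  simp only [Iso.trans_hom, Iso.symm_hom, Category.assoc, Scheme.Hom.isoOpensRange_hom_ι]
  rw [← h, ← Category.assoc, Scheme.Hom.isoOpensRange_inv_comp]

/-- The map from a ring to the local ring of its spectrum at a point. -/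
noncomputable def toSpecStalk (C : CommRingCat.{u}) (y : Spec C) :
    C →+* (Spec C).presheaf.stalk y :=
  ((Spec C).presheaf.germ ⊤ y trivial).hom.comp (Scheme.ΓSpecIso C).inv.hom

lemma isLocalization_toSpecStalk (C : CommRingCat.{u}) (y : Spec C) :
    haveI := y.isPrime
    letI : Algebra C ((Spec C).presheaf.stalk y) := (toSpecStalk C y).toAlgebra
    IsLocalization.AtPrime ((Spec C).presheaf.stalk y) y.asIdeal :=
  have := y.isPrime
  StructureSheaf.IsLocalization.to_stalk C y

/-- The morphism to `X` from the spectrum of an algebra over the ring of an affine open of `X`. -/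
noncomputable def chartMap {U : X.Opens} (hU : IsAffineOpen U) {C : CommRingCat.{u}}
    (φ : Γ(X, U) ⟶ C) : Spec C ⟶ X :=
  Spec.map φ ≫ hU.fromSpec

variable {U : X.Opens} (hU : IsAffineOpen U) {C : CommRingCat.{u}} (φ : Γ(X, U) ⟶ C)

lemma chartMap_mem (y : Spec C) : chartMap hU φ y ∈ U := by
  have : hU.fromSpec (Spec.map φ y) ∈ Set.range hU.fromSpec := ⟨_, rfl⟩
  rwa [hU.range_fromSpec] at this

lemma primeAt_chartMap (y : Spec C) :
    primeAt hU (chartMap hU φ y) (chartMap_mem hU φ y) = y.asIdeal.comap φ.hom := by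
  have h := hU.fromSpec_primeIdealOf ⟨_, chartMap_mem hU φ y⟩
  exact congrArg PrimeSpectrum.asIdeal
    (hU.fromSpec.isOpenEmbedding.injective (h.trans rfl) : _ = Spec.map φ y)

lemma stalkMap_chartMap (y : Spec C) (b : Γ(X, U)) :
    ((chartMap hU φ).stalkMap y).hom
      ((X.presheaf.germ U (chartMap hU φ y) (chartMap_mem hU φ y)).hom b) =
      toSpecStalk C y (φ.hom b) := by
  have h1 := Scheme.Hom.germ_stalkMap (chartMap hU φ) U y (chartMap_mem hU φ y)
  have h2 : (chartMap hU φ).app U ≫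
      (Spec C).presheaf.germ (chartMap hU φ ⁻¹ᵁ U) y (chartMap_mem hU φ y) =
      φ ≫ (Scheme.ΓSpecIso C).inv ≫ (Spec C).presheaf.germ ⊤ y trivial := by
    have h3 : (chartMap hU φ).app U = (φ ≫ (Scheme.ΓSpecIso C).inv) ≫
        (Spec C).presheaf.map (homOfLE le_top).op := by
      rw [chartMap, Scheme.Hom.comp_app, hU.fromSpec_app_of_le U le_rfl]
      rw [Scheme.ΓSpecIso_inv_naturality]
      simp only [Category.assoc, Scheme.Hom.naturality]
      simp
    rw [h3, Category.assoc, Category.assoc]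
    congr 2
    exact (Spec C).presheaf.germ_res _ _ _
  rw [h2] at h1
  exact congr($(h1).hom b)

/-- The chart and `U` have the common open subscheme where `f` is inverted. -/
lemma isBirational_chartMap [IsIntegral X] [IsDomain Γ(X, U)] [IsDomain C] {f : Γ(X, U)} (hf : f ≠ 0)
    (hφ : Function.Injective φ.hom) (h : ∀ c : C, ∃ (n : ℕ) (b : Γ(X, U)), φ.hom f ^ n * c = φ.hom b) :
    IsBirational (chartMap hU φ) := by
  let L := Localization.Away (φ.hom f)
  let ψ : C →+* L := algebraMap C L
  have hψ : Function.Injective ψ := IsLocalization.injective L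
    (powers_le_nonZeroDivisors_of_noZeroDivisors ((map_ne_zero_iff _ hφ).mpr hf))
  let _ : Algebra Γ(X, U) L := (ψ.comp φ.hom).toAlgebra
  have hloc : IsLocalization.Away f L := by
    rw [IsLocalization.Away, isLocalization_iff]
    refine ⟨?_, fun z ↦ ?_, fun {x y} hxy ↦ ⟨1, ?_⟩⟩
    · rintro ⟨_, n, rfl⟩
      rw [map_pow]
      exact (IsLocalization.Away.algebraMap_isUnit (φ.hom f)).pow n
    · obtain ⟨n, c, hc⟩ := IsLocalization.Away.surj (φ.hom f) z
      obtain ⟨m, b, hb⟩ := h c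
      refine ⟨⟨b, ⟨f ^ (n + m), n + m, rfl⟩⟩, ?_⟩
      have hb' := congrArg ψ hb
      rw [map_mul, map_pow] at hb'
      have hc' : z * ψ (φ.hom f) ^ n = ψ c := hc
      change z * ψ (φ.hom (f ^ (n + m))) = ψ (φ.hom b)
      rw [map_pow, map_pow, ← hb', ← hc']
      ring
    · exact congrArg _ (hφ (hψ hxy))
  have : Nontrivial L := hψ.nontrivial
  have : Nonempty (Spec (CommRingCat.of L)) := inferInstanceAs (Nonempty (PrimeSpectrum L))
  have hi : IsOpenImmersion (Spec.map (CommRingCat.ofHom (algebraMap Γ(X, U) L))) :=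
    IsOpenImmersion.of_isLocalization f
  have hj : IsOpenImmersion (Spec.map (CommRingCat.ofHom ψ)) :=
    IsOpenImmersion.of_isLocalization (φ.hom f)
  refine isBirational_of_isOpenImmersion (chartMap hU φ) (Spec.map (CommRingCat.ofHom ψ))
    (Spec.map (CommRingCat.ofHom (algebraMap Γ(X, U) L)) ≫ hU.fromSpec) ?_
  rw [chartMap, ← Category.assoc, ← Spec.map_comp]
  rfl

end

end RVar
namespace RVar

/-! ### Blowing up a point of codimension two -/

open IsLocalRing

section

variable {X : Scheme.{u}}

lemma mem_primeAt_iff {U : X.Opens} (hU : IsAffineOpen U) (x : X) (hx : x ∈ U) (b : Γ(X, U)) :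
    b ∈ primeAt hU x hx ↔
      (X.presheaf.germ U x hx).hom b ∈ maximalIdeal (X.presheaf.stalk x) := by
  let _ : Algebra Γ(X, U) (X.presheaf.stalk x) := (X.presheaf.germ U x hx).hom.toAlgebra
  have := isLocalization_stalk_primeAt hU x hx
  exact (IsLocalization.AtPrime.to_map_mem_maximal_iff (X.presheaf.stalk x)
    (primeAt hU x hx) b).symm

lemma exists_maximalIdeal_eq_span_pair (A : Type*) [CommRing A] [IsRegularLocalRing A]
    (hdim : ringKrullDim A = 2) : ∃ f g : A, maximalIdeal A = Ideal.span {f, g} := by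
  classical
  have h1 : (maximalIdeal A).spanFinrank = 2 := by
    have : ((maximalIdeal A).spanFinrank : WithBot ℕ∞) = ringKrullDim A :=
      IsRegularLocalRing.spanFinrank_maximalIdeal
    rw [hdim] at this
    exact_mod_cast this
  obtain ⟨S, hcard, hS⟩ := Submodule.FG.exists_span_finset_card_eq_spanFinrank
    (IsNoetherian.noetherian (maximalIdeal A))
  rw [h1, Finset.card_eq_two] at hcard
  obtain ⟨f, g, -, rfl⟩ := hcard
  exact ⟨f, g, by rw [← hS]; simp [Ideal.span]⟩

lemma exists_mul_mem_span_of_map_eq {B A : Type*} [CommRing B] [IsNoetherianRing B] [CommRing A]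
    [Algebra B A] (q : Ideal B) [q.IsPrime] [IsLocalization.AtPrime A q] (I : Ideal B)
    (h : q.map (algebraMap B A) ≤ I.map (algebraMap B A)) : ∃ s ∉ q, ∀ b ∈ q, s * b ∈ I := by
  classical
  obtain ⟨T, hT⟩ := IsNoetherian.noetherian q
  have h1 : ∀ b : q, ∃ s ∉ q, s * (b : B) ∈ I := by
    intro b
    obtain ⟨s, hs, hsb⟩ := (IsLocalization.algebraMap_mem_map_algebraMap_iff q.primeCompl A I
      (b : B)).mp (h (Ideal.mem_map_of_mem _ b.2))
    exact ⟨s, hs, hsb⟩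
  choose! σ hσ hσI using h1
  have hTq : ∀ t ∈ T, t ∈ q := fun t ht ↦ hT ▸ Submodule.subset_span ht
  let s := ∏ t ∈ T.attach, σ ⟨t.1, hTq t.1 t.2⟩
  refine ⟨s, fun hs ↦ ?_, fun b hb ↦ ?_⟩
  · obtain ⟨t, -, ht⟩ := (Ideal.IsPrime.prod_mem_iff (hp := ‹q.IsPrime›)).mp hs
    exact hσ _ ht
  · have hle : q ≤ I.colon {s} := by
      conv_lhs => rw [← hT]
      refine Submodule.span_le.mpr fun t ht ↦ ?_
      rw [SetLike.mem_coe, Submodule.mem_colon_singleton, smul_eq_mul, mul_comm]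
      obtain ⟨r, hr⟩ : σ ⟨t, hTq t ht⟩ ∣ s :=
        Finset.dvd_prod_of_mem (fun t : T ↦ σ ⟨t.1, hTq t.1 t.2⟩) (Finset.mem_attach T ⟨t, ht⟩)
      rw [hr, mul_right_comm]
      exact I.mul_mem_right _ (hσI ⟨t, hTq t ht⟩)
    have := hle hb
    rwa [Submodule.mem_colon_singleton, smul_eq_mul, mul_comm] at this

/-- Generators of the maximal ideal of the stalk come, up to units, from sections. Finitely many
denominators are then inverted by passing to a basic open set, on which these sections generate the
prime of `x`. -/
lemma exists_primeAt_eq_span_pair [IsLocallyNoetherian X] (hX : IsNonsingular X) (x : X)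
    (h2 : Order.coheight x = 2) : ∃ (U : X.Opens) (hU : IsAffineOpen U) (hx : x ∈ U) (f g : Γ(X, U)),
      f ≠ 0 ∧ primeAt hU x hx = Ideal.span {f, g} := by
  obtain ⟨U, hU, hx, -⟩ := exists_isAffineOpen_mem_and_subset (U := ⊤) (x := x) trivial
  let A := X.presheaf.stalk x
  have : IsNoetherianRing Γ(X, U) := IsLocallyNoetherian.component_noetherian ⟨U, hU⟩
  let _ : Algebra Γ(X, U) A := (X.presheaf.germ U x hx).hom.toAlgebra
  have hloc : IsLocalization.AtPrime A (primeAt hU x hx) := isLocalization_stalk_primeAt hU x hx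
  have hreg : IsRegularLocalRing A := hX x
  have hdim : ringKrullDim A = 2 := by
    rw [ringKrullDim_stalk_eq_coheight, h2]; rfl
  obtain ⟨f', g', hm⟩ := exists_maximalIdeal_eq_span_pair A hdim
  obtain ⟨hf', -, -⟩ := dvd_of_dvd_mul_of_maximalIdeal_eq_span_pair A hdim hm
  have := isDomain_of_isRegularLocalRing A
  obtain ⟨⟨f₀, t₁⟩, hf₀⟩ := IsLocalization.surj (primeAt hU x hx).primeCompl f'
  obtain ⟨⟨g₀, t₂⟩, hg₀⟩ := IsLocalization.surj (primeAt hU x hx).primeCompl g'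
  have hu₁ := IsLocalization.map_units A t₁
  have hu₂ := IsLocalization.map_units A t₂
  simp only at hf₀ hg₀
  have hm' : maximalIdeal A = (Ideal.span {f₀, g₀}).map (algebraMap Γ(X, U) A) := by
    rw [Ideal.map_span, Set.image_pair, ← hf₀, ← hg₀, hm, Ideal.span_insert, Ideal.span_insert,
      Ideal.span_singleton_mul_right_unit hu₁, Ideal.span_singleton_mul_right_unit hu₂]
  obtain ⟨s, hs, hsq⟩ := exists_mul_mem_span_of_map_eq (A := A) (primeAt hU x hx)
    (Ideal.span {f₀, g₀}) (by rw [IsLocalization.AtPrime.map_eq_maximalIdeal, hm'])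
  have hxs : x ∈ X.basicOpen s := by
    rw [Scheme.mem_basicOpen _ _ _ hx]
    exact IsLocalization.map_units A (⟨s, hs⟩ : (primeAt hU x hx).primeCompl)
  let D := X.basicOpen s
  have hD : IsAffineOpen D := hU.basicOpen s
  let res : Γ(X, U) →+* Γ(X, D) := (X.presheaf.map (homOfLE (X.basicOpen_le s)).op).hom
  have hres (b : Γ(X, U)) : (X.presheaf.germ D x hxs).hom (res b) = algebraMap Γ(X, U) A b :=
    X.presheaf.germ_res_apply (homOfLE (X.basicOpen_le s)) x hxs b
  have hmem (b : Γ(X, U)) : res b ∈ primeAt hD x hxs ↔ b ∈ primeAt hU x hx := by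
    rw [mem_primeAt_iff, mem_primeAt_iff, hres]
    rfl
  refine ⟨D, hD, hxs, res f₀, res g₀, ?_, le_antisymm (fun a ha ↦ ?_) ?_⟩
  · intro h0
    have h3 := hres f₀
    rw [h0, map_zero, ← hf₀] at h3
    exact mul_ne_zero hf' hu₁.ne_zero h3.symm
  · let _ : Algebra Γ(X, U) Γ(X, D) := res.toAlgebra
    have hlocD : IsLocalization.Away s Γ(X, D) := hU.isLocalization_basicOpen s
    obtain ⟨n, b, hb⟩ := IsLocalization.Away.surj s a
    have hus : IsUnit (res s) := IsLocalization.Away.algebraMap_isUnit s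
    have hb' : a * res s ^ n = res b := hb
    have hbq : b ∈ primeAt hU x hx := by
      rw [← hmem, ← hb']
      exact Ideal.mul_mem_right _ _ ha
    have h4 := Ideal.mem_map_of_mem res (hsq b hbq)
    rw [Ideal.map_span, Set.image_pair, map_mul, ← hb'] at h4
    rw [← Ideal.unit_mul_mem_iff_mem _ (hus.pow n), ← Ideal.unit_mul_mem_iff_mem _ hus, mul_comm _ a]
    exact h4
  · rw [Ideal.span_le]
    have hsub : ∀ b ∈ Ideal.span {f₀, g₀}, res b ∈ primeAt hD x hxs := by
      intro b hb
      rw [hmem, mem_primeAt_iff]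
      change algebraMap Γ(X, U) A b ∈ maximalIdeal A
      rw [hm']
      exact Ideal.mem_map_of_mem _ hb
    rintro _ (rfl | rfl)
    · exact hsub _ (Ideal.subset_span (by simp))
    · exact hsub _ (Ideal.subset_span (by simp))

end

end RVar
namespace RVar

open IsLocalRing

/-! ### The exceptional divisor of the chart as a divisor over `X` -/

section

variable {K : Type u} [Field K] {d : ℕ} {X : Scheme.{u}} {s : X ⟶ baseScheme K d}

lemma isRVariety_chartMap (hs : IsRVariety s) {U : X.Opens} (hU : IsAffineOpen U)
    {C : CommRingCat.{u}} [IsDomain C] (φ : Γ(X, U) ⟶ C) (hφ : φ.hom.FiniteType) :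
    IsRVariety (chartMap hU φ ≫ s) := by
  have := hs.locallyOfFiniteType
  have : LocallyOfFiniteType (Spec.map φ) := HasRingHomProperty.Spec_iff.mpr hφ
  have : LocallyOfFiniteType (chartMap hU φ) := by
    rw [chartMap]
    infer_instance
  exact ⟨inferInstance, inferInstance, inferInstance, inferInstance⟩

lemma isNormalScheme_Spec {C : CommRingCat.{u}} [IsDomain C] [IsIntegrallyClosed C] :
    IsNormalScheme (Spec C) := by
  intro y
  have := y.isPrime
  let _ : Algebra C ((Spec C).presheaf.stalk y) := (toSpecStalk C y).toAlgebra
  have := isLocalization_toSpecStalk C y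
  exact ⟨inferInstance, isIntegrallyClosed_of_isLocalization _ _
    y.asIdeal.primeCompl_le_nonZeroDivisors⟩

lemma coheight_Spec {C : CommRingCat.{u}} (y : Spec C) : Order.coheight y = y.asIdeal.height := by
  have := y.isPrime
  let _ : Algebra C ((Spec C).presheaf.stalk y) := (toSpecStalk C y).toAlgebra
  have := isLocalization_toSpecStalk C y
  have h1 := IsLocalization.AtPrime.ringKrullDim_eq_height y.asIdeal ((Spec C).presheaf.stalk y)
  rw [ringKrullDim_stalk_eq_coheight] at h1
  exact WithBot.coe_injective h1

lemma height_span_singleton_eq_one {C : Type*} [CommRing C] [IsDomain C] [IsNoetherianRing C]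
    {f : C} (hf : Prime f) : (Ideal.span {f}).height = 1 := by
  have : (Ideal.span {f}).IsPrime := (Ideal.span_singleton_prime hf.ne_zero).mpr hf
  refine le_antisymm (Ideal.height_le_one_of_isPrincipal_of_mem_minimalPrimes (Ideal.span {f}) _ ?_) ?_
  · rw [Ideal.minimalPrimes_eq_subsingleton_self]
    exact rfl
  · rw [Order.one_le_iff_pos, pos_iff_ne_zero, Ne, Ideal.height_eq_zero_iff_eq_bot]
    simpa using hf.ne_zero

lemma isIntegrallyClosed_of_isRegularRing (B : Type*) [CommRing B] [IsDomain B] [IsRegularRing B] :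
    IsIntegrallyClosed B := by
  refine IsIntegrallyClosed.of_localization_maximal fun p _ _ ↦ ?_
  have : IsRegularRing (Localization.AtPrime p) := isRegularRing_of_isLocalization p.primeCompl _
  have := uniqueFactorizationMonoid_of_isRegularRing (Localization.AtPrime p)
  infer_instance

/-- The blow-up of a point of codimension two gives a divisor along which the relative canonical
divisor has order at most one. -/
lemma exists_divisorOver_of_coheight_eq_two (hs : IsRVariety s) (hX : IsNonsingular X) {x : X}
    (h2 : Order.coheight x = 2) : ∃ (E : DivisorOver s) (U : X.Opens) (hU : IsAffineOpen U)
      (hx : x ∈ U), E.f E.point = x ∧ E.ordCanonical ≤ 1 ∧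
      ∀ (η₁ η₂ : X) (h₁ : η₁ ∈ U) (h₂ : η₂ ∈ U), (∀ (n₁ n₂ : ℕ) (a : Γ(X, U)),
        (∃ s ∉ primeAt hU η₁ h₁, s * a ∈ primeAt hU η₁ h₁ ^ n₁) →
        (∃ s ∉ primeAt hU η₂ h₂, s * a ∈ primeAt hU η₂ h₂ ^ n₂) →
        ∃ s ∉ primeAt hU x hx, s * a ∈ primeAt hU x hx ^ (n₁ + n₂)) →
      ∀ 𝔞 : RIdeal X, 𝔞.orderAt η₁ + 𝔞.orderAt η₂ ≤ E.ord 𝔞 := by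
  have := hs.isIntegral
  have := isLocallyNoetherian_of_isRVariety hs
  obtain ⟨U, hU, hx, f, g, hf, hfg⟩ := exists_primeAt_eq_span_pair hX x h2
  have : Nonempty U := ⟨⟨x, hx⟩⟩
  have hreg : IsRegularRing Γ(X, U) := isRegularRing_sections hU hX
  have hnoeth : IsNoetherianRing Γ(X, U) := IsLocallyNoetherian.component_noetherian ⟨U, hU⟩
  have hic : IsIntegrallyClosed Γ(X, U) :=
    isIntegrallyClosed_of_isRegularRing _
  have hq : (primeAt hU x hx).height = 2 := by rw [height_primeAt, h2]
  let C : CommRingCat.{u} := CommRingCat.of (blowupChart Γ(X, U) f g)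
  have hCdom : IsDomain C := inferInstanceAs (IsDomain (blowupChart Γ(X, U) f g))
  let φ : Γ(X, U) ⟶ C := CommRingCat.ofHom (algebraMap Γ(X, U) (blowupChart Γ(X, U) f g))
  have hprime : Prime (φ.hom f) := prime_algebraMap_blowupChart hf hq hfg
  have hft : Algebra.FiniteType Γ(X, U) (blowupChart Γ(X, U) f g) := finiteType_blowupChart f g
  have hCn : IsNoetherianRing C := Algebra.FiniteType.isNoetherianRing Γ(X, U) _
  have hCic : IsIntegrallyClosed C := isIntegrallyClosed_blowupChart hprime
  let Q : Ideal C := Ideal.span {φ.hom f}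
  have hQ : Q.IsPrime := (Ideal.span_singleton_prime hprime.ne_zero).mpr hprime
  have hinj : Function.Injective φ.hom := FaithfulSMul.algebraMap_injective _ _
  let y : Spec C := ⟨Q, hQ⟩
  let E : DivisorOver s :=
    { Y := Spec C
      f := chartMap hU φ
      isRVariety := isRVariety_chartMap hs hU φ (RingHom.finiteType_algebraMap.mpr hft)
      isNormal := isNormalScheme_Spec
      isBirational := isBirational_chartMap hU φ hf hinj fun c ↦ by
        obtain ⟨n, b, hb⟩ := exists_pow_mul_mem_range_of_mem_blowupChart hf c.2
        exact ⟨n, b, Subtype.ext hb⟩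
      point := y
      coheight_point := by
        rw [coheight_Spec]
        exact height_span_singleton_eq_one hprime }
  have hxy : chartMap hU φ y = x := by
    refine (Specializes.antisymm ?_ ?_).eq <;>
    rw [← primeAt_le_primeAt_iff hU (by first | exact chartMap_mem hU φ y | exact hx)
      (by first | exact chartMap_mem hU φ y | exact hx), primeAt_chartMap]
    · exact (comap_span_blowupChart hf hq hfg).le
    · exact (comap_span_blowupChart hf hq hfg).ge
  let A := X.presheaf.stalk (chartMap hU φ y)
  let S := (Spec C).presheaf.stalk y
  let _ : Algebra Γ(X, U) A := (X.presheaf.germ U _ (chartMap_mem hU φ y)).hom.toAlgebra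
  let _ : Algebra A S := ((chartMap hU φ).stalkMap y).hom.toAlgebra
  let _ : Algebra (blowupChart Γ(X, U) f g) S := (toSpecStalk C y).toAlgebra
  let _ : Algebra Γ(X, U) S := ((toSpecStalk C y).comp φ.hom).toAlgebra
  have : IsScalarTower Γ(X, U) (blowupChart Γ(X, U) f g) S := IsScalarTower.of_algebraMap_eq' rfl
  have : IsScalarTower Γ(X, U) A S :=
    IsScalarTower.of_algebraMap_eq fun b ↦ (stalkMap_chartMap hU φ y b).symm
  have hloc : IsLocalization.AtPrime S Q := isLocalization_toSpecStalk C y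
  refine ⟨E, U, hU, hx, hxy, idealOrder_fittingIdealZero_blowupChart_le_one (A := A) Q hf rfl,
    fun η₁ η₂ h₁ h₂ hη 𝔞 ↦ ?_⟩
  rw [RIdeal.orderAt, RIdeal.orderAt, ← Finset.sum_add_distrib, DivisorOver.ord]
  refine Finset.sum_le_sum fun j _ ↦ ?_
  rw [← mul_add, ← ENat.toENNReal_add]
  gcongr
  let _ : Algebra Γ(X, U) (X.presheaf.stalk η₁) := (X.presheaf.germ U η₁ h₁).hom.toAlgebra
  let _ : Algebra Γ(X, U) (X.presheaf.stalk η₂) := (X.presheaf.germ U η₂ h₂).hom.toAlgebra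
  have := isLocalization_stalk_primeAt hU η₁ h₁
  have := isLocalization_stalk_primeAt hU η₂ h₂
  have key := add_le_idealOrder_map_blowupChart (S := S) Q hf hq hfg rfl hη
    (X.presheaf.stalk η₁) (X.presheaf.stalk η₂) ((𝔞.ideal j).ideal ⟨U, hU⟩)
  have hp : pullbackStalkIdeal E.f (𝔞.ideal j) E.point =
      ((𝔞.ideal j).ideal ⟨U, hU⟩).map (algebraMap Γ(X, U) S) := by
    rw [pullbackStalkIdeal, stalkIdeal_eq hU _ _ (chartMap_mem hU φ y), Ideal.map_map,
      IsScalarTower.algebraMap_eq Γ(X, U) A S]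
    rfl
  rw [stalkIdeal_eq hU _ _ h₁, stalkIdeal_eq hU _ _ h₂, hp]
  exact key

end

end RVar
namespace RVar

/-! ### The non-normal locus of the union of the non-klt centres of codimension one -/

section

variable {K : Type u} [Field K] {d : ℕ} {X : Scheme.{u}} {s : X ⟶ baseScheme K d}

/-- A point of codimension two at which the union of the non-klt centres of codimension one is not
normal is the generic point of a non-klt centre. -/
lemma isNonKltCentre_closure_singleton (hs : IsRVariety s) (hX : IsNonsingular X) {𝔞 : RIdeal X}
    (hS : codimOneLocus s 𝔞 ≠ ⊤) (z : (codimOneIdeal s 𝔞).subscheme)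
    (hz : z ∈ nonNormalLocus (codimOneIdeal s 𝔞).subscheme)
    (h2 : Order.coheight ((codimOneIdeal s 𝔞).subschemeι z) = 2) :
    IsNonKltCentre s 𝔞 (closure {(codimOneIdeal s 𝔞).subschemeι z}) := by
  have := hs.isIntegral
  have := isLocallyNoetherian_of_isRVariety hs
  set x := (codimOneIdeal s 𝔞).subschemeι z with hxz
  have hxS : x ∈ (codimOneIdeal s 𝔞).support := by
    rw [← SetLike.mem_coe, ← Scheme.IdealSheafData.range_subschemeι]
    exact ⟨z, rfl⟩
  obtain ⟨E, U, hU, hx, hEx, hcan, hord⟩ := exists_divisorOver_of_coheight_eq_two hs hX h2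
  have : Nonempty U := ⟨⟨x, hx⟩⟩
  have hreg : IsRegularRing Γ(X, U) := isRegularRing_sections hU hX
  have hN : ¬ IsNormalQuotientAt ((codimOneIdeal s 𝔞).ideal ⟨U, hU⟩) (primeAt hU x hx) :=
    fun h ↦ hz ((isNormalLocalRing_subscheme_iff hU _ z hx).mpr h)
  obtain ⟨p₁, p₂, hp₁, hp₂, h₁, h₂, hI₁, hI₂, -, -, hp⟩ :=
    exists_mul_mem_pow_of_not_isNormalQuotientAt (isRadical_codimOneIdeal 𝔞 ⟨U, hU⟩)
      (hasHeightOnePrimesBelow_codimOneIdeal hs hX hS hU)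
      ((ideal_le_primeAt_iff hU _ x hx).mpr hxS) (by rw [height_primeAt, h2]) hN
  obtain ⟨η₁, hη₁, rfl⟩ := exists_primeAt_eq hU p₁
  obtain ⟨η₂, hη₂, rfl⟩ := exists_primeAt_eq hU p₂
  rw [height_primeAt] at h₁ h₂
  rw [ideal_le_primeAt_iff, mem_support_codimOneIdeal] at hI₁ hI₂
  refine ⟨E, by rw [DivisorOver.centre_eq, hEx], ?_⟩
  -- The points `η₁` and `η₂` may coincide; the order of `𝔞` there is then counted twice.
  have hle : (1 : ℝ≥0∞) + 1 ≤ E.ord 𝔞 :=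
    (add_le_add (one_le_orderAt_of_mem_codimOneLocus hs hX hS hI₁ h₁)
      (one_le_orderAt_of_mem_codimOneLocus hs hX hS hI₂ h₂)).trans (hord η₁ η₂ hη₁ hη₂ hp 𝔞)
  have hle' : (1 : ℝ≥0∞) + (E.ordCanonical : ℝ≥0∞) ≤ E.ord 𝔞 := by
    refine le_trans ?_ hle
    gcongr
    exact_mod_cast hcan
  rw [DivisorOver.logDiscrepancy, EReal.sub_nonpos, ← EReal.coe_ennreal_one,
    ← EReal.coe_ennreal_add, EReal.coe_ennreal_le_coe_ennreal_iff]
  exact hle'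

/-- The contrapositive of stability of normality under generization, inside one affine chart. -/
lemma mem_nonNormalLocus_of_specializes (I : X.IdealSheafData)
    {z w : I.subscheme} (h : z ⤳ w) (hz : z ∈ nonNormalLocus I.subscheme) :
    w ∈ nonNormalLocus I.subscheme := by
  intro hw
  obtain ⟨U, hU, hx, -⟩ := exists_isAffineOpen_mem_and_subset (U := ⊤) (x := I.subschemeι w) trivial
  have h' := h.map I.subschemeι.continuous
  have hzU := h'.mem_open U.isOpen hx
  rw [isNormalLocalRing_subscheme_iff hU _ w hx] at hw
  refine hz ((isNormalLocalRing_subscheme_iff hU _ z hzU).mpr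
    (IsNormalQuotientAt.mono inferInstance ?_ ((primeAt_le_primeAt_iff hU hzU hx).mpr h') hw))
  rw [ideal_le_primeAt_iff, ← SetLike.mem_coe, ← Scheme.IdealSheafData.range_subschemeι]
  exact ⟨z, rfl⟩

/-- Near a point, the non-normal locus of the union of the non-klt centres of codimension one is
covered by the closures of finitely many points of codimension two. -/
lemma exists_finite_specializes_of_mem_nonNormalLocus [CharZero K] (hs : IsRVariety s)
    (hX : IsNonsingular X) {𝔞 : RIdeal X} (hS : codimOneLocus s 𝔞 ≠ ⊤) {U : X.Opens}
    (hU : IsAffineOpen U) (hne : Nonempty U) :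
    ∃ F : Set (codimOneIdeal s 𝔞).subscheme, F.Finite ∧
      (∀ z ∈ F, z ∈ nonNormalLocus (codimOneIdeal s 𝔞).subscheme ∧
        Order.coheight ((codimOneIdeal s 𝔞).subschemeι z) = 2) ∧
      ∀ w ∈ nonNormalLocus (codimOneIdeal s 𝔞).subscheme, (codimOneIdeal s 𝔞).subschemeι w ∈ U →
        ∃ z ∈ F, z ⤳ w := by
  have := hs.isIntegral
  have := isLocallyNoetherian_of_isRVariety hs
  have hreg : IsRegularRing Γ(X, U) := isRegularRing_sections hU hX
  have hI := isRadical_codimOneIdeal (s := s) 𝔞 ⟨U, hU⟩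
  have h1 := hasHeightOnePrimesBelow_codimOneIdeal hs hX hS hU
  obtain ⟨g, hg⟩ := exists_finiteType_sections hs hU
  have hfin := finite_height_eq_two hI h1 fun p hp ↦ isGenericallyNormal_of_finiteType g hg p
  set ι := (codimOneIdeal s 𝔞).subschemeι
  have hsupp : ∀ z, ι z ∈ (codimOneIdeal s 𝔞).support := fun z ↦ by
    rw [← SetLike.mem_coe, ← Scheme.IdealSheafData.range_subschemeι]
    exact ⟨z, rfl⟩
  have hemb := ι.isClosedEmbedding
  refine ⟨{z | z ∈ nonNormalLocus (codimOneIdeal s 𝔞).subscheme ∧ Order.coheight (ι z) = 2 ∧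
    ι z ∈ U}, ?_, fun z hz ↦ ⟨hz.1, hz.2.1⟩, fun w hw hwU ↦ ?_⟩
  · have hfin' := (((hfin.preimage (fun p _ p' _ h ↦ PrimeSpectrum.ext h :
      Set.InjOn (PrimeSpectrum.asIdeal (R := Γ(X, U))) _)).image hU.fromSpec).preimage
        hemb.injective.injOn)
    refine hfin'.subset ?_
    rintro z ⟨hz, hz2, hzU⟩
    refine ⟨hU.primeIdealOf ⟨ι z, hzU⟩, ⟨PrimeSpectrum.isPrime _, ?_, ?_, ?_⟩,
      hU.fromSpec_primeIdealOf ⟨ι z, hzU⟩⟩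
    · exact (ideal_le_primeAt_iff hU _ (ι z) hzU).mpr (hsupp z)
    · rw [← hz2]
      exact height_primeAt hU (ι z) hzU
    · exact fun h ↦ hz ((isNormalLocalRing_subscheme_iff hU _ z hzU).mpr h)
  · obtain ⟨q', hq', hIq', hq'q, hq'2, hN⟩ := exists_le_height_eq_two hI h1 _ inferInstance
      ((ideal_le_primeAt_iff hU _ (ι w) hwU).mpr (hsupp w))
      fun h ↦ hw ((isNormalLocalRing_subscheme_iff hU _ w hwU).mpr h)
    obtain ⟨x, hx, rfl⟩ := exists_primeAt_eq hU q'
    rw [ideal_le_primeAt_iff, ← SetLike.mem_coe, ← Scheme.IdealSheafData.range_subschemeι] at hIq'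
    obtain ⟨z, rfl⟩ := hIq'
    rw [height_primeAt] at hq'2
    rw [primeAt_le_primeAt_iff] at hq'q
    exact ⟨z, ⟨fun h ↦ hN ((isNormalLocalRing_subscheme_iff hU _ z hx).mp h), hq'2, hx⟩,
      hemb.isInducing.specializes_iff.mp hq'q⟩

end

end RVar

/-! ### Irreducible components of the non-normal locus -/

theorem mainTheorem9 {K : Type u} [Field K] [CharZero K] {d : ℕ} {X : Scheme.{u}}
    (s : X ⟶ RVar.baseScheme K d) (hs : RVar.IsRVariety s) (hX : RVar.IsNonsingular X)
    (𝔞 : RVar.RIdeal X)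
    (D : Set (RVar.nonNormalLocus (RVar.codimOneIdeal s 𝔞).subscheme))
    (hD : D ∈ irreducibleComponents (RVar.nonNormalLocus (RVar.codimOneIdeal s 𝔞).subscheme)) :
    RVar.IsNonKltCentre s 𝔞
      ((RVar.codimOneIdeal s 𝔞).subschemeι '' (Subtype.val '' D)) := by
  obtain ⟨⟨w₀, hw₀⟩, hw₀D⟩ := hD.1.nonempty
  have hS : RVar.codimOneLocus s 𝔞 ≠ ⊤ := by
    intro hS
    rw [RVar.nonNormalLocus_codimOneIdeal_eq_empty hs hX hS] at hw₀
    exact hw₀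
  set ι := (RVar.codimOneIdeal s 𝔞).subschemeι
  obtain ⟨U, hU, hwU, -⟩ := exists_isAffineOpen_mem_and_subset (U := ⊤) (x := ι w₀) trivial
  obtain ⟨F, hF, hFN, hFw⟩ := RVar.exists_finite_specializes_of_mem_nonNormalLocus hs hX hS hU
    ⟨⟨_, hwU⟩⟩
  let c : RVar.nonNormalLocus (RVar.codimOneIdeal s 𝔞).subscheme → X := fun w ↦ ι w.1
  have hc : Continuous c := ι.continuous.comp continuous_subtype_val
  -- The finite cover is available only over the affine open `U`, but the part of `D` over `U` is
  -- dense in `D` by irreducibility.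
  have hcov : D ⊆ ⋃₀ ((fun z ↦ Subtype.val ⁻¹' closure {z}) '' F) := by
    refine (subset_closure_inter_of_isPreirreducible_of_isOpen hD.1.isPreirreducible
      (U.isOpen.preimage hc) ⟨⟨w₀, hw₀⟩, hw₀D, hwU⟩).trans (closure_minimal ?_ ?_)
    · rintro w ⟨-, hw⟩
      obtain ⟨z, hz, hzw⟩ := hFw w.1 w.2 hw
      exact ⟨_, ⟨z, hz, rfl⟩, hzw.mem_closure⟩
    · rw [Set.sUnion_image]
      exact hF.isClosed_biUnion fun z _ ↦ isClosed_closure.preimage continuous_subtype_val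
  have hfin := hF.image fun z ↦
    (Subtype.val ⁻¹' closure {z} : Set (RVar.nonNormalLocus (RVar.codimOneIdeal s 𝔞).subscheme))
  obtain ⟨Z, hZ, hDZ⟩ := isIrreducible_iff_sUnion_isClosed.mp hD.1 hfin.toFinset
    (fun Z hZ ↦ by
      obtain ⟨z, -, rfl⟩ := hfin.mem_toFinset.mp hZ
      exact isClosed_closure.preimage continuous_subtype_val)
    (by rwa [Set.Finite.coe_toFinset])
  obtain ⟨z, hz, rfl⟩ := hfin.mem_toFinset.mp hZ
  have hDz : ∀ w ∈ D, z ⤳ w.1 := fun w hw ↦ specializes_iff_mem_closure.mpr (hDZ hw)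
  obtain ⟨hzN, hz2⟩ := hFN z hz
  -- Since `z` itself lies in the non-normal locus, its closure there is irreducible, and maximality
  -- of `D` gives equality.
  have hDeq : D = closure {⟨z, hzN⟩} := by
    have hsub : D ⊆ closure {⟨z, hzN⟩} := fun w hw ↦
      (Topology.IsInducing.subtypeVal.specializes_iff.mp (hDz w hw) : _ ⤳ w).mem_closure
    exact hsub.antisymm (hD.2 isIrreducible_singleton.closure hsub)
  have himage : ι '' (Subtype.val '' D) = closure {ι z} := by
    refine Set.Subset.antisymm ?_ fun x hx ↦ ?_
    · rintro _ ⟨_, ⟨w, hw, rfl⟩, rfl⟩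
      rw [hDeq, ← specializes_iff_mem_closure] at hw
      exact (hw.map hc).mem_closure
    · rw [← specializes_iff_mem_closure] at hx
      -- The full closure in `X` is reached because the subscheme is closed and the non-normal locus
      -- is stable under specialization.
      have hxr : x ∈ Set.range ι := hx.mem_closed ι.isClosedEmbedding.isClosed_range ⟨z, rfl⟩
      obtain ⟨w, rfl⟩ := hxr
      have hzw : z ⤳ w := ι.isClosedEmbedding.isInducing.specializes_iff.mp hx
      refine ⟨w, ⟨⟨w, RVar.mem_nonNormalLocus_of_specializes _ hzw hzN⟩, ?_, rfl⟩, rfl⟩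
      rw [hDeq, ← specializes_iff_mem_closure]
      exact Topology.IsInducing.subtypeVal.specializes_iff.mp hzw
  rw [himage]
  exact RVar.isNonKltCentre_closure_singleton hs hX hS z hzN hz2
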